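/- Conventions. A formal power series $f=\sum_{k\in\mathbb N^n} a_kx^k$ over $\mathbb C$ is Gevrey-$\alpha$ if there are $C,r>0$ with $\sum_{|k|=l}|a_k|\le C r^l (l!)^\alpha$ for all $l\ge 0$; a formal vector field $X=\sum_i X_i\,\partial/\partial x_i$ or a formal map on $\mathbb C^n$ is Gevrey-$\alpha$ if all its components are. A formal transformation is a formal map $\Phi$ with $\Phi(0)=0$ that has a formal compositional inverse $\Psi=\Phi^{-1}$, and $\Phi_*X=X'$ means $X\circ\Psi=D\Psi\cdot X'$. $X$ is formally linearizable if $\Phi_*X$ is a linear vector field for some formal transformation $\Phi$. A linear vector field is nilpotent if, for each $d\ge1$, it acts as a nilpotent operator on the homogeneous polynomials of degree $d$. Call a linear vector field $N$ standard if, up to the numbering of the coordinates, it is a direct sum of blocks $\sum_{i=1}^{k}\sqrt{i(k+1-i)}\,x_{i+1}\,\partial/\partial x_i$ on $\mathbb C^{k+1}$ ($k\ge0$). For $d\ge2$ give the space of vector fields with components homogeneous of degree $d$ the inner product $\langle V,W\rangle=\sum_{i=1}^n\sum_{|k|=d}V_{i,k}\overline{W_{i,k}}\,\frac{k!}{|k|!}$,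 where $V_{i,k},W_{i,k}$ are the coefficients of $x^k$ in the $i$-th components; let $d_0(U)=DU\cdot N-DN\cdot U$ on this space, and let $d_0^*$ be its adjoint. A formal vector field $X'=N+R'$, with $R'$ of order $\ge2$, is in normal form if every homogeneous part $R'_d$ ($d\ge2$) lies in $\operatorname{Ker} d_0^*$. Theorem. Let $\alpha\ge0$ and let $X=L+R$ be a formal Gevrey-$\alpha$ vector field on $\mathbb C^n$ with $L$ linear and nilpotent and $R$ of order $\ge2$. There is an invertible matrix $P$ such that $N=P^{-1}LP$ is standard, and for every such $P$ there are a formal series $U$ of order $\ge2$ with all homogeneous parts $U_d$ ($d\ge2$) in $\operatorname{Im} d_0^*$, a formal transformation $\Phi$ with inverse $\Phi^{-1}=P\circ(\mathrm{id}+U)$, and a vector field $X'=N+R'$ in normal form, such that $\Phi_*X=X'$ and $\Phi$, $\Phi^{-1}$ and $X'$ are Gevrey-$(1+\alpha)$. If $X$ is moreover formally linearizable, then these same $\Phi$, $\Phi^{-1}$ and $X'$ are Gevrey-$\alpha$, and $X'=N$. -/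

import Mathlib

noncomputable section

namespace GevreyNF

/-- Formal vector fields `∑ Vᵢ ∂/∂xᵢ` in `n` complex variables, and also formal maps, given by
their tuple of components. -/
abbrev FormalField (n : ℕ) : Type := Fin n → MvPowerSeries (Fin n) ℂ

/-- The multi-indices `k ∈ ℕⁿ` with `|k| = l`. -/
def multiIndices (n l : ℕ) : Finset (Fin n →₀ ℕ) :=
  Finset.finsuppAntidiag Finset.univ l

/-- A power series `∑ aₖ xᵏ` is Gevrey-`α` if there are `C, r > 0` such that
`∑_{|k| = l} |aₖ| ≤ C r ^ l (l!) ^ α` for all `l`. -/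
def IsGevreySeries {n : ℕ} (α : ℝ) (f : MvPowerSeries (Fin n) ℂ) : Prop :=
  ∃ C r : ℝ, 0 < C ∧ 0 < r ∧ ∀ l : ℕ,
    ∑ k ∈ multiIndices n l, ‖MvPowerSeries.coeff k f‖ ≤ C * r ^ l * (l.factorial : ℝ) ^ α

/-- A formal vector field (or map) is Gevrey-`α` if each component is. -/
def IsGevrey {n : ℕ} (α : ℝ) (V : FormalField n) : Prop :=
  ∀ i, IsGevreySeries α (V i)

/-- The formal vector field (or map) vanishes at the origin. -/
def VanishesAtZero {n : ℕ} (V : FormalField n) : Prop :=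
  ∀ i, MvPowerSeries.constantCoeff (V i) = 0

/-- The matrix of the linear part at the origin: the `(i, j)` entry is the coefficient of `xⱼ` in
the `i`-th component. -/
def linearPart {n : ℕ} (V : FormalField n) : Matrix (Fin n) (Fin n) ℂ :=
  fun i j => MvPowerSeries.coeff (Finsupp.single j 1) (V i)

/-- The linear vector field (or linear map) `x ↦ A x`. -/
def linearField {n : ℕ} (A : Matrix (Fin n) (Fin n) ℂ) : FormalField n :=
  fun i => ∑ j, A i j • MvPowerSeries.X j

/-- The action `f ↦ ∑ᵢ Vᵢ ∂f/∂xᵢ` of a vector field on power series. -/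
def derivAlong {n : ℕ} (V : FormalField n) (f : MvPowerSeries (Fin n) ℂ) :
    MvPowerSeries (Fin n) ℂ :=
  ∑ i, V i * MvPowerSeries.pderiv ℂ i f

/-- Every component of `V` is a homogeneous polynomial of degree `d`. -/
def IsHomogeneousField {n : ℕ} (d : ℕ) (V : FormalField n) : Prop :=
  ∀ i, (V i).IsHomogeneous d

/-- The part of `V` whose components are homogeneous of degree `d`. -/
def homogeneousPart {n : ℕ} (d : ℕ) (V : FormalField n) : FormalField n :=
  fun i => (V i).homogeneousComponent d

/-- The linear vector field `x ↦ A x` is nilpotent: it acts nilpotently on the homogeneous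
polynomials of each degree `d ≥ 1`. -/
def IsNilpotentLinear {n : ℕ} (A : Matrix (Fin n) (Fin n) ℂ) : Prop :=
  ∀ d : ℕ, 1 ≤ d → ∃ k : ℕ, ∀ f : MvPowerSeries (Fin n) ℂ, f.IsHomogeneous d →
    (derivAlong (linearField A))^[k] f = 0

/-- The operator `d₀ : U ↦ DU · N - DN · U` for the linear vector field `N = A x`, which is the
Lie bracket with `N`. -/
def lieOp {n : ℕ} (A : Matrix (Fin n) (Fin n) ℂ) (U : FormalField n) : FormalField n :=
  fun i => derivAlong (linearField A) (U i) - derivAlong U (linearField A i)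

/-- The inner product `∑_{|k| = d} aₖ conj(bₖ) k! / |k|!` of polynomials homogeneous of
degree `d`. -/
def polyInner {n : ℕ} (d : ℕ) (f g : MvPowerSeries (Fin n) ℂ) : ℂ :=
  ∑ k ∈ multiIndices n d,
    MvPowerSeries.coeff k f * (starRingEnd ℂ) (MvPowerSeries.coeff k g) *
      ((∏ i, ((k i).factorial : ℂ)) / (d.factorial : ℂ))

/-- The inner product of vector fields with components homogeneous of degree `d`. -/
def fieldInner {n : ℕ} (d : ℕ) (V W : FormalField n) : ℂ :=
  ∑ i, polyInner d (V i) (W i)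

/-- `U = d₀* V`, where `d₀*` is the adjoint of `d₀ = lieOp A` on the finite-dimensional space of
vector fields with components homogeneous of degree `d`: by definition `d₀* V` is the unique
element of this space with `⟨d₀* V, W⟩ = ⟨V, d₀ W⟩` for all `W` in it. -/
def IsAdjointValue {n : ℕ} (A : Matrix (Fin n) (Fin n) ℂ) (d : ℕ) (V U : FormalField n) : Prop :=
  IsHomogeneousField d U ∧
    ∀ W : FormalField n, IsHomogeneousField d W → fieldInner d U W = fieldInner d V (lieOp A W)

/-- `V ∈ Ker d₀*` in degree `d`. -/
def InKerAdjoint {n : ℕ} (A : Matrix (Fin n) (Fin n) ℂ) (d : ℕ) (V : FormalField n) : Prop :=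
  IsHomogeneousField d V ∧ IsAdjointValue A d V 0

/-- `U ∈ Im d₀*` in degree `d`. -/
def InRangeAdjoint {n : ℕ} (A : Matrix (Fin n) (Fin n) ℂ) (d : ℕ) (U : FormalField n) : Prop :=
  ∃ V : FormalField n, IsHomogeneousField d V ∧ IsAdjointValue A d V U

/-- `X' = N + R'`, with `N = A x` and `R'` of order `≥ 2`, is in normal form: every homogeneous
part of `R'` lies in `Ker d₀*`. -/
def IsNormalForm {n : ℕ} (A : Matrix (Fin n) (Fin n) ℂ) (X' : FormalField n) : Prop :=
  VanishesAtZero X' ∧ linearPart X' = A ∧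
    ∀ d : ℕ, 2 ≤ d → InKerAdjoint A d (homogeneousPart d X')

/-- `U` has order `≥ 2` and each of its homogeneous parts lies in `Im d₀*`. -/
def IsNormalizedCorrection {n : ℕ} (A : Matrix (Fin n) (Fin n) ℂ) (U : FormalField n) : Prop :=
  VanishesAtZero U ∧ linearPart U = 0 ∧
    ∀ d : ℕ, 2 ≤ d → InRangeAdjoint A d (homogeneousPart d U)

/-- The composition `V ∘ Ψ` (used for `Ψ` without constant term). -/
def compose {n : ℕ} (V Ψ : FormalField n) : FormalField n :=
  fun i => MvPowerSeries.subst Ψ (V i)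

/-- `Φ` and `Ψ` are formal transformations fixing the origin, inverse to each other. -/
def AreInverse {n : ℕ} (Φ Ψ : FormalField n) : Prop :=
  VanishesAtZero Φ ∧ VanishesAtZero Ψ ∧
    compose Φ Ψ = MvPowerSeries.X ∧ compose Ψ Φ = MvPowerSeries.X

/-- `Φ_* X = X'` where `Φ` is the formal transformation with inverse `Ψ`, that is,
`X ∘ Ψ = DΨ · X'`. -/
def TransformsTo {n : ℕ} (Ψ X X' : FormalField n) : Prop :=
  compose X Ψ = fun i => derivAlong X' (Ψ i)

/-- `X` can be brought to a linear vector field by a formal transformation. -/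
def IsFormallyLinearizable {n : ℕ} (X : FormalField n) : Prop :=
  ∃ (Φ Ψ : FormalField n) (B : Matrix (Fin n) (Fin n) ℂ),
    AreInverse Φ Ψ ∧ TransformsTo Ψ X (linearField B)

/-- The matrix of the vector field `∑_{i=1}^{k} √(i (k + 1 - i)) x_{i+1} ∂/∂xᵢ` on `ℂ^(k+1)`
(the indices below start at `0`). -/
def nilpotentBlock (k : ℕ) : Matrix (Fin (k + 1)) (Fin (k + 1)) ℂ :=
  fun i j => if (i : ℕ) + 1 = j then ((Real.sqrt (((i : ℝ) + 1) * ((k : ℝ) - i)) : ℝ) : ℂ) else 0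

/-- `A` is, up to the numbering of the coordinates, a direct sum of nilpotent blocks (of arbitrary
sizes, including size one) as above. -/
def IsStandardNilpotent {n : ℕ} (A : Matrix (Fin n) (Fin n) ℂ) : Prop :=
  ∃ (m : ℕ) (k : Fin m → ℕ) (e : (Σ j : Fin m, Fin (k j + 1)) ≃ Fin n),
    A = Matrix.reindex e e (Matrix.blockDiagonal' fun j => nilpotentBlock (k j))

/-- The linear change of coordinates `x = P y` brings the linear vector field `x ↦ A x` to a
standard nilpotent one, `y ↦ P⁻¹ A P y`. -/
def Standardizes {n : ℕ} (P A : Matrix (Fin n) (Fin n) ℂ) : Prop :=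
  IsUnit P.det ∧ IsStandardNilpotent (P⁻¹ * A * P)

end GevreyNF

end

open GevreyNF

noncomputable section

namespace GevreyNF

open MvPowerSeries Finsupp

variable {n : ℕ}

/-! ### Order of vanishing, substitution and composition -/

/-! After the linear change `P` one seeks `id + U` conjugating `N + R` to `N + S`, where `N = A x`
is standard. The conjugacy relation reads `d₀ U + S = R ∘ (id + U) - DU · S`. Call the right-hand
side `W`. Since `R`, `U`, `S` have order at least two, the part of `W` of degree `d` involves only
parts of `U` and `S` of smaller degree. Splitting each `W_d` orthogonally as `d₀ U_d + S_d`, with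
`U_d` in `Im d₀*` and `S_d` in `Ker d₀*`, therefore gives a formal solution (`exists_solution`, a
fixed point argument on `W`).

The splitting costs nothing in norm, uniformly in `d`. For the Fischer inner product the adjoint of
`d₀` is the bracket with the conjugate transpose of `A` (`fieldInner_lieOp_conjTranspose`). For
standard `A` these two operators and their commutator form an `𝔰𝔩₂` triple with integral weights, so
`d₀ d₀*` has integer eigenvalues (`exists_int_eq_of_eigenvalue`). An integer is at most its square,
hence `‖d₀* w‖ ≤ ‖d₀ d₀* w‖` (`norm_lieEnd_ge`), and `‖U_d‖`, `‖S_d‖` are at most `‖W_d‖`.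

The Fischer norm is submultiplicative (`fischerNorm_mul_le`), so the truncated majorants `∑ ‖W_d‖ t
^ d / (d!) ^ β` satisfy a quadratic recursion in the truncation degree, and they stay bounded once
`t` is small (`isGevrey_of_conjugacy_equation`). Substitution into `R` is harmless for every `β ≥
α`. Only the term `DU · S` loses a factor, the degree, through the derivative; the factorial weights
absorb it when `β ≥ 1`. This is the sole source of the loss in the Gevrey order.

If `X` is formally linearizable, so is its normal form, and the lowest nonlinear part of the latter
then lies both in `Im d₀` and in `Ker d₀*`. These are orthogonal, so the normal form is linear
(`eq_linearField_of_isNormalForm`). Then `S = 0`, the bad term disappears and `β = α` is allowed.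
The inverse of `id + U` solves an equation of the same shape with `S = 0`, so the same estimate
covers it. -/

theorem mem_multiIndices {l : ℕ} {k : Fin n →₀ ℕ} : k ∈ multiIndices n l ↔ degree k = l := by
  simp [multiIndices, Finset.mem_finsuppAntidiag, degree_eq_sum]

/-- The power series all of whose coefficients of degree less than `m` vanish. -/
def ordGE (n m : ℕ) : Submodule ℂ (MvPowerSeries (Fin n) ℂ) where
  carrier := {f | ∀ k, degree k < m → coeff k f = 0}
  add_mem' := fun hf hg k hk => by rw [map_add, hf k hk, hg k hk, add_zero]
  zero_mem' := fun k _ => by simp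
  smul_mem' := fun c f hf k hk => by
    simp [hf k hk]

theorem ordGE_mono {a b : ℕ} (h : a ≤ b) {f : MvPowerSeries (Fin n) ℂ} (hf : f ∈ ordGE n b) :
    f ∈ ordGE n a := fun k hk => hf k (hk.trans_le h)

theorem mem_ordGE_zero (f : MvPowerSeries (Fin n) ℂ) : f ∈ ordGE n 0 :=
  fun _ hk => absurd hk (Nat.not_lt_zero _)

theorem mul_mem_ordGE {a b : ℕ} {f g : MvPowerSeries (Fin n) ℂ} (hf : f ∈ ordGE n a)
    (hg : g ∈ ordGE n b) : f * g ∈ ordGE n (a + b) := by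
  classical
  intro k hk
  rw [coeff_mul]
  refine Finset.sum_eq_zero fun p hp => ?_
  have h : degree p.1 + degree p.2 = degree k := by
    rw [← Finset.HasAntidiagonal.mem_antidiagonal.mp hp, map_add]
  by_cases h1 : degree p.1 < a
  · rw [hf _ h1, zero_mul]
  · rw [hg _ (by omega), mul_zero]

theorem mem_ordGE_one {f : MvPowerSeries (Fin n) ℂ} : f ∈ ordGE n 1 ↔ constantCoeff f = 0 := by
  constructor
  · intro h
    rw [← coeff_zero_eq_constantCoeff_apply]
    exact h 0 (by simp)
  · intro h k hk
    have : k = 0 := by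
      rw [← degree_eq_zero_iff]; omega
    rw [this, coeff_zero_eq_constantCoeff_apply, h]

theorem X_mem_ordGE_one (i : Fin n) : (X i : MvPowerSeries (Fin n) ℂ) ∈ ordGE n 1 :=
  mem_ordGE_one.mpr (by simp)

theorem eq_zero_of_forall_mem_ordGE {f : MvPowerSeries (Fin n) ℂ} (h : ∀ m, f ∈ ordGE n m) :
    f = 0 := by
  ext k
  simpa using h (degree k + 1) k (Nat.lt_succ_self _)

theorem pderiv_mem_ordGE {m : ℕ} {f : MvPowerSeries (Fin n) ℂ} (hf : f ∈ ordGE n (m + 1))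
    (i : Fin n) : pderiv ℂ i f ∈ ordGE n m := by
  intro k hk
  rw [coeff_pderiv, hf _ (by simpa using hk), zero_mul]

theorem exists_eq_add_single {l : ℕ} {k : Fin n →₀ ℕ} (h : degree k = l + 1) :
    ∃ (k' : Fin n →₀ ℕ) (i : Fin n), degree k' = l ∧ k = k' + single i 1 := by
  have hk : k ≠ 0 := by
    rintro rfl
    simp at h
  obtain ⟨i, hi⟩ := Finsupp.ne_iff.mp hk
  have hle : single i 1 ≤ k := by
    rw [Finsupp.single_le_iff]
    exact Nat.one_le_iff_ne_zero.mpr hi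
  have h2 : k = (k - single i 1) + single i 1 := (tsub_add_cancel_of_le hle).symm
  refine ⟨k - single i 1, i, ?_, h2⟩
  have h3 := congrArg degree h2
  rw [map_add, degree_single] at h3
  omega

/-! ### Substitution of maps without constant term -/

/-- The monomial `Ψᵏ = ∏ᵢ Ψᵢ ^ kᵢ`. -/
def mpow (Ψ : FormalField n) (k : Fin n →₀ ℕ) : MvPowerSeries (Fin n) ℂ :=
  k.prod fun s e => Ψ s ^ e

@[simp] theorem mpow_zero (Ψ : FormalField n) : mpow Ψ 0 = 1 := by simp [mpow]

theorem mpow_add_single (Ψ : FormalField n) (k : Fin n →₀ ℕ) (i : Fin n) :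
    mpow Ψ (k + single i 1) = mpow Ψ k * Ψ i := by
  rw [mpow, Finsupp.prod_add_index' (by simp) (by intros; rw [pow_add])]
  simp [mpow]

theorem mpow_mem_ordGE {Ψ : FormalField n} (hΨ : ∀ i, Ψ i ∈ ordGE n 1) {l : ℕ} :
    ∀ {k : Fin n →₀ ℕ}, degree k = l → mpow Ψ k ∈ ordGE n l := by
  induction l with
  | zero => intro k _; exact mem_ordGE_zero _
  | succ l ih =>
    intro k hk
    obtain ⟨k', i, hk', rfl⟩ := exists_eq_add_single hk
    rw [mpow_add_single]
    exact mul_mem_ordGE (ih hk') (hΨ i)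

/-- Telescoping: each of the `l` factors is exchanged in turn for one differing from it in order
`m`, while the other `l - 1` factors have order at least one. -/
theorem mpow_sub_mem_ordGE {Ψ Ψ' : FormalField n} (hΨ : ∀ i, Ψ i ∈ ordGE n 1)
    (hΨ' : ∀ i, Ψ' i ∈ ordGE n 1) {m : ℕ} (h : ∀ i, Ψ i - Ψ' i ∈ ordGE n m) {l : ℕ} :
    ∀ {k : Fin n →₀ ℕ}, degree k = l → mpow Ψ k - mpow Ψ' k ∈ ordGE n (m + l - 1) := by
  induction l with
  | zero =>
    intro k hk
    rw [degree_eq_zero_iff] at hk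
    simp [hk]
  | succ l ih =>
    intro k hk
    obtain ⟨k', i, hk', rfl⟩ := exists_eq_add_single hk
    rw [mpow_add_single, mpow_add_single]
    have : mpow Ψ k' * Ψ i - mpow Ψ' k' * Ψ' i =
        mpow Ψ k' * (Ψ i - Ψ' i) + (mpow Ψ k' - mpow Ψ' k') * Ψ' i := by ring
    rw [this]
    refine Submodule.add_mem _ ?_ ?_
    · exact ordGE_mono (by omega) (mul_mem_ordGE (mpow_mem_ordGE hΨ hk') (h i))
    · exact ordGE_mono (by omega) (mul_mem_ordGE (ih hk') (hΨ' i))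

theorem hasSubst_of_ordGE {Ψ : FormalField n} (hΨ : ∀ i, Ψ i ∈ ordGE n 1) : HasSubst Ψ :=
  hasSubst_of_constantCoeff_zero fun i => mem_ordGE_one.mp (hΨ i)

theorem subst_zero {Ψ : FormalField n} (hΨ : ∀ i, Ψ i ∈ ordGE n 1) :
    subst Ψ (0 : MvPowerSeries (Fin n) ℂ) = 0 := by
  rw [← coe_substAlgHom (hasSubst_of_ordGE hΨ), map_zero]

theorem subst_one {Ψ : FormalField n} (hΨ : ∀ i, Ψ i ∈ ordGE n 1) :
    subst Ψ (1 : MvPowerSeries (Fin n) ℂ) = 1 := by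
  rw [← coe_substAlgHom (hasSubst_of_ordGE hΨ), map_one]

/-- Since `Ψᵏ` has order at least `|k|`, only `|k| ≤ degree e` matters. The free bound `D` makes one
finite sum serve all coefficients of degree at most `D` at once. -/
theorem coeff_subst_eq_sum {Ψ : FormalField n} (hΨ : ∀ i, Ψ i ∈ ordGE n 1)
    (f : MvPowerSeries (Fin n) ℂ) {e : Fin n →₀ ℕ} {D : ℕ} (he : degree e ≤ D) :
    coeff e (subst Ψ f) = ∑ l ∈ Finset.range (D + 1), ∑ k ∈ multiIndices n l,
      coeff k f * coeff e (mpow Ψ k) := by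
  classical
  rw [coeff_subst (hasSubst_of_ordGE hΨ)]
  have hd : (Finset.range (D + 1) : Set ℕ).PairwiseDisjoint (multiIndices n) := by
    intro a _ b _ hab
    refine Finset.disjoint_left.mpr fun k hk hk' => hab ?_
    rw [← mem_multiIndices.mp hk, mem_multiIndices.mp hk']
  rw [← Finset.sum_biUnion hd]
  refine finsum_eq_finsetSum_of_support_subset _ fun k hk => ?_
  simp only [Finset.coe_biUnion, Set.mem_iUnion, Finset.mem_coe, mem_multiIndices, exists_prop,
    Finset.mem_range]
  by_contra hlt
  refine hk ?_
  have : coeff e (mpow Ψ k) = 0 := mpow_mem_ordGE hΨ rfl e (by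
    by_contra h
    exact hlt ⟨degree k, by omega, rfl⟩)
  change coeff k f • coeff e (mpow Ψ k) = 0
  rw [this, smul_zero]

theorem subst_mem_ordGE {Ψ : FormalField n} (hΨ : ∀ i, Ψ i ∈ ordGE n 1) {m : ℕ}
    {f : MvPowerSeries (Fin n) ℂ} (hf : f ∈ ordGE n m) : subst Ψ f ∈ ordGE n m := by
  intro e he
  rw [coeff_subst_eq_sum hΨ f le_rfl]
  refine Finset.sum_eq_zero fun l hl => Finset.sum_eq_zero fun k hk => ?_
  rw [Finset.mem_range] at hl
  rw [hf k (by rw [mem_multiIndices.mp hk]; omega), zero_mul]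

/-- The contraction property behind every degree-by-degree argument: for `l ≥ 2`, changing `Ψ` in
order `m` changes `f ∘ Ψ` only in order `m + 1` or higher. -/
theorem subst_sub_subst_mem_ordGE {Ψ Ψ' : FormalField n} (hΨ : ∀ i, Ψ i ∈ ordGE n 1)
    (hΨ' : ∀ i, Ψ' i ∈ ordGE n 1) {m l : ℕ} (h : ∀ i, Ψ i - Ψ' i ∈ ordGE n m)
    {f : MvPowerSeries (Fin n) ℂ} (hf : f ∈ ordGE n l) :
    subst Ψ f - subst Ψ' f ∈ ordGE n (m + l - 1) := by
  intro e he
  rw [map_sub, coeff_subst_eq_sum hΨ f le_rfl, coeff_subst_eq_sum hΨ' f le_rfl,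
    ← Finset.sum_sub_distrib]
  refine Finset.sum_eq_zero fun j _ => ?_
  rw [← Finset.sum_sub_distrib]
  refine Finset.sum_eq_zero fun k hk => ?_
  rw [mem_multiIndices] at hk
  rw [← mul_sub, ← map_sub]
  by_cases hj : j < l
  · rw [hf k (by omega), zero_mul]
  · rw [mpow_sub_mem_ordGE hΨ hΨ' h hk e (by omega), mul_zero]

theorem sub_truncTotal_mem_ordGE (f : MvPowerSeries (Fin n) ℂ) (m : ℕ) :
    f - (truncTotal m f : MvPolynomial (Fin n) ℂ) ∈ ordGE n m := by
  intro k hk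
  rw [map_sub, MvPolynomial.coeff_coe, coeff_truncTotal_eq_ite, if_pos hk, sub_self]

/-- The chain rule for formal power series. -/
theorem pderiv_subst {Ψ : FormalField n} (hΨ : ∀ i, Ψ i ∈ ordGE n 1)
    (f : MvPowerSeries (Fin n) ℂ) (i : Fin n) :
    pderiv ℂ i (subst Ψ f) = ∑ j, subst Ψ (pderiv ℂ j f) * pderiv ℂ i (Ψ j) := by
  have hs := hasSubst_of_ordGE hΨ
  have hpoly : ∀ p : MvPolynomial (Fin n) ℂ, pderiv ℂ i (subst Ψ (p : MvPowerSeries (Fin n) ℂ)) =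
      ∑ j, subst Ψ (pderiv ℂ j (p : MvPowerSeries (Fin n) ℂ)) * pderiv ℂ i (Ψ j) := by
    intro p
    induction p using MvPolynomial.induction_on with
    | C a =>
      rw [MvPolynomial.coe_C]
      simp only [subst_C, pderiv_C, subst_zero hΨ, zero_mul, Finset.sum_const_zero]
    | add p q hp hq =>
      simp only [MvPolynomial.coe_add, subst_add hs, map_add, hp, hq, add_mul,
        Finset.sum_add_distrib]
    | mul_X p j hp =>
      simp only [MvPolynomial.coe_mul, MvPolynomial.coe_X, subst_mul hs, subst_X hs,
        Derivation.leibniz, hp, smul_eq_mul, subst_add hs, add_mul, Finset.sum_add_distrib]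
      have hX : ∑ x, subst Ψ (p : MvPowerSeries (Fin n) ℂ) * subst Ψ (pderiv ℂ x (X j)) *
          pderiv ℂ i (Ψ x) = subst Ψ (p : MvPowerSeries (Fin n) ℂ) * pderiv ℂ i (Ψ j) := by
        rw [Finset.sum_eq_single j]
        · rw [pderiv_X_self, subst_one hΨ, mul_one]
        · intro b _ hb
          rw [pderiv_X_of_ne hb.symm, subst_zero hΨ, mul_zero, zero_mul]
        · simp
      rw [hX, Finset.mul_sum]
      congr 1
      exact Finset.sum_congr rfl fun _ _ => by ring
  -- Both sides lower the order by at most one, so replacing `f` by a polynomial truncation leaves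
  -- an error of arbitrarily high order.
  refine sub_eq_zero.mp (eq_zero_of_forall_mem_ordGE fun m => ?_)
  have hr := sub_truncTotal_mem_ordGE f (m + 1)
  set p := truncTotal (m + 1) f
  set r := f - (p : MvPowerSeries (Fin n) ℂ) with hrdef
  have hf : f = p + r := by rw [hrdef]; ring
  have : pderiv ℂ i (subst Ψ f) - ∑ j, subst Ψ (pderiv ℂ j f) * pderiv ℂ i (Ψ j) =
      pderiv ℂ i (subst Ψ r) - ∑ j, subst Ψ (pderiv ℂ j r) * pderiv ℂ i (Ψ j) := by
    rw [hf]
    simp only [subst_add hs, map_add, hpoly, add_mul, Finset.sum_add_distrib]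
    ring
  rw [this]
  refine Submodule.sub_mem _ (pderiv_mem_ordGE (subst_mem_ordGE hΨ hr) i)
    (Submodule.sum_mem _ fun j _ => ?_)
  exact mul_mem_ordGE (b := 0) (subst_mem_ordGE hΨ (pderiv_mem_ordGE hr j)) (mem_ordGE_zero _)

theorem subst_sum {ι : Type*} {Ψ : FormalField n} (hΨ : ∀ i, Ψ i ∈ ordGE n 1) (s : Finset ι)
    (F : ι → MvPowerSeries (Fin n) ℂ) : subst Ψ (∑ i ∈ s, F i) = ∑ i ∈ s, subst Ψ (F i) := by
  rw [← coe_substAlgHom (hasSubst_of_ordGE hΨ), map_sum]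

theorem compose_assoc {V Ψ Θ : FormalField n} (hΨ : ∀ i, Ψ i ∈ ordGE n 1)
    (hΘ : ∀ i, Θ i ∈ ordGE n 1) : compose (compose V Ψ) Θ = compose V (compose Ψ Θ) := by
  funext i
  exact subst_comp_subst_apply (hasSubst_of_ordGE hΨ) (hasSubst_of_ordGE hΘ) (V i)

theorem compose_X_right (V : FormalField n) : compose V X = V := by
  funext i
  simp [compose, subst_self]

theorem compose_X_left {Ψ : FormalField n} (hΨ : ∀ i, Ψ i ∈ ordGE n 1) : compose X Ψ = Ψ := by
  funext i
  exact subst_X (hasSubst_of_ordGE hΨ) i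

theorem compose_mem_ordGE {V Ψ : FormalField n} (hΨ : ∀ i, Ψ i ∈ ordGE n 1) {m : ℕ}
    (hV : ∀ i, V i ∈ ordGE n m) (i : Fin n) : compose V Ψ i ∈ ordGE n m :=
  subst_mem_ordGE hΨ (hV i)

theorem subst_derivAlong {Θ V : FormalField n} (hΘ : ∀ i, Θ i ∈ ordGE n 1)
    (f : MvPowerSeries (Fin n) ℂ) :
    subst Θ (derivAlong V f) = ∑ j, compose V Θ j * subst Θ (pderiv ℂ j f) := by
  rw [derivAlong, subst_sum hΘ]
  exact Finset.sum_congr rfl fun j _ => subst_mul (hasSubst_of_ordGE hΘ) _ _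

/-- Transformations of vector fields compose. -/
theorem TransformsTo.comp {Ψ Θ V V' V'' : FormalField n} (hΨ : ∀ i, Ψ i ∈ ordGE n 1)
    (hΘ : ∀ i, Θ i ∈ ordGE n 1) (h : TransformsTo Ψ V V') (h' : TransformsTo Θ V' V'') :
    TransformsTo (compose Ψ Θ) V V'' := by
  unfold TransformsTo at *
  rw [← compose_assoc hΨ hΘ, h]
  funext i
  change subst Θ (derivAlong V' (Ψ i)) = derivAlong V'' (subst Θ (Ψ i))
  rw [subst_derivAlong hΘ, h']
  simp only [derivAlong, pderiv_subst hΘ, Finset.sum_mul, Finset.mul_sum]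
  rw [Finset.sum_comm]
  exact Finset.sum_congr rfl fun _ _ => Finset.sum_congr rfl fun _ _ => by ring

theorem derivAlong_X (V : FormalField n) (i : Fin n) : derivAlong V (X i) = V i := by
  rw [derivAlong, Finset.sum_eq_single i]
  · simp [pderiv_X_self]
  · intro j _ hj
    rw [pderiv_X_of_ne hj.symm, mul_zero]
  · simp

/-- If `Φ` and `Ψ` are inverse to each other and `Φ_* V = V'`, then `Ψ_* V' = V`. -/
theorem TransformsTo.symm {Φ Ψ V V' : FormalField n} (hΦ : ∀ i, Φ i ∈ ordGE n 1)
    (hΨ : ∀ i, Ψ i ∈ ordGE n 1) (h1 : compose Φ Ψ = X) (h2 : compose Ψ Φ = X)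
    (h : TransformsTo Ψ V V') : TransformsTo Φ V' V := by
  -- `Z` is defined so that `Ψ_* Z = V` holds automatically. Composing with `Φ_* V = V'` yields an
  -- identity change of coordinates from `Z` to `V'`, whence `Z = V'`.
  let Z : FormalField n := compose (fun i => derivAlong V (Φ i)) Ψ
  have hZ : TransformsTo Φ Z V := by
    unfold TransformsTo
    rw [compose_assoc hΨ hΦ, h2, compose_X_right]
  have h3 := TransformsTo.comp hΦ hΨ hZ h
  rw [h1] at h3
  unfold TransformsTo at h3
  rw [compose_X_right] at h3
  have : Z = V' := by
    rw [h3]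
    funext i
    exact derivAlong_X V' i
  rw [← this]
  exact hZ

/-! ### Linear vector fields and homogeneous parts -/

theorem coeff_linearField (A : Matrix (Fin n) (Fin n) ℂ) (i : Fin n) (k : Fin n →₀ ℕ) :
    coeff k (linearField A i) = ∑ j, A i j * if k = single j 1 then 1 else 0 := by
  classical
  simp [linearField, coeff_X]

theorem linearField_mem_ordGE (A : Matrix (Fin n) (Fin n) ℂ) (i : Fin n) :
    linearField A i ∈ ordGE n 1 :=
  Submodule.sum_mem _ fun j _ => Submodule.smul_mem _ _ (X_mem_ordGE_one j)

@[simp] theorem linearPart_linearField (A : Matrix (Fin n) (Fin n) ℂ) :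
    linearPart (linearField A) = A := by
  ext i j
  simp [linearPart, coeff_linearField, Finsupp.single_left_inj]

theorem linearPart_add (V W : FormalField n) :
    linearPart (V + W) = linearPart V + linearPart W := by
  ext i j
  simp [linearPart]

theorem linearPart_sub (V W : FormalField n) :
    linearPart (V - W) = linearPart V - linearPart W := by
  ext i j
  simp [linearPart]

theorem linearPart_eq_zero_of_ordGE {V : FormalField n} (h : ∀ i, V i ∈ ordGE n 2) :
    linearPart V = 0 := by
  ext i j
  exact h i _ (by simp)

theorem mem_ordGE_two {V : FormalField n} (h : ∀ i, V i ∈ ordGE n 1) (h' : linearPart V = 0)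
    (i : Fin n) : V i ∈ ordGE n 2 := by
  intro k hk
  by_cases hk1 : degree k < 1
  · exact h i k hk1
  · obtain ⟨k', j, hk', rfl⟩ := exists_eq_add_single (show degree k = 0 + 1 by omega)
    rw [degree_eq_zero_iff] at hk'
    rw [hk', zero_add]
    exact congrFun (congrFun h' i) j

theorem sub_linearField_mem_ordGE {V : FormalField n} (h : ∀ i, V i ∈ ordGE n 1) (i : Fin n) :
    (V - linearField (linearPart V)) i ∈ ordGE n 2 :=
  mem_ordGE_two (fun i => Submodule.sub_mem _ (h i) (linearField_mem_ordGE _ i))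
    (show linearPart (V - linearField (linearPart V)) = 0 by
      rw [linearPart_sub, linearPart_linearField, sub_self]) i

theorem linearField_one : linearField (1 : Matrix (Fin n) (Fin n) ℂ) = X := by
  funext i
  simp [linearField, Matrix.one_apply]

theorem compose_linearField {Ψ : FormalField n} (hΨ : ∀ i, Ψ i ∈ ordGE n 1)
    (A : Matrix (Fin n) (Fin n) ℂ) (i : Fin n) :
    compose (linearField A) Ψ i = ∑ j, A i j • Ψ j := by
  change subst Ψ (∑ j, A i j • (X j : MvPowerSeries (Fin n) ℂ)) = _
  rw [subst_sum hΨ]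
  refine Finset.sum_congr rfl fun j _ => ?_
  rw [subst_smul (hasSubst_of_ordGE hΨ), subst_X (hasSubst_of_ordGE hΨ)]

theorem linearField_mul (A B : Matrix (Fin n) (Fin n) ℂ) (i : Fin n) :
    linearField (A * B) i = ∑ j, A i j • linearField B j := by
  simp only [linearField, Matrix.mul_apply, Finset.sum_smul, Finset.smul_sum, smul_smul]
  rw [Finset.sum_comm]

theorem compose_linearField_linearField (A B : Matrix (Fin n) (Fin n) ℂ) :
    compose (linearField A) (linearField B) = linearField (A * B) := by
  funext i
  rw [compose_linearField (linearField_mem_ordGE B), linearField_mul]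

theorem linearPart_compose {V Ψ : FormalField n} (hV : ∀ i, V i ∈ ordGE n 1)
    (hΨ : ∀ i, Ψ i ∈ ordGE n 1) :
    linearPart (compose V Ψ) = linearPart V * linearPart Ψ := by
  have h1 : compose V Ψ = compose (linearField (linearPart V)) Ψ +
      compose (V - linearField (linearPart V)) Ψ := by
    funext i
    change subst Ψ (V i) = subst Ψ (linearField (linearPart V) i) + subst Ψ (V i - _)
    rw [← subst_add (hasSubst_of_ordGE hΨ), add_sub_cancel]
  rw [h1, linearPart_add, linearPart_eq_zero_of_ordGE
    (compose_mem_ordGE hΨ (sub_linearField_mem_ordGE hV)), add_zero]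
  ext i j
  simp only [linearPart, compose_linearField hΨ, Matrix.mul_apply, map_sum, map_smul, smul_eq_mul]

theorem derivAlong_add (V : FormalField n) (f g : MvPowerSeries (Fin n) ℂ) :
    derivAlong V (f + g) = derivAlong V f + derivAlong V g := by
  simp [derivAlong, mul_add, Finset.sum_add_distrib]

theorem derivAlong_smul (V : FormalField n) (c : ℂ) (f : MvPowerSeries (Fin n) ℂ) :
    derivAlong V (c • f) = c • derivAlong V f := by
  simp [derivAlong, Finset.smul_sum]

theorem derivAlong_sum {ι : Type*} (V : FormalField n) (s : Finset ι)
    (f : ι → MvPowerSeries (Fin n) ℂ) :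
    derivAlong V (∑ a ∈ s, f a) = ∑ a ∈ s, derivAlong V (f a) := by
  simp only [derivAlong, map_sum, Finset.mul_sum]
  rw [Finset.sum_comm]

theorem derivAlong_linearField_right (V : FormalField n) (A : Matrix (Fin n) (Fin n) ℂ)
    (i : Fin n) : derivAlong V (linearField A i) = ∑ j, A i j • V j := by
  rw [linearField, derivAlong_sum]
  exact Finset.sum_congr rfl fun j _ => by rw [derivAlong_smul, derivAlong_X]

theorem coeff_X_mul_pderiv (f : MvPowerSeries (Fin n) ℂ) (i j : Fin n) (k : Fin n →₀ ℕ) :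
    coeff k (X j * pderiv ℂ i f) = if single j 1 ≤ k then
      coeff (k - single j 1 + single i 1) f * ((k - single j 1 : Fin n →₀ ℕ) i + 1) else 0 := by
  classical
  rw [X, coeff_monomial_mul, coeff_pderiv, one_mul]

theorem homogeneousComponent_X_mul_pderiv (d : ℕ) (f : MvPowerSeries (Fin n) ℂ) (i j : Fin n) :
    homogeneousComponent d (X j * pderiv ℂ i f) =
      X j * pderiv ℂ i (homogeneousComponent d f) := by
  ext k
  rw [coeff_homogeneousComponent, coeff_X_mul_pderiv, coeff_X_mul_pderiv,
    coeff_homogeneousComponent]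
  by_cases h : single j 1 ≤ k
  · have hk : degree (k - single j 1 + single i 1) = degree k := by
      conv_rhs => rw [← tsub_add_cancel_of_le h]
      simp
    rw [hk]
    split_ifs <;> simp
  · simp [h]

theorem derivAlong_linearField (A : Matrix (Fin n) (Fin n) ℂ) (f : MvPowerSeries (Fin n) ℂ) :
    derivAlong (linearField A) f = ∑ i, ∑ j, A i j • (X j * pderiv ℂ i f) := by
  simp [derivAlong, linearField, Finset.sum_mul]

theorem homogeneousComponent_derivAlong_linearField (d : ℕ) (A : Matrix (Fin n) (Fin n) ℂ)
    (f : MvPowerSeries (Fin n) ℂ) : homogeneousComponent d (derivAlong (linearField A) f) =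
      derivAlong (linearField A) (homogeneousComponent d f) := by
  simp only [derivAlong_linearField, map_sum, map_smul, homogeneousComponent_X_mul_pderiv]

theorem lieOp_apply (A : Matrix (Fin n) (Fin n) ℂ) (U : FormalField n) (i : Fin n) :
    lieOp A U i = derivAlong (linearField A) (U i) - ∑ j, A i j • U j := by
  rw [lieOp, derivAlong_linearField_right]

theorem homogeneousPart_lieOp (d : ℕ) (A : Matrix (Fin n) (Fin n) ℂ) (U : FormalField n) :
    homogeneousPart d (lieOp A U) = lieOp A (homogeneousPart d U) := by
  funext i
  change homogeneousComponent d (lieOp A U i) = _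
  simp only [lieOp_apply, map_sub, map_sum, map_smul, homogeneousComponent_derivAlong_linearField]
  rfl

theorem isHomogeneousField_homogeneousPart (d : ℕ) (V : FormalField n) :
    IsHomogeneousField d (homogeneousPart d V) :=
  fun i => isHomogeneous_homogeneousComponent (V i) d

theorem coeff_homogeneousPart (d : ℕ) (V : FormalField n) (i : Fin n) (k : Fin n →₀ ℕ) :
    coeff k (homogeneousPart d V i) = if degree k = d then coeff k (V i) else 0 :=
  coeff_homogeneousComponent d k (V i)

theorem isHomogeneousField_iff {d : ℕ} {V : FormalField n} :
    IsHomogeneousField d V ↔ homogeneousPart d V = V := by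
  constructor
  · intro h
    funext i
    exact (isHomogeneous_iff_eq_homogeneousComponent.mp (h i)).symm
  · intro h
    rw [← h]
    exact isHomogeneousField_homogeneousPart d V

/-! ### Rigidity: a linearizable normal form is linear -/

theorem polyInner_self (d : ℕ) (f : MvPowerSeries (Fin n) ℂ) :
    polyInner d f f = ((∑ k ∈ multiIndices n d, ‖coeff k f‖ ^ 2 *
      ((∏ i, ((k i).factorial : ℝ)) / (d.factorial : ℝ)) : ℝ) : ℂ) := by
  rw [polyInner, Complex.ofReal_sum]
  refine Finset.sum_congr rfl fun k _ => ?_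
  rw [Complex.mul_conj, Complex.normSq_eq_norm_sq]
  push_cast
  rfl

theorem prod_factorial_div_pos (d : ℕ) (k : Fin n →₀ ℕ) :
    (0 : ℝ) < (∏ i, ((k i).factorial : ℝ)) / (d.factorial : ℝ) :=
  div_pos (Finset.prod_pos fun i _ => by exact_mod_cast Nat.factorial_pos _)
    (by exact_mod_cast Nat.factorial_pos _)

theorem eq_zero_of_fieldInner_self {d : ℕ} {V : FormalField n} (hV : IsHomogeneousField d V)
    (h : fieldInner d V V = 0) : V = 0 := by
  have hnn : ∀ (i : Fin n) (k : Fin n →₀ ℕ), 0 ≤ ‖coeff k (V i)‖ ^ 2 *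
      ((∏ i, ((k i).factorial : ℝ)) / (d.factorial : ℝ)) := fun i k =>
    mul_nonneg (sq_nonneg _) (prod_factorial_div_pos d k).le
  simp only [fieldInner, polyInner_self, ← Complex.ofReal_sum, Complex.ofReal_eq_zero] at h
  rw [Finset.sum_eq_zero_iff_of_nonneg fun i _ => Finset.sum_nonneg fun k _ => hnn i k] at h
  funext i
  ext k
  by_cases hk : degree k = d
  · have h1 := h i (Finset.mem_univ i)
    rw [Finset.sum_eq_zero_iff_of_nonneg fun k _ => hnn i k] at h1
    have h2 := h1 k (mem_multiIndices.mpr hk)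
    rcases mul_eq_zero.mp h2 with h3 | h3
    · simpa using h3
    · exact absurd h3 (prod_factorial_div_pos d k).ne'
  · exact IsHomogeneous.coeff_eq_zero (hV i) hk

theorem fieldInner_zero_left (d : ℕ) (V : FormalField n) : fieldInner d 0 V = 0 := by
  simp [fieldInner, polyInner]

/-- A vector field in normal form which is conjugate to a linear one is linear. -/
theorem eq_linearField_of_isNormalForm {A B : Matrix (Fin n) (Fin n) ℂ} {X' Θ : FormalField n}
    (hX' : IsNormalForm A X') (hΘ : ∀ i, Θ i ∈ ordGE n 1) (hdet : IsUnit (linearPart Θ).det)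
    (h : TransformsTo Θ X' (linearField B)) : X' = linearField A := by
  obtain ⟨h0, hA, hker⟩ := hX'
  replace h0 : ∀ i, X' i ∈ ordGE n 1 := fun i => mem_ordGE_one.mpr (h0 i)
  set Q := linearPart Θ with hQ
  -- Comparison of the linear parts in the conjugacy relation.
  have hAQ : A * Q = Q * B := by
    have h1 := congrArg linearPart h
    rw [linearPart_compose h0 hΘ, hA, ← hQ] at h1
    rw [h1]
    have h2 : (fun i => derivAlong (linearField B) (Θ i)) =
        linearField (Q * B) + fun i => derivAlong (linearField B) ((Θ - linearField Q) i) := by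
      funext i
      have : Θ i = linearField Q i + (Θ - linearField Q) i := by simp
      conv_lhs => rw [this, derivAlong_add, derivAlong_linearField_right, ← linearField_mul]
      rfl
    rw [h2, linearPart_add, linearPart_linearField, linearPart_eq_zero_of_ordGE, add_zero]
    intro i
    refine Submodule.sum_mem _ fun j _ => ?_
    exact mul_mem_ordGE (a := 1) (b := 1) (linearField_mem_ordGE B j)
      (pderiv_mem_ordGE (sub_linearField_mem_ordGE hΘ i) j)
  -- Composing with `Q⁻¹` reduces to a conjugacy tangent to the identity whose target is `A x`
  -- itself.
  have hlin : TransformsTo (linearField Q⁻¹) (linearField B) (linearField A) := by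
    unfold TransformsTo
    funext i
    rw [compose_linearField_linearField, derivAlong_linearField_right, ← linearField_mul]
    congr 1
    calc B * Q⁻¹ = (Q⁻¹ * Q) * B * Q⁻¹ := by rw [Matrix.nonsing_inv_mul _ hdet, one_mul]
      _ = Q⁻¹ * (A * Q) * Q⁻¹ := by rw [hAQ, Matrix.mul_assoc Q⁻¹]
      _ = Q⁻¹ * A := by
        rw [Matrix.mul_assoc, Matrix.mul_assoc, Matrix.mul_nonsing_inv _ hdet, mul_one]
  have hΘ' := h.comp hΘ (linearField_mem_ordGE _) hlin
  set Ξ := compose Θ (linearField Q⁻¹) with hΞ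
  have hΞ1 : ∀ i, Ξ i ∈ ordGE n 1 := compose_mem_ordGE (linearField_mem_ordGE _) hΘ
  have hlinΞ : linearPart Ξ = 1 := by
    rw [hΞ, linearPart_compose hΘ (linearField_mem_ordGE _), linearPart_linearField,
      ← hQ, Matrix.mul_nonsing_inv _ hdet]
  let V : FormalField n := Ξ - X
  have hV : ∀ i, V i ∈ ordGE n 2 := fun i => by
    have := sub_linearField_mem_ordGE hΞ1 i
    rwa [hlinΞ, linearField_one] at this
  let R : FormalField n := X' - linearField A
  have hR2 : ∀ i, R i ∈ ordGE n 2 := fun i => by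
    have := sub_linearField_mem_ordGE h0 i
    rwa [hA] at this
  have hΞV : ∀ i, Ξ i = X i + V i := fun i => by simp [V]
  -- The linear terms cancel in the conjugacy relation for `Ξ = id + V`, leaving `R ∘ Ξ = d₀ V`.
  have heq : ∀ i, subst Ξ (R i) = lieOp A V i := by
    intro i
    have h1 : subst Ξ (X' i) = derivAlong (linearField A) (Ξ i) := congrFun hΘ' i
    have h2 : subst Ξ (linearField A i) = linearField A i + ∑ j, A i j • V j := by
      have h3 := compose_linearField hΞ1 A i
      simp only [hΞV, smul_add, Finset.sum_add_distrib] at h3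
      exact h3
    change subst Ξ (X' i - linearField A i) = _
    rw [subst_sub (hasSubst_of_ordGE hΞ1), h1, h2, lieOp_apply, hΞV, derivAlong_add,
      derivAlong_X]
    ring
  have hRall : ∀ d i, R i ∈ ordGE n (d + 2) := by
    intro d
    induction d with
    | zero => exact hR2
    | succ d ih =>
      have hpart : homogeneousPart (d + 2) R = lieOp A (homogeneousPart (d + 2) V) := by
        rw [← homogeneousPart_lieOp]
        funext i
        ext k
        rw [coeff_homogeneousPart, coeff_homogeneousPart]
        split_ifs with hk
        -- As `R` has order `d + 2` and `Ξ - id` has order two, `R ∘ Ξ` and `R` differ only from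
        -- degree `d + 3` on.
        · have := subst_sub_subst_mem_ordGE hΞ1 X_mem_ordGE_one (m := 2) (fun i => hV i) (ih i) k
            (by omega)
          rw [map_sub, sub_eq_zero, subst_self, id, heq] at this
          exact this.symm
        · rfl
      have hR' : homogeneousPart (d + 2) X' = homogeneousPart (d + 2) R := by
        funext i
        ext k
        rw [coeff_homogeneousPart, coeff_homogeneousPart]
        split_ifs with hk
        · have : coeff k (linearField A i) = 0 := by
            rw [coeff_linearField]
            refine Finset.sum_eq_zero fun j _ => ?_
            rw [if_neg, mul_zero]
            rintro rfl
            simp at hk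
          simp [R, this]
        · rfl
      -- This part equals `d₀ V_{d+2}` and is killed by `d₀*`, hence is orthogonal to itself.
      have hzero : homogeneousPart (d + 2) R = 0 := by
        obtain ⟨hh, -, had⟩ := hker (d + 2) (by omega)
        rw [hR'] at hh had
        refine eq_zero_of_fieldInner_self hh ?_
        have := had _ (isHomogeneousField_homogeneousPart (d + 2) V)
        rw [← hpart, fieldInner_zero_left] at this
        exact this.symm
      intro i k hk
      by_cases hlt : degree k < d + 2
      · exact ih i k hlt
      · have h3 := coeff_homogeneousPart (d + 2) R i k
        rw [hzero, if_pos (by omega)] at h3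
        simpa using h3.symm
  funext i
  rw [← sub_eq_zero]
  exact eq_zero_of_forall_mem_ordGE fun m => ordGE_mono (by omega) (hRall m i)

/-! ### Solving equations degree by degree -/

/-- A map of formal fields whose terms of degree at most `m` depend only on the terms of degree
less than `m` of the argument has a fixed point. -/
theorem exists_fixedPoint (G : FormalField n → FormalField n)
    (hG : ∀ m W W', (∀ i, W i - W' i ∈ ordGE n m) → ∀ i, G W i - G W' i ∈ ordGE n (m + 1)) :
    ∃ W, G W = W := by
  let s : ℕ → FormalField n := fun m => G^[m] 0
  have hs1 : ∀ m i, s (m + 1) i - s m i ∈ ordGE n m := by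
    intro m
    induction m with
    | zero => exact fun i => mem_ordGE_zero _
    | succ m ih =>
      have := hG m _ _ ih
      simpa only [s, ← Function.iterate_succ_apply' G] using this
  have hs : ∀ m l i, s (m + l) i - s m i ∈ ordGE n m := by
    intro m l i
    induction l with
    | zero => simp
    | succ l ih =>
      have := Submodule.add_mem _ (ordGE_mono (Nat.le_add_right m l) (hs1 (m + l) i)) ih
      rwa [sub_add_sub_cancel] at this
  -- The iterates stabilize: from index `degree k + 1` on, the coefficient at `k` no longer changes.
  let W : FormalField n := fun i k => coeff k (s (degree k + 1) i)
  have hW : ∀ m i, W i - s m i ∈ ordGE n m := by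
    intro m i k hk
    obtain ⟨l, rfl⟩ := Nat.exists_eq_add_of_le (Nat.succ_le_of_lt hk)
    have := hs (degree k + 1) l i k (Nat.lt_succ_self _)
    rw [map_sub] at this ⊢
    rw [sub_eq_zero] at this ⊢
    exact this.symm
  refine ⟨W, ?_⟩
  funext i
  refine sub_eq_zero.mp (eq_zero_of_forall_mem_ordGE fun m => ?_)
  have h1 := ordGE_mono (Nat.le_succ m) (hG m W (s m) (hW m) i)
  have h2 := ordGE_mono (Nat.le_succ m) (hW (m + 1) i)
  have h3 : G (s m) = s (m + 1) := (Function.iterate_succ_apply' G m 0).symm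
  rw [h3] at h1
  have := Submodule.sub_mem _ h1 h2
  rwa [sub_sub_sub_cancel_right] at this

/-- The formal field of order at least two whose homogeneous parts are obtained from those of `W`
by applying `T d` in degree `d`. -/
def degreewise (T : ℕ → FormalField n → FormalField n) (W : FormalField n) : FormalField n :=
  fun i k => if 2 ≤ degree k then coeff k (T (degree k) (homogeneousPart (degree k) W) i) else 0

theorem coeff_degreewise (T : ℕ → FormalField n → FormalField n) (W : FormalField n) (i : Fin n)
    (k : Fin n →₀ ℕ) : coeff k (degreewise T W i) =
      if 2 ≤ degree k then coeff k (T (degree k) (homogeneousPart (degree k) W) i) else 0 :=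
  rfl

theorem degreewise_mem_ordGE (T : ℕ → FormalField n → FormalField n) (W : FormalField n)
    (i : Fin n) : degreewise T W i ∈ ordGE n 2 := fun k hk => by
  rw [coeff_degreewise, if_neg (by omega)]

theorem homogeneousPart_degreewise {T : ℕ → FormalField n → FormalField n}
    (hT : ∀ d V, IsHomogeneousField d (T d V)) (W : FormalField n) {d : ℕ} (hd : 2 ≤ d) :
    homogeneousPart d (degreewise T W) = T d (homogeneousPart d W) := by
  funext i
  ext k
  rw [coeff_homogeneousPart, coeff_degreewise]
  split_ifs with h1 h2
  · rw [h1]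
  · omega
  · exact (IsHomogeneous.coeff_eq_zero (hT d _ i) h1).symm

theorem degreewise_sub_mem_ordGE (T : ℕ → FormalField n → FormalField n) {m : ℕ}
    {W W' : FormalField n} (h : ∀ i, W i - W' i ∈ ordGE n m) (i : Fin n) :
    degreewise T W i - degreewise T W' i ∈ ordGE n m := by
  intro k hk
  have : homogeneousPart (degree k) W = homogeneousPart (degree k) W' := by
    funext j
    ext k'
    rw [coeff_homogeneousPart, coeff_homogeneousPart]
    split_ifs with h1
    · exact sub_eq_zero.mp ((map_sub (coeff k') _ _).symm.trans (h j k' (by omega)))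
    · rfl
  rw [map_sub, coeff_degreewise, coeff_degreewise, this, sub_self]

theorem add_X_mem_ordGE {U : FormalField n} (hU : ∀ i, U i ∈ ordGE n 2) (i : Fin n) :
    X i + U i ∈ ordGE n 1 :=
  Submodule.add_mem _ (X_mem_ordGE_one i) (ordGE_mono (by omega) (hU i))

/-- Solvability, degree by degree, of the conjugacy equation. -/
theorem exists_solution {R : FormalField n} (hR : ∀ i, R i ∈ ordGE n 2)
    (T S : ℕ → FormalField n → FormalField n) :
    ∃ W : FormalField n, ∀ i, W i = subst (fun j => X j + degreewise T W j) (R i) -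
      derivAlong (degreewise S W) (degreewise T W i) := by
  obtain ⟨W, hW⟩ := exists_fixedPoint (fun W : FormalField n => fun i =>
    subst (fun j => X j + degreewise T W j) (R i) -
      derivAlong (degreewise S W) (degreewise T W i)) (by
    intro m W W' h i
    have hT := degreewise_sub_mem_ordGE T h
    have hS := degreewise_sub_mem_ordGE S h
    have h1 := subst_sub_subst_mem_ordGE (add_X_mem_ordGE (degreewise_mem_ordGE T W))
      (add_X_mem_ordGE (degreewise_mem_ordGE T W')) (m := m)
      (fun i => by simpa using hT i) (hR i)
    have h2 : derivAlong (degreewise S W) (degreewise T W i) -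
        derivAlong (degreewise S W') (degreewise T W' i) ∈ ordGE n (m + 1) := by
      rw [derivAlong, derivAlong, ← Finset.sum_sub_distrib]
      refine Submodule.sum_mem _ fun j _ => ?_
      have h3 := mul_mem_ordGE (hS j) (pderiv_mem_ordGE (degreewise_mem_ordGE T W i) j)
      have h4 : degreewise S W' j * pderiv ℂ j (degreewise T W i - degreewise T W' i) ∈
          ordGE n (m + 1) := by
        -- For `m = 0` the derivative has no order to lose; the order two of the other factor
        -- suffices.
        cases m with
        | zero =>
          exact ordGE_mono (by omega)
            (mul_mem_ordGE (b := 0) (degreewise_mem_ordGE S W' j) (mem_ordGE_zero _))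
        | succ m =>
          exact ordGE_mono (by omega)
            (mul_mem_ordGE (degreewise_mem_ordGE S W' j) (pderiv_mem_ordGE (hT i) j))
      have := Submodule.add_mem _ h3 h4
      convert this using 1
      rw [map_sub]
      ring
    have := Submodule.sub_mem _ (ordGE_mono (by omega) h1) h2
    rwa [sub_sub_sub_comm] at this)
  exact ⟨W, fun i => (congrFun hW i).symm⟩

theorem homogeneousPart_eq_self_degreewise {W : FormalField n} (hW : ∀ i, W i ∈ ordGE n 2) :
    degreewise (fun _ V => V) W = W := by
  funext i
  ext k
  rw [coeff_degreewise, coeff_homogeneousPart, if_pos rfl]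
  split_ifs with h
  · rfl
  · exact (hW i k (by omega)).symm

theorem derivAlong_zero (f : MvPowerSeries (Fin n) ℂ) : derivAlong (0 : FormalField n) f = 0 := by
  simp [derivAlong]

/-- A formal map tangent to the identity has a right inverse tangent to the identity. -/
theorem exists_rightInverse {U : FormalField n} (hU : ∀ i, U i ∈ ordGE n 2) :
    ∃ W : FormalField n, (∀ i, W i ∈ ordGE n 2) ∧
      (∀ i, W i = subst (fun j => X j + W j) (-(U i))) ∧
      compose (fun i => X i + U i) (fun i => X i + W i) = X := by
  -- With `T` the identity and `S` zero, the equation becomes `W = -U ∘ (id + W)`.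
  obtain ⟨W, hW⟩ := exists_solution (R := fun i => -(U i))
    (fun i => Submodule.neg_mem _ (hU i)) (fun _ V => V) (fun _ _ => 0)
  have hS : degreewise (fun _ _ => 0) W = 0 := by
    funext i
    ext k
    simp [coeff_degreewise]
  have hT := add_X_mem_ordGE (degreewise_mem_ordGE (fun _ V => V) W)
  have hW2 : ∀ i, W i ∈ ordGE n 2 := fun i => by
    rw [hW i, hS, derivAlong_zero, sub_zero]
    exact subst_mem_ordGE hT (Submodule.neg_mem _ (hU i))
  rw [homogeneousPart_eq_self_degreewise hW2] at hW
  simp only [hS, derivAlong_zero, sub_zero] at hW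
  refine ⟨W, hW2, hW, ?_⟩
  have hs := hasSubst_of_ordGE (add_X_mem_ordGE hW2)
  funext i
  change subst _ (X i + U i) = _
  rw [subst_add hs, subst_X hs]
  have h1 : W i = - subst (fun j => X j + W j) (U i) := by
    conv_lhs => rw [hW i]
    rw [← coe_substAlgHom hs, map_neg]
  rw [h1]
  ring

/-- A formal map tangent to the identity has an inverse. -/
theorem exists_inverse {U : FormalField n} (hU : ∀ i, U i ∈ ordGE n 2) :
    ∃ W : FormalField n, (∀ i, W i ∈ ordGE n 2) ∧
      (∀ i, W i = subst (fun j => X j + W j) (-(U i))) ∧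
      compose (fun i => X i + U i) (fun i => X i + W i) = X ∧
      compose (fun i => X i + W i) (fun i => X i + U i) = X := by
  obtain ⟨W, hW2, hW, h1⟩ := exists_rightInverse hU
  obtain ⟨Z, hZ2, -, h2⟩ := exists_rightInverse hW2
  refine ⟨W, hW2, hW, h1, ?_⟩
  -- A right inverse of a right inverse is the original map.
  have h3 : (fun i => X i + U i) = fun i => X i + Z i := by
    have h4 := compose_assoc (V := fun i => X i + U i) (add_X_mem_ordGE hW2) (add_X_mem_ordGE hZ2)
    rw [h1, h2, compose_X_right, compose_X_left (add_X_mem_ordGE hZ2)] at h4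
    exact h4.symm
  rw [h3, h2]

/-! ### The Fischer norm -/

/-- The weight `k! / d!` of the monomial `xᵏ` of degree `d`. -/
def fischerWeight (d : ℕ) (k : Fin n →₀ ℕ) : ℝ :=
  (∏ i, ((k i).factorial : ℝ)) / (d.factorial : ℝ)

theorem fischerWeight_pos (d : ℕ) (k : Fin n →₀ ℕ) : 0 < fischerWeight d k :=
  prod_factorial_div_pos d k

/-- The recursion of the weights under `∂/∂xᵢ`, from which the formulas for powers, derivatives and
adjoints follow. -/
theorem fischerWeight_add_single (d : ℕ) (k : Fin n →₀ ℕ) (i : Fin n) :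
    (d + 1) * fischerWeight (d + 1) (k + single i 1) = (k i + 1) * fischerWeight d k := by
  have h : ∏ j, (((k + single i 1 : Fin n →₀ ℕ) j).factorial : ℝ) =
      (k i + 1) * ∏ j, ((k j).factorial : ℝ) := by
    rw [← Finset.mul_prod_erase _ _ (Finset.mem_univ i),
      ← Finset.mul_prod_erase _ (fun j => ((k j).factorial : ℝ)) (Finset.mem_univ i), ← mul_assoc]
    congr 1
    · simp [Nat.factorial_succ]
    · refine Finset.prod_congr rfl fun j hj => ?_
      have : j ≠ i := Finset.ne_of_mem_erase hj
      simp [this.symm]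
  rw [fischerWeight, fischerWeight, h, Nat.factorial_succ]
  have : ((d.factorial : ℕ) : ℝ) ≠ 0 := by exact_mod_cast d.factorial_ne_zero
  push_cast
  field_simp

/-- Adding `single i 1` is a bijection onto the multi-indices of degree `d + 1` with positive `i`-th
entry, and the others contribute nothing. -/
theorem sum_multiIndices_succ {M : Type*} [AddCommMonoid M] (d : ℕ) (i : Fin n)
    {F : (Fin n →₀ ℕ) → M} (hF : ∀ k, k i = 0 → F k = 0) :
    ∑ k ∈ multiIndices n (d + 1), F k = ∑ k ∈ multiIndices n d, F (k + single i 1) := by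
  symm
  refine Finset.sum_of_injOn (fun k => k + single i 1) ?_ ?_ ?_ ?_
  · intro a _ b _ h
    exact add_right_cancel h
  · intro k hk
    simp only [Finset.mem_coe, mem_multiIndices] at *
    simp [hk]
  · intro k hk hk'
    refine hF k ?_
    by_contra h
    refine hk' ⟨k - single i 1, ?_, ?_⟩
    · have hle : single i 1 ≤ k := by
        rw [Finsupp.single_le_iff]
        omega
      have h3 := congrArg degree (tsub_add_cancel_of_le hle)
      rw [map_add, degree_single, mem_multiIndices.mp hk] at h3
      simp only [Finset.mem_coe, mem_multiIndices]
      omega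
    · refine tsub_add_cancel_of_le ?_
      rw [Finsupp.single_le_iff]
      omega
  · intros
    rfl

theorem pderiv_sum_X_pow (d : ℕ) (i : Fin n) :
    pderiv ℝ i ((∑ j, X j : MvPowerSeries (Fin n) ℝ) ^ (d + 1)) =
      ((d : ℝ) + 1) • (∑ j, X j : MvPowerSeries (Fin n) ℝ) ^ d := by
  have h : pderiv ℝ i (∑ j, X j : MvPowerSeries (Fin n) ℝ) = 1 := by
    rw [map_sum, Finset.sum_eq_single i]
    · exact pderiv_X_self
    · intro b _ hb
      exact pderiv_X_of_ne hb
    · simp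
  rw [pderiv_pow, h, Nat.add_sub_cancel, mul_one, MvPowerSeries.smul_eq_C_mul]
  simp

/-- The inverse weights are the multinomial coefficients. Induction on `d`: differentiating the
power reproduces the recursion of the weights. -/
theorem coeff_sum_X_pow (d : ℕ) (k : Fin n →₀ ℕ) :
    coeff k ((∑ j, X j : MvPowerSeries (Fin n) ℝ) ^ d) =
      if degree k = d then (fischerWeight d k)⁻¹ else 0 := by
  induction d generalizing k with
  | zero =>
    simp only [pow_zero, coeff_one, degree_eq_zero_iff]
    split_ifs with h
    · simp [h, fischerWeight]
    · rfl
  | succ d ih =>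
    by_cases hk : k = 0
    · rw [hk, if_neg (by simp), coeff_zero_eq_constantCoeff_apply]
      simp
    · obtain ⟨l, hl⟩ := Nat.exists_eq_succ_of_ne_zero (mt (degree_eq_zero_iff k).mp hk)
      obtain ⟨k', i, hk', rfl⟩ := exists_eq_add_single hl
      have h1 := congrArg (coeff k') (pderiv_sum_X_pow (n := n) d i)
      rw [coeff_pderiv, map_smul, ih, smul_eq_mul] at h1
      have h2 : ((k' i : ℝ) + 1) ≠ 0 := by positivity
      have h3 := fischerWeight_add_single d k' i
      have h4 := (fischerWeight_pos d k').ne'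
      have h5 := (fischerWeight_pos (d + 1) (k' + single i 1)).ne'
      rw [← eq_div_iff h2] at h1
      rw [h1, map_add, degree_single]
      by_cases hd : degree k' = d
      · rw [if_pos hd, if_pos (by rw [hd]), inv_eq_one_div (fischerWeight (d + 1) _)]
        field_simp
        linarith
      · rw [if_neg hd, if_neg (by omega)]
        simp

/-- The coefficients of degree `d` of a power series, scaled so that the Euclidean norm is the
Fischer norm. -/
def polyVec (n d : ℕ) : MvPowerSeries (Fin n) ℂ →ₗ[ℂ] EuclideanSpace ℂ (multiIndices n d) where
  toFun f := WithLp.toLp 2 fun k => coeff (k : Fin n →₀ ℕ) f * (√(fischerWeight d (k : Fin n →₀ ℕ)) : ℝ)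
  map_add' f g := by
    ext k
    simp [add_mul]
  map_smul' c f := by
    ext k
    simp [mul_assoc]

theorem polyVec_apply (d : ℕ) (f : MvPowerSeries (Fin n) ℂ) (k : multiIndices n d) :
    polyVec n d f k = coeff (k : Fin n →₀ ℕ) f * (√(fischerWeight d (k : Fin n →₀ ℕ)) : ℝ) := rfl

theorem polyVec_eq_iff {d : ℕ} {f g : MvPowerSeries (Fin n) ℂ} :
    polyVec n d f = polyVec n d g ↔ ∀ k, degree k = d → coeff k f = coeff k g := by
  constructor
  · intro h k hk
    have h1 := congrArg (fun v => v ⟨k, mem_multiIndices.mpr hk⟩) h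
    simp only [polyVec_apply] at h1
    refine mul_right_cancel₀ ?_ h1
    exact_mod_cast (Real.sqrt_pos.mpr (fischerWeight_pos d k)).ne'
  · intro h
    ext k
    rw [polyVec_apply, polyVec_apply, h _ (mem_multiIndices.mp k.2)]

/-- The Fischer norm of the part of degree `d` of a power series. -/
def fischerNorm (d : ℕ) (f : MvPowerSeries (Fin n) ℂ) : ℝ := ‖polyVec n d f‖

theorem fischerNorm_nonneg (d : ℕ) (f : MvPowerSeries (Fin n) ℂ) : 0 ≤ fischerNorm d f :=
  norm_nonneg _

theorem fischerNorm_sq (d : ℕ) (f : MvPowerSeries (Fin n) ℂ) :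
    fischerNorm d f ^ 2 = ∑ k ∈ multiIndices n d, ‖coeff k f‖ ^ 2 * fischerWeight d k := by
  rw [fischerNorm, EuclideanSpace.norm_sq_eq, ← Finset.sum_coe_sort (multiIndices n d)]
  refine Finset.sum_congr rfl fun k _ => ?_
  rw [polyVec_apply, norm_mul, mul_pow, Complex.norm_real, Real.norm_of_nonneg (Real.sqrt_nonneg _),
    Real.sq_sqrt (fischerWeight_pos d _).le]

theorem fischerNorm_congr {d : ℕ} {f g : MvPowerSeries (Fin n) ℂ}
    (h : ∀ k, degree k = d → coeff k f = coeff k g) : fischerNorm d f = fischerNorm d g := by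
  rw [fischerNorm, fischerNorm, polyVec_eq_iff.mpr h]

theorem fischerNorm_homogeneousComponent (d : ℕ) (f : MvPowerSeries (Fin n) ℂ) :
    fischerNorm d (homogeneousComponent d f) = fischerNorm d f :=
  fischerNorm_congr fun k hk => by rw [coeff_homogeneousComponent, if_pos hk]

theorem fischerNorm_eq_zero {d m : ℕ} {f : MvPowerSeries (Fin n) ℂ} (hf : f ∈ ordGE n m)
    (hd : d < m) : fischerNorm d f = 0 := by
  rw [fischerNorm, norm_eq_zero, ← map_zero (polyVec n d), polyVec_eq_iff]
  intro k hk
  rw [hf k (by omega), map_zero]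

theorem fischerNorm_add_le (d : ℕ) (f g : MvPowerSeries (Fin n) ℂ) :
    fischerNorm d (f + g) ≤ fischerNorm d f + fischerNorm d g := by
  rw [fischerNorm, map_add]
  exact norm_add_le _ _

theorem fischerNorm_sub_le (d : ℕ) (f g : MvPowerSeries (Fin n) ℂ) :
    fischerNorm d (f - g) ≤ fischerNorm d f + fischerNorm d g := by
  rw [fischerNorm, map_sub]
  exact norm_sub_le _ _

theorem fischerNorm_sum_le {ι : Type*} (d : ℕ) (s : Finset ι) (f : ι → MvPowerSeries (Fin n) ℂ) :
    fischerNorm d (∑ i ∈ s, f i) ≤ ∑ i ∈ s, fischerNorm d (f i) := by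
  rw [fischerNorm, map_sum]
  exact norm_sum_le _ _

theorem fischerNorm_smul (d : ℕ) (c : ℂ) (f : MvPowerSeries (Fin n) ℂ) :
    fischerNorm d (c • f) = ‖c‖ * fischerNorm d f := by
  rw [fischerNorm, map_smul, norm_smul, fischerNorm]

/-- Cauchy-Schwarz in each coefficient of the product, with the inverse weights as second factor.
Their convolution is again an inverse weight because `(∑ xⱼ)^a (∑ xⱼ)^b = (∑ xⱼ)^(a+b)`, so no
constant is lost. -/
theorem fischerNorm_mul_of_isHomogeneous {a b : ℕ} {f g : MvPowerSeries (Fin n) ℂ}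
    (hf : f.IsHomogeneous a) (hg : g.IsHomogeneous b) :
    fischerNorm (a + b) (f * g) ≤ fischerNorm a f * fischerNorm b g := by
  classical
  refine le_of_sq_le_sq ?_ (mul_nonneg (fischerNorm_nonneg _ _) (fischerNorm_nonneg _ _))
  rw [mul_pow, fischerNorm_sq, fischerNorm_sq, fischerNorm_sq, Finset.sum_mul_sum,
    ← Finset.sum_product']
  set F : (Fin n →₀ ℕ) × (Fin n →₀ ℕ) → ℝ := fun p =>
    ‖coeff p.1 f‖ ^ 2 * fischerWeight a p.1 * (‖coeff p.2 g‖ ^ 2 * fischerWeight b p.2) with hF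
  have hterm : ∀ m ∈ multiIndices n (a + b),
      ‖coeff m (f * g)‖ ^ 2 * fischerWeight (a + b) m ≤
        ∑ p ∈ Finset.HasAntidiagonal.antidiagonal m, F p := by
    intro m hm
    have hw := fischerWeight_pos (a + b) m
    have hσ : ∑ p ∈ Finset.HasAntidiagonal.antidiagonal m,
        coeff p.1 ((∑ j, X j : MvPowerSeries (Fin n) ℝ) ^ a) *
          coeff p.2 ((∑ j, X j : MvPowerSeries (Fin n) ℝ) ^ b) = (fischerWeight (a + b) m)⁻¹ := by
      rw [← coeff_mul, ← pow_add, coeff_sum_X_pow, if_pos (mem_multiIndices.mp hm)]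
    have h1 : ‖coeff m (f * g)‖ ≤ ∑ p ∈ Finset.HasAntidiagonal.antidiagonal m,
        ‖coeff p.1 f‖ * ‖coeff p.2 g‖ := by
      rw [coeff_mul]
      refine (norm_sum_le _ _).trans (Finset.sum_le_sum fun p _ => (norm_mul _ _).le)
    have h2 := Finset.sum_sq_le_sum_mul_sum_of_sq_le_mul
      (Finset.HasAntidiagonal.antidiagonal m)
      (r := fun p => ‖coeff p.1 f‖ * ‖coeff p.2 g‖) (f := F)
      (g := fun p => coeff p.1 ((∑ j, X j : MvPowerSeries (Fin n) ℝ) ^ a) *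
          coeff p.2 ((∑ j, X j : MvPowerSeries (Fin n) ℝ) ^ b))
      (fun p _ => mul_nonneg (mul_nonneg (sq_nonneg _) (fischerWeight_pos _ _).le)
        (mul_nonneg (sq_nonneg _) (fischerWeight_pos _ _).le))
      (fun p _ => by
        rw [coeff_sum_X_pow, coeff_sum_X_pow]
        refine mul_nonneg ?_ ?_ <;> split_ifs <;>
          first | exact (inv_pos.mpr (fischerWeight_pos _ _)).le | exact le_rfl)
      (fun p _ => by
        by_cases h1 : degree p.1 = a
        · by_cases h2 : degree p.2 = b
          · rw [coeff_sum_X_pow, coeff_sum_X_pow, if_pos h1, if_pos h2, hF]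
            have := (fischerWeight_pos a p.1).ne'
            have := (fischerWeight_pos b p.2).ne'
            apply le_of_eq
            field_simp
          · simp [hF, IsHomogeneous.coeff_eq_zero hg h2]
        · simp [hF, IsHomogeneous.coeff_eq_zero hf h1])
    rw [hσ, ← div_eq_mul_inv, le_div_iff₀ hw] at h2
    refine le_trans ?_ h2
    gcongr
  refine (Finset.sum_le_sum hterm).trans (le_of_eq ?_)
  rw [← Finset.sum_fiberwise_of_maps_to (s := multiIndices n a ×ˢ multiIndices n b)
    (t := multiIndices n (a + b)) (g := fun p => p.1 + p.2)]
  · refine Finset.sum_congr rfl fun m _ => ?_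
    symm
    refine Finset.sum_subset ?_ ?_
    · intro p hp
      rw [Finset.mem_filter] at hp
      exact Finset.HasAntidiagonal.mem_antidiagonal.mpr hp.2
    · intro p hp hp'
      rw [Finset.mem_filter, Finset.mem_product, mem_multiIndices, mem_multiIndices,
        Finset.HasAntidiagonal.mem_antidiagonal.mp hp] at hp'
      by_cases h1 : degree p.1 = a
      · have h2 : degree p.2 ≠ b := fun h2 => hp' ⟨⟨h1, h2⟩, rfl⟩
        simp [IsHomogeneous.coeff_eq_zero hg h2]
      · simp [IsHomogeneous.coeff_eq_zero hf h1]
  · intro p hp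
    rw [Finset.mem_product, mem_multiIndices, mem_multiIndices] at hp
    rw [mem_multiIndices, map_add, hp.1, hp.2]

/-- The Fischer norm is submultiplicative. -/
theorem fischerNorm_mul_le (d : ℕ) (f g : MvPowerSeries (Fin n) ℂ) :
    fischerNorm d (f * g) ≤ ∑ p ∈ Finset.HasAntidiagonal.antidiagonal d,
      fischerNorm p.1 f * fischerNorm p.2 g := by
  classical
  have h : polyVec n d (f * g) = polyVec n d (∑ p ∈ Finset.HasAntidiagonal.antidiagonal d,
      homogeneousComponent p.1 f * homogeneousComponent p.2 g) := by
    rw [polyVec_eq_iff]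
    intro k hk
    rw [map_sum]
    simp only [coeff_mul, coeff_homogeneousComponent]
    rw [Finset.sum_comm]
    refine Finset.sum_congr rfl fun q hq => ?_
    have hq' := congrArg degree (Finset.HasAntidiagonal.mem_antidiagonal.mp hq)
    rw [map_add, hk] at hq'
    rw [Finset.sum_eq_single (degree q.1, degree q.2)]
    · simp
    · intro p _ hp
      by_cases h1 : degree q.1 = p.1
      · have h2 : degree q.2 ≠ p.2 := fun h2 => hp (by rw [h1, h2])
        simp [h2]
      · simp [h1]
    · intro h
      exact absurd (Finset.HasAntidiagonal.mem_antidiagonal.mpr hq') h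
  rw [fischerNorm, h]
  refine (fischerNorm_sum_le d _ _).trans (Finset.sum_le_sum fun p hp => ?_)
  rw [← Finset.HasAntidiagonal.mem_antidiagonal.mp hp,
    ← fischerNorm_homogeneousComponent p.1 f, ← fischerNorm_homogeneousComponent p.2 g]
  exact fischerNorm_mul_of_isHomogeneous (isHomogeneous_homogeneousComponent _ _)
    (isHomogeneous_homogeneousComponent _ _)

/-- The weight recursion turns the square of the left norm into a sum over degree `d + 1` with the
extra factor `kᵢ (d + 1)`, and `kᵢ ≤ d + 1`. -/
theorem fischerNorm_pderiv_le (d : ℕ) (f : MvPowerSeries (Fin n) ℂ) (i : Fin n) :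
    fischerNorm d (pderiv ℂ i f) ≤ (d + 1) * fischerNorm (d + 1) f := by
  refine le_of_sq_le_sq ?_ (mul_nonneg (by positivity) (fischerNorm_nonneg _ _))
  rw [mul_pow, fischerNorm_sq, fischerNorm_sq, Finset.mul_sum]
  have h1 : ∑ k ∈ multiIndices n (d + 1), (k i : ℝ) * (d + 1) *
      (‖coeff k f‖ ^ 2 * fischerWeight (d + 1) k) =
      ∑ k ∈ multiIndices n d, ‖coeff k (pderiv ℂ i f)‖ ^ 2 * fischerWeight d k := by
    rw [sum_multiIndices_succ d i (by intro k hk; simp [hk])]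
    refine Finset.sum_congr rfl fun k _ => ?_
    have h2 : ‖((k i : ℂ) + 1)‖ = (k i : ℝ) + 1 := by
      rw [← Nat.cast_one, ← Nat.cast_add, Complex.norm_natCast]
      push_cast
      rfl
    rw [coeff_pderiv, norm_mul, h2, mul_pow]
    have h3 := fischerWeight_add_single d k i
    simp only [Finsupp.add_apply, single_eq_same, Nat.cast_add, Nat.cast_one]
    linear_combination ((k i : ℝ) + 1) * ‖coeff (k + single i 1) f‖ ^ 2 * h3
  rw [← h1]
  refine Finset.sum_le_sum fun k hk => ?_
  rw [sq ((d : ℝ) + 1)]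
  have h4 : (k i : ℝ) ≤ d + 1 := by
    have := Finsupp.le_degree i k
    rw [mem_multiIndices.mp hk] at this
    exact_mod_cast this
  have h5 := fischerWeight_pos (d + 1) k
  gcongr

/-- The multinomial theorem at the point `(1, …, 1)`, by induction through `∑ kᵢ = d + 1`. -/
theorem sum_inv_fischerWeight (d : ℕ) :
    ∑ k ∈ multiIndices n d, (fischerWeight d k)⁻¹ = (n : ℝ) ^ d := by
  induction d with
  | zero =>
    have : multiIndices n 0 = {0} := by
      ext k
      simp [mem_multiIndices, degree_eq_zero_iff]
    simp [this, fischerWeight]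
  | succ d ih =>
    have h1 : ∀ k ∈ multiIndices n (d + 1), (fischerWeight (d + 1) k)⁻¹ =
        ∑ i, (k i : ℝ) * ((d + 1) * fischerWeight (d + 1) k)⁻¹ := by
      intro k hk
      have h2 : ∑ i, (k i : ℝ) = d + 1 := by
        have := mem_multiIndices.mp hk
        rw [degree_eq_sum] at this
        exact_mod_cast this
      rw [← Finset.sum_mul, h2]
      have := (fischerWeight_pos (d + 1) k).ne'
      field_simp
    rw [Finset.sum_congr rfl h1, Finset.sum_comm]
    have h3 : ∀ i : Fin n, ∑ k ∈ multiIndices n (d + 1),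
        (k i : ℝ) * ((d + 1) * fischerWeight (d + 1) k)⁻¹ = (n : ℝ) ^ d := by
      intro i
      rw [sum_multiIndices_succ d i (by intro k hk; simp [hk]), ← ih]
      refine Finset.sum_congr rfl fun k _ => ?_
      rw [fischerWeight_add_single]
      have := (fischerWeight_pos d k).ne'
      have h2 : ((k i : ℝ) + 1) ≠ 0 := by positivity
      simp only [Finsupp.add_apply, single_eq_same, Nat.cast_add, Nat.cast_one]
      field_simp
    rw [Finset.sum_congr rfl fun i _ => h3 i]
    simp [pow_succ, mul_comm]

/-- Cauchy-Schwarz against the inverse weights, whose sum is `n ^ d`. Together with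
`fischerNorm_le_sum` it makes the two norms equivalent up to a geometric factor, which Gevrey bounds
ignore. -/
theorem sum_norm_coeff_le (d : ℕ) (f : MvPowerSeries (Fin n) ℂ) :
    ∑ k ∈ multiIndices n d, ‖coeff k f‖ ≤ √n ^ d * fischerNorm d f := by
  refine le_of_sq_le_sq ?_ (mul_nonneg (by positivity) (fischerNorm_nonneg _ _))
  rw [mul_pow, ← pow_mul, mul_comm d 2, pow_mul, Real.sq_sqrt (Nat.cast_nonneg n), fischerNorm_sq,
    ← sum_inv_fischerWeight]
  refine Finset.sum_sq_le_sum_mul_sum_of_sq_le_mul _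
    (fun k _ => (inv_pos.mpr (fischerWeight_pos d k)).le)
    (fun k _ => mul_nonneg (sq_nonneg _) (fischerWeight_pos d k).le) (fun k _ => le_of_eq ?_)
  have := (fischerWeight_pos d k).ne'
  field_simp

theorem fischerWeight_le_one {d : ℕ} {k : Fin n →₀ ℕ} (hk : degree k = d) :
    fischerWeight d k ≤ 1 := by
  rw [fischerWeight, div_le_one (by exact_mod_cast d.factorial_pos), ← hk, degree_eq_sum]
  exact_mod_cast Nat.le_of_dvd (Nat.factorial_pos _)
    (Nat.prod_factorial_dvd_factorial_sum Finset.univ k)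

theorem fischerNorm_le_sum (d : ℕ) (f : MvPowerSeries (Fin n) ℂ) :
    fischerNorm d f ≤ ∑ k ∈ multiIndices n d, ‖coeff k f‖ := by
  refine le_of_sq_le_sq ?_ (Finset.sum_nonneg fun k _ => norm_nonneg _)
  rw [fischerNorm_sq]
  refine le_trans (Finset.sum_le_sum fun k hk => ?_)
    (Finset.sum_sq_le_sq_sum_of_nonneg fun k _ => norm_nonneg (coeff k f))
  exact mul_le_of_le_one_right (sq_nonneg _) (fischerWeight_le_one (mem_multiIndices.mp hk))

/-! ### Gevrey series -/

theorem isGevreySeries_of_fischerNorm_le {α : ℝ} {f : MvPowerSeries (Fin n) ℂ} {C r : ℝ}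
    (hC : 0 < C) (hr : 0 < r)
    (h : ∀ l, fischerNorm l f ≤ C * r ^ l * (l.factorial : ℝ) ^ α) : IsGevreySeries α f := by
  refine ⟨C, (√n + 1) * r, hC, by positivity, fun l => (sum_norm_coeff_le l f).trans ?_⟩
  calc √n ^ l * fischerNorm l f ≤ (√n + 1) ^ l * (C * r ^ l * (l.factorial : ℝ) ^ α) := by
        gcongr
        · exact fischerNorm_nonneg _ _
        · linarith
        · exact h l
    _ = _ := by rw [mul_pow]; ring

theorem IsGevreySeries.exists_fischerNorm_le {α : ℝ} {f : MvPowerSeries (Fin n) ℂ}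
    (hf : IsGevreySeries α f) :
    ∃ C r : ℝ, 0 < C ∧ 0 < r ∧ ∀ l, fischerNorm l f ≤ C * r ^ l * (l.factorial : ℝ) ^ α := by
  obtain ⟨C, r, hC, hr, h⟩ := hf
  exact ⟨C, r, hC, hr, fun l => (fischerNorm_le_sum l f).trans (h l)⟩

theorem factorial_rpow_pos (α : ℝ) (l : ℕ) : 0 < (l.factorial : ℝ) ^ α :=
  Real.rpow_pos_of_pos (by exact_mod_cast l.factorial_pos) _

theorem IsGevreySeries.mono {α β : ℝ} (h : α ≤ β) {f : MvPowerSeries (Fin n) ℂ}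
    (hf : IsGevreySeries α f) : IsGevreySeries β f := by
  obtain ⟨C, r, hC, hr, hb⟩ := hf
  refine ⟨C, r, hC, hr, fun l => (hb l).trans ?_⟩
  gcongr
  exact_mod_cast l.factorial_pos

/-- Gevrey bounds for finitely many series can be taken with the same constants. -/
theorem IsGevrey.exists_uniform {α : ℝ} {V : FormalField n} (hV : IsGevrey α V) :
    ∃ C r : ℝ, 0 < C ∧ 0 < r ∧ ∀ i l, ∑ k ∈ multiIndices n l, ‖coeff k (V i)‖ ≤
      C * r ^ l * (l.factorial : ℝ) ^ α := by
  choose C r hC hr h using hV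
  refine ⟨1 + ∑ i, C i, 1 + ∑ i, r i,
    add_pos_of_pos_of_nonneg one_pos (Finset.sum_nonneg fun i _ => (hC i).le),
    add_pos_of_pos_of_nonneg one_pos (Finset.sum_nonneg fun i _ => (hr i).le),
    fun i l => (h i l).trans ?_⟩
  have h1 : C i ≤ 1 + ∑ i, C i := by
    have := Finset.single_le_sum (fun i _ => (hC i).le) (Finset.mem_univ i)
    linarith
  have h2 : r i ≤ 1 + ∑ i, r i := by
    have := Finset.single_le_sum (fun i _ => (hr i).le) (Finset.mem_univ i)
    linarith
  have := hC i
  have := hr i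
  have := factorial_rpow_pos α l
  have hC' : 0 ≤ 1 + ∑ i, C i := by linarith
  gcongr

theorem IsGevreySeries.add {α : ℝ} {f g : MvPowerSeries (Fin n) ℂ} (hf : IsGevreySeries α f)
    (hg : IsGevreySeries α g) : IsGevreySeries α (f + g) := by
  obtain ⟨C, r, hC, hr, hb⟩ := hf
  obtain ⟨C', r', hC', hr', hb'⟩ := hg
  refine ⟨C + C', r + r', by positivity, by positivity, fun l => ?_⟩
  have h1 : ∑ k ∈ multiIndices n l, ‖coeff k (f + g)‖ ≤
      ∑ k ∈ multiIndices n l, ‖coeff k f‖ + ∑ k ∈ multiIndices n l, ‖coeff k g‖ := by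
    rw [← Finset.sum_add_distrib]
    exact Finset.sum_le_sum fun k _ => by rw [map_add]; exact norm_add_le _ _
  have := factorial_rpow_pos α l
  calc _ ≤ C * r ^ l * (l.factorial : ℝ) ^ α + C' * r' ^ l * (l.factorial : ℝ) ^ α :=
        h1.trans (add_le_add (hb l) (hb' l))
    _ ≤ C * (r + r') ^ l * (l.factorial : ℝ) ^ α + C' * (r + r') ^ l * (l.factorial : ℝ) ^ α := by
        gcongr <;> linarith
    _ = _ := by ring

theorem isGevreySeries_zero (α : ℝ) : IsGevreySeries α (0 : MvPowerSeries (Fin n) ℂ) :=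
  ⟨1, 1, one_pos, one_pos, fun l => by simpa using (factorial_rpow_pos α l).le⟩

theorem IsGevreySeries.smul {α : ℝ} (c : ℂ) {f : MvPowerSeries (Fin n) ℂ}
    (hf : IsGevreySeries α f) : IsGevreySeries α (c • f) := by
  obtain ⟨C, r, hC, hr, hb⟩ := hf
  refine ⟨(‖c‖ + 1) * C, r, by positivity, hr, fun l => ?_⟩
  simp only [map_smul, smul_eq_mul, norm_mul, ← Finset.mul_sum]
  calc ‖c‖ * ∑ k ∈ multiIndices n l, ‖coeff k f‖
      ≤ (‖c‖ + 1) * (C * r ^ l * (l.factorial : ℝ) ^ α) := by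
        gcongr
        · linarith
        · exact hb l
    _ = _ := by ring

theorem IsGevreySeries.sum {ι : Type*} {α : ℝ} (s : Finset ι) {f : ι → MvPowerSeries (Fin n) ℂ}
    (hf : ∀ i ∈ s, IsGevreySeries α (f i)) : IsGevreySeries α (∑ i ∈ s, f i) :=
  Finset.sum_induction f (IsGevreySeries α) (fun _ _ => IsGevreySeries.add)
    (isGevreySeries_zero α) hf

theorem sum_norm_coeff_X (j : Fin n) (l : ℕ) :
    ∑ k ∈ multiIndices n l, ‖coeff k (X j : MvPowerSeries (Fin n) ℂ)‖ = if l = 1 then 1 else 0 := by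
  classical
  simp only [coeff_X, apply_ite norm, norm_one, norm_zero, Finset.sum_ite_eq', mem_multiIndices,
    degree_single, eq_comm]

theorem isGevreySeries_X (α : ℝ) (j : Fin n) :
    IsGevreySeries α (X j : MvPowerSeries (Fin n) ℂ) := by
  refine ⟨1, 1, one_pos, one_pos, fun l => ?_⟩
  rw [sum_norm_coeff_X]
  split_ifs with h
  · simp [h]
  · simpa using (factorial_rpow_pos α l).le

theorem isGevrey_linearField (α : ℝ) (A : Matrix (Fin n) (Fin n) ℂ) :
    IsGevrey α (linearField A) :=
  fun _ => IsGevreySeries.sum _ fun j _ => (isGevreySeries_X α j).smul _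

theorem fischerNorm_X_le (d : ℕ) (j : Fin n) :
    fischerNorm d (X j : MvPowerSeries (Fin n) ℂ) ≤ if d = 1 then 1 else 0 :=
  (fischerNorm_le_sum d _).trans (sum_norm_coeff_X j d).le

/-! ### Majorants with factorial weights -/

/-- The truncated majorant `∑_{d ≤ D} ‖f_d‖ t ^ d / (d!) ^ β`. -/
def gevreySum (β t : ℝ) (D : ℕ) (f : MvPowerSeries (Fin n) ℂ) : ℝ :=
  ∑ d ∈ Finset.range (D + 1), fischerNorm d f * (t ^ d / (d.factorial : ℝ) ^ β)

theorem gevreyWeight_pos (β : ℝ) {t : ℝ} (ht : 0 < t) (d : ℕ) :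
    0 < t ^ d / (d.factorial : ℝ) ^ β :=
  div_pos (pow_pos ht d) (factorial_rpow_pos β d)

theorem gevreySum_term_nonneg (β : ℝ) {t : ℝ} (ht : 0 < t) (d : ℕ) (f : MvPowerSeries (Fin n) ℂ) :
    0 ≤ fischerNorm d f * (t ^ d / (d.factorial : ℝ) ^ β) :=
  mul_nonneg (fischerNorm_nonneg _ _) (gevreyWeight_pos β ht d).le

theorem gevreySum_nonneg (β : ℝ) {t : ℝ} (ht : 0 < t) (D : ℕ) (f : MvPowerSeries (Fin n) ℂ) :
    0 ≤ gevreySum β t D f :=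
  Finset.sum_nonneg fun d _ => gevreySum_term_nonneg β ht d f

theorem gevreySum_le_of_fischerNorm_le (β : ℝ) {t : ℝ} (ht : 0 < t) {D : ℕ}
    {ι : Type*} (s : Finset ι) (c : ι → ℝ) (g : ι → MvPowerSeries (Fin n) ℂ)
    {f : MvPowerSeries (Fin n) ℂ}
    (h : ∀ d ≤ D, fischerNorm d f ≤ ∑ a ∈ s, c a * fischerNorm d (g a)) :
    gevreySum β t D f ≤ ∑ a ∈ s, c a * gevreySum β t D (g a) := by
  simp only [gevreySum, Finset.mul_sum]
  rw [Finset.sum_comm]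
  refine Finset.sum_le_sum fun d hd => ?_
  have h1 := h d (Nat.lt_succ_iff.mp (Finset.mem_range.mp hd))
  have h2 := gevreyWeight_pos β ht d
  calc _ ≤ (∑ a ∈ s, c a * fischerNorm d (g a)) * (t ^ d / (d.factorial : ℝ) ^ β) := by gcongr
    _ = _ := by
      rw [Finset.sum_mul]
      exact Finset.sum_congr rfl fun _ _ => by ring

theorem gevreySum_add_le (β : ℝ) {t : ℝ} (ht : 0 < t) (D : ℕ) (f g : MvPowerSeries (Fin n) ℂ) :
    gevreySum β t D (f + g) ≤ gevreySum β t D f + gevreySum β t D g := by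
  have := gevreySum_le_of_fischerNorm_le β ht (D := D) (Finset.univ : Finset (Fin 2)) (fun _ => 1)
    ![f, g] (f := f + g) (fun d _ => by simpa using fischerNorm_add_le d f g)
  simpa using this

theorem gevreySum_sub_le (β : ℝ) {t : ℝ} (ht : 0 < t) (D : ℕ) (f g : MvPowerSeries (Fin n) ℂ) :
    gevreySum β t D (f - g) ≤ gevreySum β t D f + gevreySum β t D g := by
  have := gevreySum_le_of_fischerNorm_le β ht (D := D) (Finset.univ : Finset (Fin 2)) (fun _ => 1)
    ![f, g] (f := f - g) (fun d _ => by simpa using fischerNorm_sub_le d f g)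
  simpa using this

theorem gevreySum_sum_le {ι : Type*} (β : ℝ) {t : ℝ} (ht : 0 < t) (D : ℕ) (s : Finset ι)
    (f : ι → MvPowerSeries (Fin n) ℂ) :
    gevreySum β t D (∑ i ∈ s, f i) ≤ ∑ i ∈ s, gevreySum β t D (f i) := by
  have := gevreySum_le_of_fischerNorm_le β ht (D := D) s (fun _ => 1) f
    (fun d _ => by simpa using fischerNorm_sum_le d s f)
  simpa using this

theorem gevreySum_X_le (β : ℝ) {t : ℝ} (ht : 0 < t) (D : ℕ) (j : Fin n) :
    gevreySum β t D (X j : MvPowerSeries (Fin n) ℂ) ≤ t := by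
  have h : ∀ d ∈ Finset.range (D + 1), fischerNorm d (X j : MvPowerSeries (Fin n) ℂ) *
      (t ^ d / (d.factorial : ℝ) ^ β) ≤ if d = 1 then t else 0 := by
    intro d _
    have h1 := gevreyWeight_pos β ht d
    refine (mul_le_mul_of_nonneg_right (fischerNorm_X_le d j) h1.le).trans ?_
    split_ifs with hd
    · simp [hd]
    · simp
  refine (Finset.sum_le_sum h).trans ?_
  rw [Finset.sum_ite_eq']
  split_ifs
  · exact le_rfl
  · exact ht.le

/-- A triangle of terms is enlarged to a rectangle. The separate bounds `A`, `B` allow the factors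
to be truncated at a lower degree than their product. -/
theorem sum_antidiagonal_le {D A B : ℕ} {F : ℕ × ℕ → ℝ} (hF : ∀ p, 0 ≤ F p)
    (h : ∀ p : ℕ × ℕ, p.1 + p.2 ≤ D → F p ≠ 0 → p.1 < A ∧ p.2 < B) :
    ∑ d ∈ Finset.range (D + 1), ∑ p ∈ Finset.HasAntidiagonal.antidiagonal d, F p ≤
      ∑ i ∈ Finset.range A, ∑ j ∈ Finset.range B, F (i, j) := by
  classical
  rw [← Finset.sum_product']
  set s := (Finset.range A ×ˢ Finset.range B).filter fun p => p.1 + p.2 ≤ D with hs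
  have h1 : ∑ d ∈ Finset.range (D + 1), ∑ p ∈ Finset.HasAntidiagonal.antidiagonal d, F p =
      ∑ p ∈ s, F p := by
    rw [← Finset.sum_fiberwise_of_maps_to (s := s) (t := Finset.range (D + 1))
      (g := fun p => p.1 + p.2)]
    · refine Finset.sum_congr rfl fun d hd => ?_
      symm
      refine Finset.sum_subset ?_ ?_
      · intro p hp
        rw [Finset.mem_filter] at hp
        exact Finset.HasAntidiagonal.mem_antidiagonal.mpr hp.2
      · intro p hp hp'
        by_contra hne
        have hpd := Finset.HasAntidiagonal.mem_antidiagonal.mp hp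
        rw [Finset.mem_range] at hd
        have := h p (by omega) hne
        refine hp' ?_
        rw [hs, Finset.mem_filter, Finset.mem_filter, Finset.mem_product, Finset.mem_range,
          Finset.mem_range]
        exact ⟨⟨this, by omega⟩, hpd⟩
    · intro p hp
      rw [hs, Finset.mem_filter] at hp
      exact Finset.mem_range.mpr (by omega)
  rw [h1]
  exact Finset.sum_le_sum_of_subset_of_nonneg (Finset.filter_subset _ _) fun p _ _ => hF p

/-- Submultiplicativity with a gain `K`: the weights of a product beat the product of the weights by
the binomial coefficient to the power `β`, and only pairs of nonzero parts count. -/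
theorem gevreySum_mul_le {β t K : ℝ} (ht : 0 < t) (hK : 0 ≤ K) {D A B : ℕ}
    {f g : MvPowerSeries (Fin n) ℂ}
    (h : ∀ i j, i + j ≤ D → fischerNorm i f ≠ 0 → fischerNorm j g ≠ 0 → i ≤ A ∧ j ≤ B ∧
      K * ((i.factorial : ℝ) ^ β * (j.factorial : ℝ) ^ β) ≤ ((i + j).factorial : ℝ) ^ β) :
    K * gevreySum β t D (f * g) ≤ gevreySum β t A f * gevreySum β t B g := by
  set F : ℕ × ℕ → ℝ := fun p => fischerNorm p.1 f * (t ^ p.1 / (p.1.factorial : ℝ) ^ β) *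
    (fischerNorm p.2 g * (t ^ p.2 / (p.2.factorial : ℝ) ^ β)) with hF
  have h1 : K * gevreySum β t D (f * g) ≤ ∑ d ∈ Finset.range (D + 1),
      ∑ p ∈ Finset.HasAntidiagonal.antidiagonal d, F p := by
    rw [gevreySum, Finset.mul_sum]
    refine Finset.sum_le_sum fun d hd => ?_
    have hw := gevreyWeight_pos β ht d
    calc K * (fischerNorm d (f * g) * (t ^ d / (d.factorial : ℝ) ^ β))
        ≤ K * ((∑ p ∈ Finset.HasAntidiagonal.antidiagonal d,
            fischerNorm p.1 f * fischerNorm p.2 g) * (t ^ d / (d.factorial : ℝ) ^ β)) := by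
          gcongr
          exact fischerNorm_mul_le d f g
      _ = ∑ p ∈ Finset.HasAntidiagonal.antidiagonal d, fischerNorm p.1 f * fischerNorm p.2 g *
            (K * (t ^ d / (d.factorial : ℝ) ^ β)) := by
          rw [Finset.sum_mul, Finset.mul_sum]
          exact Finset.sum_congr rfl fun _ _ => by ring
      _ ≤ _ := by
          refine Finset.sum_le_sum fun p hp => ?_
          have hpd := Finset.HasAntidiagonal.mem_antidiagonal.mp hp
          rw [Finset.mem_range] at hd
          by_cases h2 : fischerNorm p.1 f = 0
          · simp [hF, h2]
          by_cases h3 : fischerNorm p.2 g = 0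
          · simp [hF, h3]
          obtain ⟨-, -, h4⟩ := h p.1 p.2 (by omega) h2 h3
          rw [hpd] at h4
          have e1 := factorial_rpow_pos β p.1
          have e2 := factorial_rpow_pos β p.2
          have e3 := factorial_rpow_pos β d
          have h5 : K * (t ^ d / (d.factorial : ℝ) ^ β) ≤
              t ^ p.1 / (p.1.factorial : ℝ) ^ β * (t ^ p.2 / (p.2.factorial : ℝ) ^ β) := by
            rw [← hpd, pow_add, div_mul_div_comm, hpd, mul_div_assoc', div_le_div_iff₀ e3
              (mul_pos e1 e2)]
            calc _ = t ^ p.1 * t ^ p.2 *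
                  (K * ((p.1.factorial : ℝ) ^ β * (p.2.factorial : ℝ) ^ β)) := by ring
              _ ≤ _ := by gcongr
          calc _ ≤ fischerNorm p.1 f * fischerNorm p.2 g * _ :=
                mul_le_mul_of_nonneg_left h5
                  (mul_nonneg (fischerNorm_nonneg _ _) (fischerNorm_nonneg _ _))
            _ = _ := by rw [hF]; ring
  refine h1.trans ((sum_antidiagonal_le (A := A + 1) (B := B + 1) ?_ ?_).trans (le_of_eq ?_))
  · intro p
    exact mul_nonneg (gevreySum_term_nonneg β ht _ _) (gevreySum_term_nonneg β ht _ _)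
  · intro p hp hne
    have h2 : fischerNorm p.1 f ≠ 0 := by
      intro h2
      simp [hF, h2] at hne
    have h3 : fischerNorm p.2 g ≠ 0 := by
      intro h3
      simp [hF, h3] at hne
    obtain ⟨h4, h5, -⟩ := h p.1 p.2 hp h2 h3
    exact ⟨by omega, by omega⟩
  · rw [gevreySum, gevreySum, Finset.sum_mul_sum]

theorem le_of_fischerNorm_ne_zero {d m : ℕ} {f : MvPowerSeries (Fin n) ℂ} (hf : f ∈ ordGE n m)
    (h : fischerNorm d f ≠ 0) : m ≤ d := by
  by_contra hlt
  exact h (fischerNorm_eq_zero hf (by omega))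

/-- The binomial coefficient of `i + j` over `i` is at least `i + 1` as soon as `j ≥ 1`. -/
theorem succ_mul_factorial_mul_factorial_le {i j l : ℕ} (hi : l ≤ i) (hj : 1 ≤ j) :
    (l + 1) * (i.factorial * j.factorial) ≤ (i + j).factorial := by
  rw [← Nat.add_choose_mul_factorial_mul_factorial, mul_assoc]
  refine Nat.mul_le_mul_right _ ?_
  calc l + 1 ≤ i + 1 := by omega
    _ = (i + 1).choose i := (Nat.choose_succ_self_right i).symm
    _ ≤ (i + j).choose i := Nat.choose_le_choose i (by omega)
    _ = (i + j).choose j := Nat.choose_symm_add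

theorem succ_rpow_mul_factorial_le {β : ℝ} (hβ : 0 ≤ β) {i j l : ℕ} (hi : l ≤ i) (hj : 1 ≤ j) :
    ((l : ℝ) + 1) ^ β * ((i.factorial : ℝ) ^ β * (j.factorial : ℝ) ^ β) ≤
      ((i + j).factorial : ℝ) ^ β := by
  rw [← Real.mul_rpow (by positivity) (by positivity), ← Real.mul_rpow (by positivity)
    (by positivity)]
  exact Real.rpow_le_rpow (by positivity)
    (by exact_mod_cast succ_mul_factorial_mul_factorial_le hi hj) hβ

theorem factorial_succ_rpow (β : ℝ) (l : ℕ) :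
    ((l + 1).factorial : ℝ) ^ β = (l.factorial : ℝ) ^ β * ((l : ℝ) + 1) ^ β := by
  rw [Nat.factorial_succ, Nat.cast_mul, Real.mul_rpow (by positivity) (by positivity), mul_comm]
  push_cast
  rfl

theorem gevreySum_one_le {β t : ℝ} (D : ℕ) :
    gevreySum β t D (1 : MvPowerSeries (Fin n) ℂ) ≤ 1 := by
  have h : ∀ d ∈ Finset.range (D + 1), fischerNorm d (1 : MvPowerSeries (Fin n) ℂ) *
      (t ^ d / (d.factorial : ℝ) ^ β) = if d = 0 then fischerNorm 0 (1 : MvPowerSeries (Fin n) ℂ)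
        else 0 := by
    intro d _
    split_ifs with hd
    · simp [hd]
    · have : fischerNorm d (1 : MvPowerSeries (Fin n) ℂ) = 0 := by
        rw [fischerNorm, norm_eq_zero, ← map_zero (polyVec n d), polyVec_eq_iff]
        intro k hk
        classical
        rw [coeff_one, if_neg, map_zero]
        rintro rfl
        simp at hk
        omega
      rw [this, zero_mul]
  rw [gevreySum, Finset.sum_congr rfl h, Finset.sum_ite_eq', if_pos (by simp)]
  refine (fischerNorm_le_sum 0 _).trans ?_
  have : multiIndices n 0 = {0} := by
    ext k
    simp [mem_multiIndices, degree_eq_zero_iff]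
  simp [this]

/-- Each new factor of order at least one yields a gain `(l + 1) ^ β`. The accumulated `(l!) ^ β`
compensates the Gevrey growth of the coefficients of the outer series. -/
theorem gevreySum_mpow_le {β t q : ℝ} (hβ : 0 ≤ β) (ht : 0 < t) (hq : 0 ≤ q) {D : ℕ}
    {Ψ : FormalField n} (hΨ : ∀ i, Ψ i ∈ ordGE n 1) (hΨq : ∀ i, gevreySum β t D (Ψ i) ≤ q)
    {l : ℕ} : ∀ {k : Fin n →₀ ℕ}, degree k = l →
      (l.factorial : ℝ) ^ β * gevreySum β t D (mpow Ψ k) ≤ q ^ l := by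
  induction l with
  | zero =>
    intro k hk
    rw [degree_eq_zero_iff] at hk
    simpa [hk] using gevreySum_one_le (n := n) (β := β) (t := t) D
  | succ l ih =>
    intro k hk
    obtain ⟨k', i, hk', rfl⟩ := exists_eq_add_single hk
    have h1 := gevreySum_mul_le (β := β) (D := D) (A := D) (B := D) (f := mpow Ψ k') (g := Ψ i)
      ht (K := ((l : ℝ) + 1) ^ β) (by positivity) (fun a b _ ha hb => ⟨by omega, by omega,
        succ_rpow_mul_factorial_le hβ (le_of_fischerNorm_ne_zero (mpow_mem_ordGE hΨ hk') ha)
          (le_of_fischerNorm_ne_zero (hΨ i) hb)⟩)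
    rw [mpow_add_single, factorial_succ_rpow, mul_assoc, pow_succ]
    calc _ ≤ (l.factorial : ℝ) ^ β * (gevreySum β t D (mpow Ψ k') * gevreySum β t D (Ψ i)) := by
          gcongr
      _ = (l.factorial : ℝ) ^ β * gevreySum β t D (mpow Ψ k') * gevreySum β t D (Ψ i) := by ring
      _ ≤ _ := by
          gcongr
          · exact gevreySum_nonneg β ht D _
          · exact ih hk'
          · exact hΨq i

/-- With at least two factors of order at least one, a product of degree at most `D + 1` uses only
parts of degree at most `D`. This shift is what makes the recursion on `D` close. -/
theorem gevreySum_succ_mpow_le {β t q : ℝ} (hβ : 0 ≤ β) (ht : 0 < t) (hq : 0 ≤ q) {D : ℕ}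
    {Ψ : FormalField n} (hΨ : ∀ i, Ψ i ∈ ordGE n 1) (hΨq : ∀ i, gevreySum β t D (Ψ i) ≤ q)
    {l : ℕ} (hl : 2 ≤ l) {k : Fin n →₀ ℕ} (hk : degree k = l) :
    (l.factorial : ℝ) ^ β * gevreySum β t (D + 1) (mpow Ψ k) ≤ q ^ l := by
  obtain ⟨l, rfl⟩ := Nat.exists_eq_add_of_le' (show 1 ≤ l by omega)
  obtain ⟨k', i, hk', rfl⟩ := exists_eq_add_single hk
  have h1 := gevreySum_mul_le (β := β) (D := D + 1) (A := D) (B := D) (f := mpow Ψ k') (g := Ψ i)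
    ht (K := ((l : ℝ) + 1) ^ β) (by positivity) (fun a b hab ha hb => by
      have h2 := le_of_fischerNorm_ne_zero (mpow_mem_ordGE hΨ hk') ha
      have h3 := le_of_fischerNorm_ne_zero (hΨ i) hb
      exact ⟨by omega, by omega, succ_rpow_mul_factorial_le hβ h2 h3⟩)
  rw [mpow_add_single, factorial_succ_rpow, mul_assoc, pow_succ]
  calc _ ≤ (l.factorial : ℝ) ^ β * (gevreySum β t D (mpow Ψ k') * gevreySum β t D (Ψ i)) := by
        gcongr
    _ = (l.factorial : ℝ) ^ β * gevreySum β t D (mpow Ψ k') * gevreySum β t D (Ψ i) := by ring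
    _ ≤ _ := by
        gcongr
        · exact gevreySum_nonneg β ht D _
        · exact gevreySum_mpow_le hβ ht hq hΨ hΨq hk'
        · exact hΨq i

theorem sum_range_ite_pow_le {x : ℝ} (hx : 0 ≤ x) (hx' : x ≤ 1 / 2) (m N : ℕ) :
    ∑ l ∈ Finset.range N, (if m ≤ l then x ^ l else 0) ≤ 2 * x ^ m := by
  have key : ∀ N, (∑ l ∈ Finset.range (m + N), (if m ≤ l then x ^ l else 0)) + 2 * x ^ (m + N) ≤
      2 * x ^ m := by
    intro N
    induction N with
    | zero =>
      rw [Finset.sum_eq_zero, zero_add, add_zero]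
      intro l hl
      rw [Finset.mem_range] at hl
      rw [if_neg (by omega)]
    | succ N ih =>
      rw [← add_assoc, Finset.sum_range_succ, if_pos (by omega), pow_succ]
      have : 0 ≤ x ^ (m + N) := by positivity
      nlinarith
  have h1 : ∑ l ∈ Finset.range N, (if m ≤ l then x ^ l else 0) ≤
      ∑ l ∈ Finset.range (m + N), (if m ≤ l then x ^ l else 0) := by
    refine Finset.sum_le_sum_of_subset_of_nonneg ?_ ?_
    · intro l hl
      rw [Finset.mem_range] at *
      omega
    · intro l _ _
      split_ifs <;> positivity
  have h2 : 0 ≤ x ^ (m + N) := by positivity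
  linarith [key N]

/-- The factor `(l!) ^ β` in the monomial bound cancels the Gevrey growth of `f`, and a geometric
series of ratio at most `1 / 2` starting at `m` remains. The monomial bound is a hypothesis so that
it can be supplied with or without the shift from `D` to `D + 1`. -/
theorem gevreySum_subst_le {β t q C r : ℝ} (ht : 0 < t) (hq : 0 ≤ q) (hC : 0 < C) (hr : 0 < r)
    (hrq : r * q ≤ 1 / 2) {D m : ℕ} {Ψ : FormalField n} (hΨ : ∀ i, Ψ i ∈ ordGE n 1)
    (hΨq : ∀ l, m ≤ l → ∀ k : Fin n →₀ ℕ, degree k = l →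
      (l.factorial : ℝ) ^ β * gevreySum β t D (mpow Ψ k) ≤ q ^ l)
    {f : MvPowerSeries (Fin n) ℂ} (hf : f ∈ ordGE n m)
    (hb : ∀ l, ∑ k ∈ multiIndices n l, ‖coeff k f‖ ≤ C * r ^ l * (l.factorial : ℝ) ^ β) :
    gevreySum β t D (subst Ψ f) ≤ 2 * C * (r * q) ^ m := by
  have h1 : gevreySum β t D (subst Ψ f) ≤ ∑ a ∈ (Finset.range (D + 1)).sigma (multiIndices n),
      ‖coeff a.2 f‖ * gevreySum β t D (mpow Ψ a.2) := by
    refine gevreySum_le_of_fischerNorm_le β ht _ (fun a : Σ _ : ℕ, Fin n →₀ ℕ => ‖coeff a.2 f‖)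
      (fun a => mpow Ψ a.2) fun d hd => ?_
    have h2 : fischerNorm d (subst Ψ f) = fischerNorm d
        (∑ a ∈ (Finset.range (D + 1)).sigma (multiIndices n), coeff a.2 f • mpow Ψ a.2) := by
      refine fischerNorm_congr fun k hk => ?_
      rw [coeff_subst_eq_sum hΨ f (show degree k ≤ D by omega), map_sum, Finset.sum_sigma]
      simp
    rw [h2]
    refine (fischerNorm_sum_le d _ _).trans (le_of_eq ?_)
    exact Finset.sum_congr rfl fun a _ => fischerNorm_smul _ _ _
  rw [Finset.sum_sigma] at h1
  have h2 : ∀ l ∈ Finset.range (D + 1),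
      ∑ k ∈ multiIndices n l, ‖coeff k f‖ * gevreySum β t D (mpow Ψ k) ≤
        C * if m ≤ l then (r * q) ^ l else 0 := by
    intro l _
    split_ifs with hl
    · have hfac := factorial_rpow_pos β l
      have h3 : ∀ k ∈ multiIndices n l, ‖coeff k f‖ * gevreySum β t D (mpow Ψ k) ≤
          ‖coeff k f‖ * (q ^ l / (l.factorial : ℝ) ^ β) := by
        intro k hk
        gcongr
        rw [le_div_iff₀ hfac, mul_comm]
        exact hΨq l hl k (mem_multiIndices.mp hk)
      calc _ ≤ ∑ k ∈ multiIndices n l, ‖coeff k f‖ * (q ^ l / (l.factorial : ℝ) ^ β) :=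
            Finset.sum_le_sum h3
        _ = (∑ k ∈ multiIndices n l, ‖coeff k f‖) * (q ^ l / (l.factorial : ℝ) ^ β) := by
            rw [Finset.sum_mul]
        _ ≤ (C * r ^ l * (l.factorial : ℝ) ^ β) * (q ^ l / (l.factorial : ℝ) ^ β) := by
            gcongr
            exact hb l
        _ = C * (r * q) ^ l := by
            rw [mul_pow]
            field_simp
    · rw [mul_zero]
      refine (Finset.sum_eq_zero fun k hk => ?_).le
      rw [hf k (by rw [mem_multiIndices.mp hk]; omega), norm_zero, zero_mul]
  refine (h1.trans (Finset.sum_le_sum h2)).trans ?_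
  rw [← Finset.mul_sum]
  have h3 := sum_range_ite_pow_le (mul_nonneg hr.le hq) hrq m (D + 1)
  calc _ ≤ C * (2 * (r * q) ^ m) := by gcongr
    _ = _ := by ring

theorem isGevreySeries_of_gevreySum_le {β t M : ℝ} (ht : 0 < t) {f : MvPowerSeries (Fin n) ℂ}
    (h : ∀ D, gevreySum β t D f ≤ M) : IsGevreySeries β f := by
  refine isGevreySeries_of_fischerNorm_le (C := |M| + 1) (r := t⁻¹) (by positivity)
    (inv_pos.mpr ht) fun l => ?_
  have h1 : fischerNorm l f * (t ^ l / (l.factorial : ℝ) ^ β) ≤ M :=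
    (Finset.single_le_sum (fun d _ => gevreySum_term_nonneg β ht d f)
      (Finset.mem_range.mpr (Nat.lt_succ_self l))).trans (h l)
  have hw := gevreyWeight_pos β ht l
  rw [← le_div_iff₀ hw] at h1
  refine h1.trans ?_
  have hfac := factorial_rpow_pos β l
  rw [div_div_eq_mul_div, inv_pow, ← div_eq_mul_inv, div_mul_eq_mul_div]
  gcongr
  linarith [le_abs_self M]

theorem IsGevreySeries.exists_gevreySum_le {β : ℝ} {f : MvPowerSeries (Fin n) ℂ}
    (hf : IsGevreySeries β f) (h0 : f ∈ ordGE n 1) :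
    ∃ C t₀ : ℝ, 0 < C ∧ 0 < t₀ ∧ ∀ t, 0 < t → t ≤ t₀ → ∀ D, gevreySum β t D f ≤ C * t := by
  obtain ⟨C, r, hC, hr, hb⟩ := hf.exists_fischerNorm_le
  refine ⟨2 * C * r, 1 / (2 * r), by positivity, by positivity, fun t ht ht' D => ?_⟩
  have hrt : r * t ≤ 1 / 2 := by
    rw [le_div_iff₀ (by positivity)] at ht'
    linarith
  have h1 : ∀ d ∈ Finset.range (D + 1), fischerNorm d f * (t ^ d / (d.factorial : ℝ) ^ β) ≤
      C * if 1 ≤ d then (r * t) ^ d else 0 := by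
    intro d _
    split_ifs with hd
    · have hw := gevreyWeight_pos β ht d
      have hfac := factorial_rpow_pos β d
      calc _ ≤ (C * r ^ d * (d.factorial : ℝ) ^ β) * (t ^ d / (d.factorial : ℝ) ^ β) := by
            gcongr
            exact hb d
        _ = _ := by
            rw [mul_pow]
            field_simp
    · rw [fischerNorm_eq_zero h0 (by omega), zero_mul, mul_zero]
  refine (Finset.sum_le_sum h1).trans ?_
  rw [← Finset.mul_sum]
  calc _ ≤ C * (2 * (r * t) ^ 1) := by
        gcongr
        exact sum_range_ite_pow_le (by positivity) hrt 1 (D + 1)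
    _ = _ := by ring

/-- The composition of Gevrey-`β` formal maps is Gevrey-`β`. -/
theorem IsGevrey.compose {β : ℝ} (hβ : 0 ≤ β) {V Ψ : FormalField n} (hV : IsGevrey β V)
    (hΨ : IsGevrey β Ψ) (hΨ1 : ∀ i, Ψ i ∈ ordGE n 1) : IsGevrey β (compose V Ψ) := by
  intro i
  obtain ⟨C, r, hC, hr, hb⟩ := hV i
  choose K t₀ hK ht₀ h using fun j => (hΨ j).exists_gevreySum_le (hΨ1 j)
  set c := 1 + ∑ j, K j with hc
  have hKc : ∀ j, K j ≤ c := fun j => by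
    have := Finset.single_le_sum (fun i _ => (hK i).le) (Finset.mem_univ j)
    linarith
  have hc0 : 0 < c := add_pos_of_pos_of_nonneg one_pos (Finset.sum_nonneg fun i _ => (hK i).le)
  -- Chosen so that `t = b⁻¹` lies below every `t₀ j` and satisfies `r * (c * t) ≤ 1 / 2`.
  set b := 2 * r * c + ∑ j, (t₀ j)⁻¹ with hbdef
  have hb0 : 0 < b := add_pos_of_pos_of_nonneg (by positivity)
    (Finset.sum_nonneg fun i _ => (inv_pos.mpr (ht₀ i)).le)
  have ht : 0 < b⁻¹ := inv_pos.mpr hb0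
  have htj : ∀ j, b⁻¹ ≤ t₀ j := fun j => by
    rw [inv_le_comm₀ hb0 (ht₀ j)]
    have h1 := Finset.single_le_sum (fun i _ => (inv_pos.mpr (ht₀ i)).le) (Finset.mem_univ j)
    have h2 : 0 < 2 * r * c := by positivity
    linarith
  refine isGevreySeries_of_gevreySum_le ht (M := 2 * C * (r * (c * b⁻¹)) ^ 0) fun D => ?_
  refine gevreySum_subst_le ht (by positivity) hC hr ?_ hΨ1 (fun l _ k hk => ?_)
    (mem_ordGE_zero _) hb
  · rw [← mul_assoc, ← div_eq_mul_inv, div_le_iff₀ hb0]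
    have := Finset.sum_nonneg (s := Finset.univ) fun i _ => (inv_pos.mpr (ht₀ i)).le
    linarith
  · refine gevreySum_mpow_le hβ ht (by positivity) hΨ1 (fun j => ?_) hk
    exact (h j _ ht (htj j) D).trans (by gcongr; exact hKc j)

/-- Put `x = i! (j+1)! / (i+j)!`. Then `x ≤ 1`, so `x ^ β ≤ x` for `β ≥ 1`, and `(j + 1) x ≤ 2`
because the binomial coefficient of `i + j` over `j` grows at least quadratically in `j` when `i ≥
2`. -/
theorem succ_mul_rpow_factorial_le {β : ℝ} (hβ : 1 ≤ β) {i j : ℕ} (hi : 2 ≤ i) (hj : 1 ≤ j) :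
    ((j : ℝ) + 1) * ((i.factorial : ℝ) ^ β * ((j + 1).factorial : ℝ) ^ β) ≤
      2 * ((i + j).factorial : ℝ) ^ β := by
  have hN1 : i.factorial * (j + 1).factorial ≤ (i + j).factorial := by
    have := succ_mul_factorial_mul_factorial_le (le_refl j) (show 1 ≤ i by omega)
    rw [add_comm j i] at this
    rw [Nat.factorial_succ]
    calc _ = (j + 1) * (j.factorial * i.factorial) := by ring
      _ ≤ _ := this
  have hN2 : (j + 1) * (i.factorial * (j + 1).factorial) ≤ 2 * (i + j).factorial := by
    have h1 : (j + 2) * (j + 1) = 2 * (j + 2).choose j := by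
      have := Nat.triangle_succ (j + 1)
      rw [Nat.choose_symm_of_eq_add (show j + 2 = j + 2 from rfl)]
      rw [Nat.choose_two_right, Nat.mul_div_cancel' (by
        simpa using (Nat.even_mul_pred_self (j + 2)).two_dvd)]
      simp
    have h2 : (j + 2).choose j ≤ (i + j).choose j := Nat.choose_le_choose j (by omega)
    have h3 : (i + j).choose j * i.factorial * j.factorial = (i + j).factorial := by
      rw [← Nat.add_choose_mul_factorial_mul_factorial]
    rw [← h3, Nat.factorial_succ]
    calc (j + 1) * (i.factorial * ((j + 1) * j.factorial))
        = (j + 1) * (j + 1) * (i.factorial * j.factorial) := by ring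
      _ ≤ 2 * (i + j).choose j * (i.factorial * j.factorial) := by
          refine Nat.mul_le_mul_right _ ?_
          nlinarith
      _ = _ := by ring
  have hd : (0 : ℝ) < (i + j).factorial := by exact_mod_cast Nat.factorial_pos _
  have hn : (0 : ℝ) < i.factorial * (j + 1).factorial := by positivity
  rw [← Real.mul_rpow (by positivity) (by positivity)]
  set x : ℝ := (i.factorial * (j + 1).factorial : ℝ) / (i + j).factorial with hx
  have hx0 : 0 < x := div_pos hn hd
  have hx1 : x ≤ 1 := by
    rw [hx, div_le_one hd]
    exact_mod_cast hN1
  have hx2 : ((j : ℝ) + 1) * x ≤ 2 := by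
    rw [hx, mul_div_assoc', div_le_iff₀ hd]
    exact_mod_cast hN2
  have hxβ : x ^ β ≤ x := by
    simpa using Real.rpow_le_rpow_of_exponent_ge hx0 hx1 hβ
  have he : (i.factorial * (j + 1).factorial : ℝ) = x * (i + j).factorial := by
    rw [hx]
    field_simp
  rw [he, Real.mul_rpow hx0.le hd.le, ← mul_assoc]
  gcongr
  calc ((j : ℝ) + 1) * x ^ β ≤ ((j : ℝ) + 1) * x := by gcongr
    _ ≤ 2 := hx2

/-- The factor `j + 1` lost by differentiating a part of degree `j + 1` is absorbed by the factorial
weights; this is where `β ≥ 1` enters. The factor `1 / t` accounts for the lowered degree. As both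
series have order two, their parts of degree at most `D` determine the product up to degree `D + 1`.
-/
theorem gevreySum_mul_pderiv_le {β t : ℝ} (hβ : 1 ≤ β) (ht : 0 < t) (D : ℕ)
    {f g : MvPowerSeries (Fin n) ℂ} (hf : f ∈ ordGE n 2) (hg : g ∈ ordGE n 2) (i : Fin n) :
    gevreySum β t (D + 1) (g * pderiv ℂ i f) ≤ 2 / t * (gevreySum β t D g * gevreySum β t D f) := by
  set F : ℕ × ℕ → ℝ := fun p => fischerNorm p.1 g * (t ^ p.1 / (p.1.factorial : ℝ) ^ β) *
    (fischerNorm (p.2 + 1) f * (t ^ (p.2 + 1) / ((p.2 + 1).factorial : ℝ) ^ β)) with hF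
  have h1 : gevreySum β t (D + 1) (g * pderiv ℂ i f) ≤ 2 / t * ∑ d ∈ Finset.range (D + 1 + 1),
      ∑ p ∈ Finset.HasAntidiagonal.antidiagonal d, F p := by
    rw [gevreySum, Finset.mul_sum]
    refine Finset.sum_le_sum fun d hd => ?_
    have hw := gevreyWeight_pos β ht d
    calc fischerNorm d (g * pderiv ℂ i f) * (t ^ d / (d.factorial : ℝ) ^ β)
        ≤ (∑ p ∈ Finset.HasAntidiagonal.antidiagonal d,
            fischerNorm p.1 g * ((p.2 + 1) * fischerNorm (p.2 + 1) f)) *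
              (t ^ d / (d.factorial : ℝ) ^ β) := by
          gcongr
          refine (fischerNorm_mul_le d _ _).trans (Finset.sum_le_sum fun p _ => ?_)
          exact mul_le_mul_of_nonneg_left (fischerNorm_pderiv_le _ _ _) (fischerNorm_nonneg _ _)
      _ = ∑ p ∈ Finset.HasAntidiagonal.antidiagonal d, fischerNorm p.1 g *
            fischerNorm (p.2 + 1) f * ((p.2 + 1) * (t ^ d / (d.factorial : ℝ) ^ β)) := by
          rw [Finset.sum_mul]
          exact Finset.sum_congr rfl fun _ _ => by ring
      _ ≤ _ := by
          rw [Finset.mul_sum]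
          refine Finset.sum_le_sum fun p hp => ?_
          have hpd := Finset.HasAntidiagonal.mem_antidiagonal.mp hp
          by_cases h2 : fischerNorm p.1 g = 0
          · simp [hF, h2]
          by_cases h3 : fischerNorm (p.2 + 1) f = 0
          · simp [hF, h3]
          have h4 := le_of_fischerNorm_ne_zero hg h2
          have h5 := le_of_fischerNorm_ne_zero hf h3
          have h6 := succ_mul_rpow_factorial_le hβ h4 (show 1 ≤ p.2 by omega)
          rw [hpd] at h6
          have e1 := factorial_rpow_pos β p.1
          have e2 := factorial_rpow_pos β (p.2 + 1)
          have e3 := factorial_rpow_pos β d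
          have h7 : ((p.2 : ℝ) + 1) * (t ^ d / (d.factorial : ℝ) ^ β) ≤ 2 / t *
              (t ^ p.1 / (p.1.factorial : ℝ) ^ β *
                (t ^ (p.2 + 1) / ((p.2 + 1).factorial : ℝ) ^ β)) := by
            have e4 : 2 / t * (t ^ p.1 / (p.1.factorial : ℝ) ^ β *
                (t ^ (p.2 + 1) / ((p.2 + 1).factorial : ℝ) ^ β)) =
                2 * t ^ d / ((p.1.factorial : ℝ) ^ β * ((p.2 + 1).factorial : ℝ) ^ β) := by
              have e5 : t ^ d = t ^ p.1 * t ^ p.2 := by rw [← hpd, pow_add]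
              rw [e5, pow_succ]
              field_simp
            rw [e4, mul_div_assoc', div_le_div_iff₀ e3 (mul_pos e1 e2)]
            calc _ = t ^ d * (((p.2 : ℝ) + 1) *
                  ((p.1.factorial : ℝ) ^ β * ((p.2 + 1).factorial : ℝ) ^ β)) := by ring
              _ ≤ t ^ d * (2 * (d.factorial : ℝ) ^ β) := by gcongr
              _ = _ := by ring
          calc _ ≤ fischerNorm p.1 g * fischerNorm (p.2 + 1) f * _ :=
                mul_le_mul_of_nonneg_left h7
                  (mul_nonneg (fischerNorm_nonneg _ _) (fischerNorm_nonneg _ _))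
            _ = _ := by rw [hF]; ring
  refine h1.trans (mul_le_mul_of_nonneg_left ?_ (by positivity))
  refine (sum_antidiagonal_le (A := D + 1) (B := D) ?_ ?_).trans ?_
  · intro p
    exact mul_nonneg (gevreySum_term_nonneg β ht _ _) (gevreySum_term_nonneg β ht _ _)
  · intro p hp hne
    have h2 : fischerNorm p.1 g ≠ 0 := by
      intro h2
      simp [hF, h2] at hne
    have h3 : fischerNorm (p.2 + 1) f ≠ 0 := by
      intro h3
      simp [hF, h3] at hne
    have h4 := le_of_fischerNorm_ne_zero hg h2
    have h5 := le_of_fischerNorm_ne_zero hf h3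
    exact ⟨by omega, by omega⟩
  · simp only [hF]
    rw [← Finset.sum_mul_sum]
    refine mul_le_mul_of_nonneg_left ?_ (gevreySum_nonneg β ht D g)
    rw [gevreySum, Finset.sum_range_succ']
    exact le_add_of_nonneg_right (gevreySum_term_nonneg β ht 0 f)

/-- The alternative in `hcase` separates the two halves of the theorem: either the derivative term
is absent, or `β` is large enough to absorb it. -/
theorem gevreySum_derivAlong_le {β t q : ℝ} (ht : 0 < t) (hq : 0 ≤ q) {D : ℕ}
    {f : MvPowerSeries (Fin n) ℂ} {S : FormalField n} (hf : f ∈ ordGE n 2)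
    (hS : ∀ j, S j ∈ ordGE n 2) (hfq : gevreySum β t D f ≤ q)
    (hSq : ∀ j, gevreySum β t D (S j) ≤ q) (hcase : S = 0 ∨ 1 ≤ β) :
    gevreySum β t (D + 1) (derivAlong S f) ≤ n * (2 / t * q ^ 2) := by
  rcases hcase with h0 | hβ1
  · rw [h0, derivAlong_zero]
    have : gevreySum β t (D + 1) (0 : MvPowerSeries (Fin n) ℂ) = 0 := by
      simp [gevreySum, fischerNorm]
    rw [this]
    positivity
  · refine (gevreySum_sum_le β ht _ _ _).trans ?_
    refine (Finset.sum_le_card_nsmul _ _ (2 / t * q ^ 2) fun j _ => ?_).trans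
      (le_of_eq (by simp))
    refine (gevreySum_mul_pderiv_le hβ1 ht D hf (hS j) j).trans ?_
    have := gevreySum_nonneg β ht D f
    exact mul_le_mul_of_nonneg_left ((mul_le_mul (hSq j) hfq this hq).trans_eq (sq q).symm)
      (by positivity)

/-- Bootstrap: for small `t` the bound `p D ≤ K t ^ 2 ≤ t` reproduces itself, since the right side
is then at most `4 A t ^ 2 + B K ^ 2 t ^ 3`. -/
theorem exists_bound_of_quadratic_recursion {A B r : ℝ} (hA : 0 ≤ A) (hB : 0 ≤ B) (hr : 0 < r) :
    ∃ t M : ℝ, 0 < t ∧ ∀ p : ℕ → ℝ, (∀ D, 0 ≤ p D) → p 0 = 0 →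
      (∀ D, r * (t + p D) ≤ 1 / 2 → p (D + 1) ≤ A * (t + p D) ^ 2 + B / t * p D ^ 2) →
      ∀ D, p D ≤ M := by
  -- The three summands of `b` guarantee in turn `K t ≤ 1`, `2 r t ≤ 1 / 2` and `B K ^ 2 t ≤ 1` for
  -- `t = b⁻¹`.
  set K := 4 * A + 1 with hK
  set b := K + 4 * r + B * K ^ 2 with hb
  have hK0 : 0 < K := by positivity
  have hBK : 0 ≤ B * K ^ 2 := by positivity
  have hb0 : 0 < b := by positivity
  have ht : 0 < b⁻¹ := inv_pos.mpr hb0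
  refine ⟨b⁻¹, K * b⁻¹ ^ 2, ht, fun p hp h0 h D => ?_⟩
  set t := b⁻¹ with htdef
  have htb : t * b = 1 := inv_mul_cancel₀ hb0.ne'
  have h1 : K * t ≤ 1 := by nlinarith
  have h2 : r * (2 * t) ≤ 1 / 2 := by nlinarith
  have h3 : B * K ^ 2 * t ≤ 1 := by nlinarith
  have h4 : K * t ^ 2 ≤ t := by nlinarith
  induction D with
  | zero =>
    rw [h0]
    positivity
  | succ D ih =>
    have h5 : t + p D ≤ 2 * t := by linarith
    have h6 := h D ((mul_le_mul_of_nonneg_left h5 hr.le).trans h2)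
    have hpD := hp D
    calc p (D + 1) ≤ A * (t + p D) ^ 2 + B / t * p D ^ 2 := h6
      _ ≤ A * (2 * t) ^ 2 + B / t * (K * t ^ 2) ^ 2 := by gcongr
      _ = 4 * A * t ^ 2 + (B * K ^ 2 * t) * t ^ 2 := by
          field_simp
          ring
      _ ≤ 4 * A * t ^ 2 + 1 * t ^ 2 := by gcongr
      _ = K * t ^ 2 := by rw [hK]; ring

/-- Gevrey estimate for the solution of the conjugacy equation. -/
theorem isGevrey_of_conjugacy_equation {β : ℝ} (hβ : 0 ≤ β) {R U S W : FormalField n}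
    (hR : IsGevrey β R) (hR2 : ∀ i, R i ∈ ordGE n 2) (hU2 : ∀ i, U i ∈ ordGE n 2)
    (hS2 : ∀ i, S i ∈ ordGE n 2) (hW2 : ∀ i, W i ∈ ordGE n 2)
    (hU : ∀ d i, fischerNorm d (U i) ≤ ∑ j, fischerNorm d (W j))
    (hS : ∀ d i, fischerNorm d (S i) ≤ ∑ j, fischerNorm d (W j))
    (hW : ∀ i, W i = subst (fun j => X j + U j) (R i) - derivAlong S (U i))
    (hcase : S = 0 ∨ 1 ≤ β) : IsGevrey β U ∧ IsGevrey β S ∧ IsGevrey β W := by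
  obtain ⟨C, r, hC, hr, hb⟩ := hR.exists_uniform
  -- The constants are the estimates for `R ∘ (id + U)` and `DS`-type derivative terms, summed over
  -- the `n` components of `W`.
  obtain ⟨t, M, ht, hM⟩ := exists_bound_of_quadratic_recursion (A := n * (2 * C * r ^ 2))
    (B := n * (n * 2)) (by positivity) (by positivity) hr
  have hΨ := add_X_mem_ordGE hU2
  obtain ⟨p, hp⟩ : ∃ p : ℕ → ℝ, ∀ D, p D = ∑ j, gevreySum β t D (W j) := ⟨_, fun _ => rfl⟩
  have hp0 : ∀ D, 0 ≤ p D := fun D => by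
    rw [hp]
    exact Finset.sum_nonneg fun j _ => gevreySum_nonneg β ht D _
  have hdom : ∀ V : FormalField n, (∀ d i, fischerNorm d (V i) ≤ ∑ j, fischerNorm d (W j)) →
      ∀ D i, gevreySum β t D (V i) ≤ p D := by
    intro V hV D i
    rw [hp]
    simpa using gevreySum_le_of_fischerNorm_le β ht (D := D) Finset.univ (fun _ => (1 : ℝ)) W
      (fun d _ => by simpa using hV d i)
  have hbound : ∀ D, p D ≤ M := by
    refine hM p hp0 ?_ ?_
    · rw [hp]
      refine Finset.sum_eq_zero fun j _ => ?_
      simp [gevreySum, fischerNorm_eq_zero (hW2 j) (show 0 < 2 by omega)]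
    · intro D hD
      have hq : 0 ≤ t + p D := add_nonneg ht.le (hp0 D)
      have h1 : ∀ i, gevreySum β t (D + 1) (subst (fun j => X j + U j) (R i)) ≤
          2 * C * (r * (t + p D)) ^ 2 := by
        intro i
        refine gevreySum_subst_le ht hq hC hr hD hΨ (fun l hl k hk => ?_) (hR2 i) (hb i)
        refine gevreySum_succ_mpow_le hβ ht hq hΨ (fun j => ?_) hl hk
        exact (gevreySum_add_le β ht D _ _).trans
          (add_le_add (gevreySum_X_le β ht D j) (hdom U hU D j))
      have h2 : ∀ i, gevreySum β t (D + 1) (derivAlong S (U i)) ≤ n * (2 / t * p D ^ 2) :=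
        fun i => gevreySum_derivAlong_le ht (hp0 D) (hU2 i) hS2 (hdom U hU D i) (hdom S hS D) hcase
      have h3 : ∀ i ∈ (Finset.univ : Finset (Fin n)), gevreySum β t (D + 1) (W i) ≤
          2 * C * (r * (t + p D)) ^ 2 + n * (2 / t * p D ^ 2) := by
        intro i _
        rw [hW i]
        exact (gevreySum_sub_le β ht _ _ _).trans (add_le_add (h1 i) (h2 i))
      rw [hp (D + 1)]
      refine (Finset.sum_le_card_nsmul _ _ _ h3).trans (le_of_eq ?_)
      simp only [Finset.card_univ, Fintype.card_fin, nsmul_eq_mul]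
      ring
  refine ⟨fun i => ?_, fun i => ?_, fun i => ?_⟩
  · exact isGevreySeries_of_gevreySum_le ht fun D => (hdom U hU D i).trans (hbound D)
  · exact isGevreySeries_of_gevreySum_le ht fun D => (hdom S hS D i).trans (hbound D)
  · refine isGevreySeries_of_gevreySum_le ht fun D => (hdom W (fun d i => ?_) D i).trans (hbound D)
    exact Finset.single_le_sum (f := fun j => fischerNorm d (W j))
      (fun j _ => fischerNorm_nonneg _ _) (Finset.mem_univ i)

/-! ### Lowering operators -/

/-- Let `v` have weight `m` and `A B v = l v`. If `B v = 0` then `l = 0`. Otherwise `B v` has weight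
`m - 2` and is an eigenvector of `A B` for `l + m - 2`, so integrality passes back from `B v` to
`v`. Weights are bounded below, so the descent ends; `N` measures the distance to the bound. -/
theorem exists_int_eq_of_hasWeight {E : Type*} [AddCommGroup E] [Module ℂ E]
    {A B H : E →ₗ[ℂ] E} (hH : H = A ∘ₗ B - B ∘ₗ A) (hHB : H ∘ₗ B = B ∘ₗ H - (2 : ℂ) • B)
    {m₀ : ℤ} (hint : ∀ (v : E) (μ : ℂ), v ≠ 0 → H v = μ • v → ∃ m : ℤ, m₀ ≤ m ∧ μ = m) :
    ∀ (N : ℕ) (m : ℤ), m < m₀ + N → ∀ (v : E) (l : ℂ), v ≠ 0 → H v = (m : ℂ) • v →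
      A (B v) = l • v → ∃ k : ℤ, l = k := by
  intro N
  induction N with
  | zero =>
    intro m hm v l hv hHv _
    obtain ⟨m', h1, h2⟩ := hint v m hv hHv
    rw [Int.cast_inj] at h2
    simp at hm
    omega
  | succ N ih =>
    intro m hm v l hv hHv hl
    by_cases hB : B v = 0
    · refine ⟨0, ?_⟩
      rw [hB, map_zero] at hl
      simpa [hv] using hl.symm
    · have h1 : H (B v) = ((m - 2 : ℤ) : ℂ) • B v := by
        have := LinearMap.congr_fun hHB v
        simp only [LinearMap.comp_apply, LinearMap.sub_apply, LinearMap.smul_apply, hHv,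
          map_smul] at this
        rw [this, ← sub_smul]
        push_cast
        rfl
      have h2 : A (B (B v)) = (l + ((m - 2 : ℤ) : ℂ)) • B v := by
        have := LinearMap.congr_fun hH (B v)
        simp only [LinearMap.comp_apply, LinearMap.sub_apply, hl, map_smul] at this
        rw [h1] at this
        rw [add_smul, this]
        abel
      obtain ⟨k, hk⟩ := ih (m - 2) (by push_cast at hm; omega) (B v) _ hB h1 h2
      refine ⟨k - (m - 2), ?_⟩
      push_cast at hk ⊢
      linear_combination hk

/-- In a finite-dimensional representation of the Lie algebra generated by `A`, `B` and `[A, B]`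
with integral weights, the eigenvalues of `A B` are integers. -/
theorem exists_int_eq_of_eigenvalue {E : Type*} [AddCommGroup E] [Module ℂ E]
    [FiniteDimensional ℂ E] {A B H : E →ₗ[ℂ] E} (hH : H = A ∘ₗ B - B ∘ₗ A)
    (hHB : H ∘ₗ B = B ∘ₗ H - (2 : ℂ) • B) (hHA : H ∘ₗ A = A ∘ₗ H + (2 : ℂ) • A)
    {m₀ : ℤ} (hint : ∀ (v : E) (μ : ℂ), v ≠ 0 → H v = μ • v → ∃ m : ℤ, m₀ ≤ m ∧ μ = m)
    {v : E} {l : ℂ} (hv : v ≠ 0) (hl : A (B v) = l • v) : ∃ k : ℤ, l = k := by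
  let W := Module.End.eigenspace (A ∘ₗ B) l
  have hmem : ∀ w, w ∈ W ↔ A (B w) = l • w := fun w => Module.End.mem_eigenspace_iff
  -- The shifts by `2` and `-2` cancel, so `H` commutes with `A B` and has an eigenvector inside the
  -- eigenspace. The descent needs such a joint eigenvector.
  have hW : ∀ w ∈ W, H w ∈ W := by
    intro w hw
    rw [hmem] at *
    have h1 := LinearMap.congr_fun hHB w
    have h2 := LinearMap.congr_fun hHA (B w)
    simp only [LinearMap.comp_apply, LinearMap.sub_apply, LinearMap.add_apply,
      LinearMap.smul_apply] at h1 h2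
    rw [h1, hw, map_sub, map_smul, map_smul] at h2
    rw [h2, hw]
    abel
  have : Nontrivial W := ⟨⟨⟨v, (hmem v).mpr hl⟩, 0, fun h => hv (congrArg Subtype.val h)⟩⟩
  obtain ⟨μ, hμ⟩ := Module.End.exists_eigenvalue (H.restrict hW)
  obtain ⟨w, hw⟩ := hμ.exists_hasEigenvector
  have hw0 : (w : E) ≠ 0 := fun h => hw.2 (Subtype.ext h)
  have hHw : H w = μ • (w : E) := congrArg Subtype.val hw.apply_eq_smul
  obtain ⟨m, hm, rfl⟩ := hint w μ hw0 hHw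
  exact exists_int_eq_of_hasWeight hH hHB hint ((m - m₀).toNat + 1) m (by push_cast; omega) w l hw0
    hHw ((hmem w).mp w.2)

/-- In an orthonormal eigenbasis of `A A*` with eigenvalues `eᵢ` one has `‖A* w‖² = ∑ eᵢ |wᵢ|²` and
`‖A A* w‖² = ∑ eᵢ² |wᵢ|²`; integers satisfy `e ≤ e²`. -/
theorem norm_adjoint_le_norm_comp_adjoint {E : Type*} [NormedAddCommGroup E]
    [InnerProductSpace ℂ E] [FiniteDimensional ℂ E] (A : E →ₗ[ℂ] E)
    (hint : ∀ (v : E) (l : ℂ), v ≠ 0 → A (A.adjoint v) = l • v → ∃ k : ℤ, l = k) (w : E) :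
    ‖A.adjoint w‖ ≤ ‖A (A.adjoint w)‖ := by
  have hT : (A ∘ₗ A.adjoint).IsSymmetric := by
    intro x y
    simp only [LinearMap.comp_apply]
    rw [← LinearMap.adjoint_inner_right, LinearMap.adjoint_inner_left]
  set b := hT.eigenvectorBasis rfl with hb
  set e := hT.eigenvalues rfl with he
  have hrepr : ∀ i, b.repr (A (A.adjoint w)) i = e i * b.repr w i :=
    fun i => hT.eigenvectorBasis_apply_self_apply rfl w i
  have heig : ∀ i, e i ≤ e i ^ 2 := by
    intro i
    have h1 : A (A.adjoint (b i)) = (e i : ℂ) • b i := hT.apply_eigenvectorBasis rfl i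
    have hne : b i ≠ 0 := b.orthonormal.ne_zero i
    obtain ⟨k, hk⟩ := hint _ _ hne h1
    have hk' : e i = k := by exact_mod_cast hk
    have : k ≤ k ^ 2 := by nlinarith [sq_nonneg k, sq_nonneg (k - 1), Int.le_self_sq k]
    rw [hk']
    exact_mod_cast this
  refine le_of_sq_le_sq ?_ (norm_nonneg _)
  have h2 : ‖A.adjoint w‖ ^ 2 = ∑ i, e i * ‖b.repr w i‖ ^ 2 := by
    have h3 : inner ℂ (A (A.adjoint w)) w = ∑ i, ((e i * ‖b.repr w i‖ ^ 2 : ℝ) : ℂ) := by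
      rw [← b.repr.inner_map_map, PiLp.inner_apply]
      refine Finset.sum_congr rfl fun i _ => ?_
      rw [hrepr, RCLike.inner_apply, map_mul, Complex.conj_ofReal]
      push_cast
      rw [← Complex.mul_conj']
      ring
    have h4 : inner ℂ (A (A.adjoint w)) w = ((‖A.adjoint w‖ ^ 2 : ℝ) : ℂ) := by
      rw [← LinearMap.adjoint_inner_right, inner_self_eq_norm_sq_to_K]
      push_cast
      rfl
    rw [h3, ← Complex.ofReal_sum] at h4
    exact_mod_cast h4.symm
  have h5 : ‖A (A.adjoint w)‖ ^ 2 = ∑ i, e i ^ 2 * ‖b.repr w i‖ ^ 2 := by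
    rw [← b.repr.norm_map, EuclideanSpace.norm_sq_eq]
    refine Finset.sum_congr rfl fun i _ => ?_
    rw [hrepr, norm_mul, mul_pow, Complex.norm_real, Real.norm_eq_abs, sq_abs]
  rw [h2, h5]
  exact Finset.sum_le_sum fun i _ => mul_le_mul_of_nonneg_right (heig i) (sq_nonneg _)

/-- Split `v` along `Ker A*` and `Im A`, then move the preimage into `Im A*` by removing its
component in `Ker A`. Pythagoras bounds both pieces, and `hA` bounds the preimage. -/
theorem exists_adjoint_decomposition {E : Type*} [NormedAddCommGroup E]
    [InnerProductSpace ℂ E] [FiniteDimensional ℂ E] (A : E →ₗ[ℂ] E)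
    (hA : ∀ w, ‖A.adjoint w‖ ≤ ‖A (A.adjoint w)‖) (v : E) :
    ∃ w s : E, A.adjoint s = 0 ∧ A (A.adjoint w) + s = v ∧ ‖A.adjoint w‖ ≤ ‖v‖ ∧ ‖s‖ ≤ ‖v‖ := by
  obtain ⟨s, hs, y, hy, hv⟩ := Submodule.exists_add_mem_mem_orthogonal (K := A.adjoint.ker) v
  rw [LinearMap.orthogonal_ker, LinearMap.adjoint_adjoint] at hy
  obtain ⟨x, rfl⟩ := hy
  obtain ⟨z, hz, u, hu, hx⟩ := Submodule.exists_add_mem_mem_orthogonal (K := A.ker) x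
  rw [LinearMap.orthogonal_ker] at hu
  obtain ⟨w, rfl⟩ := hu
  rw [LinearMap.mem_ker] at hs hz
  have hx' : A x = A (A.adjoint w) := by rw [hx, map_add, hz, zero_add]
  have horth : inner ℂ s (A x) = 0 := by
    rw [← LinearMap.adjoint_inner_left, hs, inner_zero_left]
  have hpy := norm_add_sq_eq_norm_sq_add_norm_sq_of_inner_eq_zero s (A x) horth
  rw [← hv] at hpy
  have h1 := norm_nonneg v
  refine ⟨w, s, hs, by rw [← hx', hv, add_comm], (hA w).trans ?_, ?_⟩
  · rw [← hx']
    refine le_of_sq_le_sq ?_ h1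
    nlinarith [mul_self_nonneg ‖s‖]
  · refine le_of_sq_le_sq ?_ h1
    nlinarith [mul_self_nonneg ‖A x‖]

/-! ### Standard nilpotent matrices -/

theorem nilpotentBlock_apply_succ {k : ℕ} {i j : Fin (k + 1)} (h : (i : ℕ) + 1 = j) :
    nilpotentBlock k i j = ((√(((i : ℝ) + 1) * ((k : ℝ) - i)) : ℝ) : ℂ) := if_pos h

theorem nilpotentBlock_mul_conj (k : ℕ) (i j : Fin (k + 1)) (h : (i : ℕ) + 1 = j) :
    nilpotentBlock k i j * star (nilpotentBlock k i j) = ((i : ℂ) + 1) * ((k : ℂ) - i) := by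
  rw [nilpotentBlock_apply_succ h, Complex.star_def, Complex.conj_ofReal, ← Complex.ofReal_mul,
    Real.mul_self_sqrt]
  · push_cast
    rfl
  · have : (i : ℝ) ≤ k := by exact_mod_cast Nat.lt_succ_iff.mp i.2
    exact mul_nonneg (by positivity) (by linarith)

/-- Both products are diagonal, with entries `(i + 1)(k - i)` and `i (k - i + 1)`. The square roots
in the block are there to make the difference the integer `k - 2 i`. -/
theorem nilpotentBlock_commutator (k : ℕ) :
    nilpotentBlock k * (nilpotentBlock k).conjTranspose -
      (nilpotentBlock k).conjTranspose * nilpotentBlock k =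
      Matrix.diagonal fun i : Fin (k + 1) => (((k : ℤ) - 2 * (i : ℤ) : ℤ) : ℂ) := by
  have h1 : ∀ i j : Fin (k + 1), (nilpotentBlock k * (nilpotentBlock k).conjTranspose) i j =
      if i = j then ((i : ℂ) + 1) * ((k : ℂ) - i) else 0 := by
    intro i j
    rw [Matrix.mul_apply]
    by_cases hi : (i : ℕ) + 1 < k + 1
    · rw [Finset.sum_eq_single (⟨i + 1, hi⟩ : Fin (k + 1))]
      · split_ifs with hij
        · subst hij
          rw [Matrix.conjTranspose_apply, nilpotentBlock_mul_conj k i _ rfl]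
        · rw [Matrix.conjTranspose_apply]
          have : nilpotentBlock k j ⟨i + 1, hi⟩ = 0 := by
            refine if_neg fun h => hij (Fin.ext ?_)
            simp at h
            omega
          rw [this, star_zero, mul_zero]
      · intro b _ hb
        have : nilpotentBlock k i b = 0 := if_neg fun h => hb (Fin.ext h.symm)
        rw [this, zero_mul]
      · simp
    · have hik : (i : ℕ) = k := by omega
      rw [Finset.sum_eq_zero]
      · split_ifs
        · rw [hik, sub_self, mul_zero]
        · rfl
      · intro b _
        have : nilpotentBlock k i b = 0 := if_neg fun h => by omega
        rw [this, zero_mul]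
  have h2 : ∀ i j : Fin (k + 1), ((nilpotentBlock k).conjTranspose * nilpotentBlock k) i j =
      if i = j then (i : ℂ) * ((k : ℂ) - i + 1) else 0 := by
    intro i j
    rw [Matrix.mul_apply]
    obtain ⟨i, hi⟩ := i
    cases i with
    | zero =>
      rw [Finset.sum_eq_zero]
      · simp
      · intro b _
        have : nilpotentBlock k b ⟨0, hi⟩ = 0 := if_neg (by simp)
        rw [Matrix.conjTranspose_apply, this, star_zero, zero_mul]
    | succ i =>
      rw [Finset.sum_eq_single (⟨i, by omega⟩ : Fin (k + 1))]
      · split_ifs with hij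
        · subst hij
          rw [Matrix.conjTranspose_apply, mul_comm, nilpotentBlock_mul_conj k _ _ rfl]
          push_cast
          ring
        · have : nilpotentBlock k ⟨i, by omega⟩ j = 0 := if_neg fun h => hij (Fin.ext h)
          rw [this, mul_zero]
      · intro b _ hb
        have : nilpotentBlock k b ⟨i + 1, hi⟩ = 0 := by
          refine if_neg fun h => hb (Fin.ext ?_)
          simp at h
          omega
        rw [Matrix.conjTranspose_apply, this, star_zero, zero_mul]
      · simp
  ext i j
  rw [Matrix.sub_apply, h1, h2, Matrix.diagonal_apply]
  split_ifs
  · push_cast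
    ring
  · ring

/-- A standard nilpotent matrix, its adjoint and their commutator, which is an integral diagonal
matrix, satisfy the relations of `𝔰𝔩₂`. -/
theorem IsStandardNilpotent.exists_weights {A : Matrix (Fin n) (Fin n) ℂ}
    (hA : IsStandardNilpotent A) : ∃ h : Fin n → ℤ,
      A * A.conjTranspose - A.conjTranspose * A = Matrix.diagonal (fun i => (h i : ℂ)) ∧
      ∀ i j, A i j ≠ 0 → h i - h j = 2 := by
  obtain ⟨m, k, e, rfl⟩ := hA
  set M := Matrix.blockDiagonal' fun j => nilpotentBlock (k j) with hM
  let h : (Σ j : Fin m, Fin (k j + 1)) → ℤ := fun p => (k p.1 : ℤ) - 2 * (p.2 : ℕ)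
  have hcomm : M * M.conjTranspose - M.conjTranspose * M =
      Matrix.diagonal (fun p => (h p : ℂ)) := by
    rw [hM, Matrix.blockDiagonal'_conjTranspose, ← Matrix.blockDiagonal'_mul,
      ← Matrix.blockDiagonal'_mul, ← Matrix.blockDiagonal'_sub]
    have : (fun j => nilpotentBlock (k j) * (nilpotentBlock (k j)).conjTranspose) -
        (fun j => (nilpotentBlock (k j)).conjTranspose * nilpotentBlock (k j)) =
        fun j => Matrix.diagonal fun i : Fin (k j + 1) => (((k j : ℤ) - 2 * (i : ℤ) : ℤ) : ℂ) := by
      funext j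
      exact nilpotentBlock_commutator (k j)
    rw [this, Matrix.blockDiagonal'_diagonal]
  refine ⟨fun i => h (e.symm i), ?_, ?_⟩
  · have h1 := congrArg (Matrix.reindex e e) hcomm
    rw [Matrix.reindex_apply, Matrix.submatrix_sub] at h1
    simp only [Matrix.reindex_apply, Matrix.conjTranspose_submatrix, Matrix.submatrix_mul_equiv]
    simp only [Pi.sub_apply] at h1
    rw [h1, Matrix.reindex_apply, Matrix.submatrix_diagonal_equiv]
    rfl
  · intro i j hij
    have key : ∀ p q, M p q ≠ 0 → h p - h q = 2 := by
      rintro ⟨a, x⟩ ⟨b, y⟩ hpq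
      by_cases hab : a = b
      · subst hab
        rw [hM, Matrix.blockDiagonal'_apply_eq] at hpq
        have hxy : (x : ℕ) + 1 = y := by
          by_contra hne
          exact hpq (if_neg hne)
        simp only [h]
        omega
      · exact absurd (Matrix.blockDiagonal'_apply_ne _ _ _ hab) hpq
    exact key _ _ hij

/-! ### The adjoint of the Lie operator -/

theorem polyInner_eq_inner (d : ℕ) (f g : MvPowerSeries (Fin n) ℂ) :
    polyInner d f g = inner ℂ (polyVec n d g) (polyVec n d f) := by
  rw [PiLp.inner_apply, polyInner, ← Finset.sum_coe_sort (multiIndices n d)]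
  refine Finset.sum_congr rfl fun k _ => ?_
  have h : ((√(fischerWeight d (k : Fin n →₀ ℕ)) : ℝ) : ℂ) *
      (√(fischerWeight d (k : Fin n →₀ ℕ)) : ℝ) =
      (∏ i, (((k : Fin n →₀ ℕ) i).factorial : ℂ)) / (d.factorial : ℂ) := by
    rw [← Complex.ofReal_mul, Real.mul_self_sqrt (fischerWeight_pos d _).le, fischerWeight]
    push_cast
    rfl
  rw [polyVec_apply, polyVec_apply, RCLike.inner_apply, map_mul, Complex.conj_ofReal, ← h]
  ring

theorem polyInner_comm (d : ℕ) (f g : MvPowerSeries (Fin n) ℂ) :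
    polyInner d f g = (starRingEnd ℂ) (polyInner d g f) := by
  rw [polyInner_eq_inner, polyInner_eq_inner, inner_conj_symm]

/-- For the weights `k! / |k|!`, differentiation and multiplication by the same variable are adjoint
up to the factor `d + 1`. -/
theorem polyInner_pderiv_left (d : ℕ) (f g : MvPowerSeries (Fin n) ℂ) (i : Fin n) :
    polyInner d (pderiv ℂ i f) g = (d + 1) * polyInner (d + 1) f (X i * g) := by
  have hX : ∀ k : Fin n →₀ ℕ, coeff (k + single i 1) (X i * g) = coeff k g := by
    intro k
    rw [add_comm, X, coeff_add_monomial_mul, one_mul]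
  have hX0 : ∀ k : Fin n →₀ ℕ, k i = 0 → coeff k (X i * g) = 0 := by
    classical
    intro k hk
    rw [X, coeff_monomial_mul, if_neg]
    intro hle
    have := hle i
    simp [hk] at this
  rw [polyInner, polyInner, sum_multiIndices_succ d i (by intro k hk; simp [hX0 k hk]),
    Finset.mul_sum]
  refine Finset.sum_congr rfl fun k _ => ?_
  have h := fischerWeight_add_single d k i
  simp only [fischerWeight] at h
  have h' : ((d : ℂ) + 1) * ((∏ j, (((k + single i 1 : Fin n →₀ ℕ) j).factorial : ℂ)) /
      ((d + 1).factorial : ℂ)) = ((k i : ℂ) + 1) *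
      ((∏ j, ((k j).factorial : ℂ)) / (d.factorial : ℂ)) := by
    have := congrArg (fun x : ℝ => (x : ℂ)) h
    push_cast at this
    exact this
  rw [coeff_pderiv, hX]
  linear_combination -(coeff (k + single i 1) f * (starRingEnd ℂ) (coeff k g)) * h'

/-- Both sides are `⟨∂ᵢ f, ∂ⱼ g⟩` up to the same factor; in degree zero both vanish. -/
theorem polyInner_X_mul_pderiv (d : ℕ) (f g : MvPowerSeries (Fin n) ℂ) (i j : Fin n) :
    polyInner d (X j * pderiv ℂ i f) g = polyInner d f (X i * pderiv ℂ j g) := by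
  cases d with
  | zero =>
    have h : ∀ (a b : Fin n) (f : MvPowerSeries (Fin n) ℂ), ∀ k ∈ multiIndices n 0,
        coeff k (X a * pderiv ℂ b f) = 0 := by
      intro a b f k hk
      rw [mem_multiIndices, degree_eq_zero_iff] at hk
      rw [hk, coeff_zero_eq_constantCoeff_apply]
      simp
    rw [polyInner, polyInner, Finset.sum_eq_zero, Finset.sum_eq_zero]
    · intro k hk
      rw [h _ _ _ k hk]
      simp
    · intro k hk
      rw [h _ _ _ k hk]
      simp
  | succ d =>
    have hd : ((d : ℂ) + 1) ≠ 0 := by exact_mod_cast d.succ_ne_zero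
    have h2 := polyInner_pderiv_left d f (pderiv ℂ j g) i
    have h3 : ((d : ℂ) + 1) * polyInner (d + 1) (X j * pderiv ℂ i f) g =
        polyInner d (pderiv ℂ i f) (pderiv ℂ j g) := by
      rw [polyInner_comm d, polyInner_pderiv_left, polyInner_comm (d + 1) (X j * pderiv ℂ i f),
        map_mul, map_add, map_one, Complex.conj_natCast]
    exact mul_left_cancel₀ hd (h3.trans h2)

theorem polyInner_derivAlong_conjTranspose (d : ℕ) (A : Matrix (Fin n) (Fin n) ℂ)
    (f g : MvPowerSeries (Fin n) ℂ) :
    polyInner d (derivAlong (linearField A.conjTranspose) f) g =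
      polyInner d f (derivAlong (linearField A) g) := by
  simp only [derivAlong_linearField, polyInner_eq_inner, map_sum, map_smul, inner_sum, sum_inner,
    inner_smul_left, inner_smul_right]
  rw [Finset.sum_comm]
  refine Finset.sum_congr rfl fun a _ => Finset.sum_congr rfl fun b _ => ?_
  rw [← polyInner_eq_inner, ← polyInner_eq_inner, polyInner_X_mul_pderiv,
    Matrix.conjTranspose_apply]
  rfl

/-- The adjoint of the bracket with `A x` is thus the bracket with another linear field, so the
commutator of `d₀` and `d₀*` can be computed on matrices. -/
theorem fieldInner_lieOp_conjTranspose (d : ℕ) (A : Matrix (Fin n) (Fin n) ℂ)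
    (V W : FormalField n) :
    fieldInner d (lieOp A.conjTranspose V) W = fieldInner d V (lieOp A W) := by
  have h1 : ∀ i, polyInner d (lieOp A.conjTranspose V i) (W i) =
      polyInner d (V i) (derivAlong (linearField A) (W i)) -
        ∑ j, (starRingEnd ℂ) (A j i) * polyInner d (V j) (W i) := by
    intro i
    rw [← polyInner_derivAlong_conjTranspose, lieOp_apply]
    simp only [polyInner_eq_inner, map_sub, map_sum, map_smul, inner_sub_right, inner_sum,
      inner_smul_right, Matrix.conjTranspose_apply]
    rfl
  have h2 : ∀ i, polyInner d (V i) (lieOp A W i) =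
      polyInner d (V i) (derivAlong (linearField A) (W i)) -
        ∑ j, (starRingEnd ℂ) (A i j) * polyInner d (V i) (W j) := by
    intro i
    rw [lieOp_apply]
    simp only [polyInner_eq_inner, map_sub, map_sum, map_smul, inner_sub_left, sum_inner,
      inner_smul_left]
  simp only [fieldInner, h1, h2, Finset.sum_sub_distrib]
  congr 1
  rw [Finset.sum_comm]

theorem lieOp_add (A : Matrix (Fin n) (Fin n) ℂ) (V W : FormalField n) :
    lieOp A (V + W) = lieOp A V + lieOp A W := by
  funext i
  simp only [Pi.add_apply, lieOp_apply, derivAlong_add, smul_add, Finset.sum_add_distrib]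
  ring

theorem lieOp_smul (A : Matrix (Fin n) (Fin n) ℂ) (c : ℂ) (V : FormalField n) :
    lieOp A (c • V) = c • lieOp A V := by
  funext i
  simp only [Pi.smul_apply, lieOp_apply, derivAlong_smul, smul_sub, Finset.smul_sum,
    smul_comm c]

/-- The operator `d₀` as a linear map. -/
def lieOpLin (A : Matrix (Fin n) (Fin n) ℂ) : FormalField n →ₗ[ℂ] FormalField n where
  toFun := lieOp A
  map_add' := lieOp_add A
  map_smul' := lieOp_smul A

theorem pderiv_comm (i j : Fin n) (f : MvPowerSeries (Fin n) ℂ) :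
    pderiv ℂ i (pderiv ℂ j f) = pderiv ℂ j (pderiv ℂ i f) := by
  classical
  ext k
  simp only [coeff_pderiv, Finsupp.add_apply, Finsupp.single_apply, add_right_comm k]
  by_cases h : i = j
  · subst h
    rfl
  · simp only [h, Ne.symm h, if_false]
    push_cast
    ring

theorem derivAlong_mul (V : FormalField n) (f g : MvPowerSeries (Fin n) ℂ) :
    derivAlong V (f * g) = f * derivAlong V g + derivAlong V f * g := by
  simp only [derivAlong, Derivation.leibniz, smul_eq_mul, Finset.mul_sum, Finset.sum_mul,
    ← Finset.sum_add_distrib]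
  exact Finset.sum_congr rfl fun i _ => by ring

/-- The second-order terms of the two compositions agree because partial derivatives commute. -/
theorem derivAlong_derivAlong_sub (V W : FormalField n) (f : MvPowerSeries (Fin n) ℂ) :
    derivAlong V (derivAlong W f) - derivAlong W (derivAlong V f) =
      derivAlong (fun i => derivAlong V (W i) - derivAlong W (V i)) f := by
  have h : ∀ V W : FormalField n, derivAlong V (derivAlong W f) =
      ∑ i, derivAlong V (W i) * pderiv ℂ i f +
        ∑ i, ∑ j, V i * W j * pderiv ℂ i (pderiv ℂ j f) := by
    intro V W
    conv_lhs => rw [derivAlong.eq_def W f, derivAlong_sum]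
    simp only [derivAlong_mul, Finset.sum_add_distrib]
    rw [add_comm]
    congr 1
    rw [Finset.sum_comm]
    refine Finset.sum_congr rfl fun j _ => ?_
    rw [derivAlong, Finset.mul_sum]
    exact Finset.sum_congr rfl fun i _ => by ring
  have h2 : ∑ i, ∑ j, W i * V j * pderiv ℂ i (pderiv ℂ j f) =
      ∑ i, ∑ j, V i * W j * pderiv ℂ i (pderiv ℂ j f) := by
    rw [Finset.sum_comm]
    exact Finset.sum_congr rfl fun i _ => Finset.sum_congr rfl fun j _ => by
      rw [pderiv_comm j i]
      ring
  rw [h V W, h W V, h2, add_sub_add_right_eq_sub, ← Finset.sum_sub_distrib, derivAlong]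
  exact Finset.sum_congr rfl fun i _ => by ring

theorem linearField_sub (A B : Matrix (Fin n) (Fin n) ℂ) (i : Fin n) :
    linearField (A - B) i = linearField A i - linearField B i := by
  simp [linearField, sub_smul, Finset.sum_sub_distrib]

/-- Applying linear fields as derivations reverses the order of matrix products, hence the order of
the commutator on the right. -/
theorem lieOp_lieOp_sub (A B : Matrix (Fin n) (Fin n) ℂ) (V : FormalField n) :
    lieOp A (lieOp B V) - lieOp B (lieOp A V) = lieOp (B * A - A * B) V := by
  funext i
  have h1 : (fun i => derivAlong (linearField A) (linearField B i) -
      derivAlong (linearField B) (linearField A i)) = linearField (B * A - A * B) := by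
    funext i
    rw [derivAlong_linearField_right, derivAlong_linearField_right, ← linearField_mul,
      ← linearField_mul, linearField_sub]
  have h2 := derivAlong_derivAlong_sub (linearField A) (linearField B) (V i)
  rw [h1] at h2
  have h3 : ∀ (A B : Matrix (Fin n) (Fin n) ℂ), ∑ j, (A * B) i j • V j =
      ∑ j, A i j • ∑ l, B j l • V l := by
    intro A B
    simp only [Matrix.mul_apply, Finset.sum_smul, Finset.smul_sum, smul_smul]
    rw [Finset.sum_comm]
  have h4 : ∀ (A B : Matrix (Fin n) (Fin n) ℂ), lieOp A (lieOp B V) i =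
      derivAlong (linearField A) (derivAlong (linearField B) (V i)) -
        ∑ j, B i j • derivAlong (linearField A) (V j) -
        (∑ j, A i j • derivAlong (linearField B) (V j) - ∑ j, (A * B) i j • V j) := by
    intro A B
    have hsub : ∀ f g : MvPowerSeries (Fin n) ℂ, derivAlong (linearField A) (f - g) =
        derivAlong (linearField A) f - derivAlong (linearField A) g := by
      intro f g
      simp [derivAlong, mul_sub, Finset.sum_sub_distrib]
    rw [lieOp_apply, h3]
    simp only [lieOp_apply, hsub, derivAlong_sum, derivAlong_smul, smul_sub,
      Finset.sum_sub_distrib]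
  rw [Pi.sub_apply, h4, h4, lieOp_apply, ← h2]
  simp only [Matrix.sub_apply, sub_smul, Finset.sum_sub_distrib]
  ring

/-! ### Homogeneous fields as a Euclidean space and the `𝔰𝔩₂` action -/

/-- The coefficients of degree `d` of a vector field, scaled so that the Hermitian inner product
becomes the standard one. -/
def fieldVec (n d : ℕ) :
    FormalField n →ₗ[ℂ] EuclideanSpace ℂ (Fin n × multiIndices n d) where
  toFun V := WithLp.toLp 2 fun p => coeff (p.2 : Fin n →₀ ℕ) (V p.1) *
    (√(fischerWeight d (p.2 : Fin n →₀ ℕ)) : ℝ)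
  map_add' f g := by
    ext k
    simp [add_mul]
  map_smul' c f := by
    ext k
    simp [mul_assoc]

theorem fieldVec_apply (d : ℕ) (V : FormalField n) (p : Fin n × multiIndices n d) :
    fieldVec n d V p = polyVec n d (V p.1) p.2 := rfl

/-- The homogeneous vector field with given scaled coefficients. -/
def fieldOf (n d : ℕ) :
    EuclideanSpace ℂ (Fin n × multiIndices n d) →ₗ[ℂ] FormalField n where
  toFun e := fun i k => if h : k ∈ multiIndices n d then
    e (i, ⟨k, h⟩) * (((√(fischerWeight d k) : ℝ) : ℂ))⁻¹ else 0
  map_add' e e' := by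
    funext i k
    change (if h : k ∈ multiIndices n d then
        (e + e') (i, ⟨k, h⟩) * ((√(fischerWeight d k) : ℝ) : ℂ)⁻¹ else (0 : ℂ)) =
      (if h : k ∈ multiIndices n d then
        e (i, ⟨k, h⟩) * ((√(fischerWeight d k) : ℝ) : ℂ)⁻¹ else (0 : ℂ)) +
      (if h : k ∈ multiIndices n d then
        e' (i, ⟨k, h⟩) * ((√(fischerWeight d k) : ℝ) : ℂ)⁻¹ else (0 : ℂ))
    split_ifs
    · simp [add_mul]
    · simp
  map_smul' c e := by
    funext i k
    change (if h : k ∈ multiIndices n d then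
        (c • e) (i, ⟨k, h⟩) * ((√(fischerWeight d k) : ℝ) : ℂ)⁻¹ else (0 : ℂ)) =
      c * (if h : k ∈ multiIndices n d then
        e (i, ⟨k, h⟩) * ((√(fischerWeight d k) : ℝ) : ℂ)⁻¹ else (0 : ℂ))
    split_ifs
    · simp [mul_assoc]
    · simp

theorem coeff_fieldOf (d : ℕ) (e : EuclideanSpace ℂ (Fin n × multiIndices n d)) (i : Fin n)
    (k : Fin n →₀ ℕ) : coeff k (fieldOf n d e i) = if h : k ∈ multiIndices n d then
      e (i, ⟨k, h⟩) * (((√(fischerWeight d k) : ℝ) : ℂ))⁻¹ else 0 := rfl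

theorem sqrt_fischerWeight_ne_zero (d : ℕ) (k : Fin n →₀ ℕ) :
    ((√(fischerWeight d k) : ℝ) : ℂ) ≠ 0 := by
  exact_mod_cast (Real.sqrt_pos.mpr (fischerWeight_pos d k)).ne'

theorem fieldVec_fieldOf (d : ℕ) (e : EuclideanSpace ℂ (Fin n × multiIndices n d)) :
    fieldVec n d (fieldOf n d e) = e := by
  ext p
  rw [fieldVec_apply, polyVec_apply, coeff_fieldOf, dif_pos p.2.2,
    inv_mul_cancel_right₀ (sqrt_fischerWeight_ne_zero _ _)]

theorem fieldOf_fieldVec (d : ℕ) (V : FormalField n) :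
    fieldOf n d (fieldVec n d V) = homogeneousPart d V := by
  funext i
  ext k
  rw [coeff_fieldOf, coeff_homogeneousPart]
  by_cases h : degree k = d
  · rw [dif_pos (mem_multiIndices.mpr h), if_pos h, fieldVec_apply, polyVec_apply,
      mul_inv_cancel_right₀ (sqrt_fischerWeight_ne_zero _ _)]
  · rw [dif_neg (mt mem_multiIndices.mp h), if_neg h]

theorem isHomogeneousField_fieldOf (d : ℕ) (e : EuclideanSpace ℂ (Fin n × multiIndices n d)) :
    IsHomogeneousField d (fieldOf n d e) := by
  rw [isHomogeneousField_iff, ← fieldOf_fieldVec, fieldVec_fieldOf]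

theorem fieldVec_homogeneousPart (d : ℕ) (V : FormalField n) :
    fieldVec n d (homogeneousPart d V) = fieldVec n d V := by
  rw [← fieldOf_fieldVec, fieldVec_fieldOf]

theorem inner_fieldVec (d : ℕ) (V W : FormalField n) :
    inner ℂ (fieldVec n d V) (fieldVec n d W) = fieldInner d W V := by
  rw [PiLp.inner_apply, Fintype.sum_prod_type, fieldInner]
  refine Finset.sum_congr rfl fun i _ => ?_
  rw [polyInner_eq_inner, PiLp.inner_apply]
  rfl

theorem norm_fieldVec_sq (d : ℕ) (V : FormalField n) :
    ‖fieldVec n d V‖ ^ 2 = ∑ i, fischerNorm d (V i) ^ 2 := by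
  rw [EuclideanSpace.norm_sq_eq, Fintype.sum_prod_type]
  refine Finset.sum_congr rfl fun i _ => ?_
  rw [fischerNorm, EuclideanSpace.norm_sq_eq]
  rfl

theorem fischerNorm_le_norm_fieldVec (d : ℕ) (V : FormalField n) (i : Fin n) :
    fischerNorm d (V i) ≤ ‖fieldVec n d V‖ := by
  refine le_of_sq_le_sq ?_ (norm_nonneg _)
  rw [norm_fieldVec_sq]
  exact Finset.single_le_sum (f := fun i => fischerNorm d (V i) ^ 2) (fun i _ => sq_nonneg _)
    (Finset.mem_univ i)

theorem norm_fieldVec_le (d : ℕ) (V : FormalField n) :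
    ‖fieldVec n d V‖ ≤ ∑ i, fischerNorm d (V i) := by
  refine le_of_sq_le_sq ?_ (Finset.sum_nonneg fun i _ => fischerNorm_nonneg _ _)
  rw [norm_fieldVec_sq]
  exact Finset.sum_sq_le_sq_sum_of_nonneg fun i _ => fischerNorm_nonneg _ _

/-- The operator `d₀` on the vector fields homogeneous of degree `d`. -/
def lieEnd (d : ℕ) (A : Matrix (Fin n) (Fin n) ℂ) :
    EuclideanSpace ℂ (Fin n × multiIndices n d) →ₗ[ℂ]
      EuclideanSpace ℂ (Fin n × multiIndices n d) :=
  fieldVec n d ∘ₗ lieOpLin A ∘ₗ fieldOf n d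

theorem lieEnd_apply (d : ℕ) (A : Matrix (Fin n) (Fin n) ℂ)
    (e : EuclideanSpace ℂ (Fin n × multiIndices n d)) :
    lieEnd d A e = fieldVec n d (lieOp A (fieldOf n d e)) := rfl

theorem lieEnd_fieldVec (d : ℕ) (A : Matrix (Fin n) (Fin n) ℂ) (V : FormalField n) :
    lieEnd d A (fieldVec n d V) = fieldVec n d (lieOp A V) := by
  rw [lieEnd_apply, fieldOf_fieldVec, ← homogeneousPart_lieOp, fieldVec_homogeneousPart]

theorem fieldOf_lieEnd (d : ℕ) (A : Matrix (Fin n) (Fin n) ℂ)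
    (e : EuclideanSpace ℂ (Fin n × multiIndices n d)) :
    fieldOf n d (lieEnd d A e) = lieOp A (fieldOf n d e) := by
  rw [lieEnd_apply, fieldOf_fieldVec, homogeneousPart_lieOp,
    isHomogeneousField_iff.mp (isHomogeneousField_fieldOf d e)]

theorem adjoint_lieEnd (d : ℕ) (A : Matrix (Fin n) (Fin n) ℂ) :
    (lieEnd d A).adjoint = lieEnd d A.conjTranspose := by
  symm
  rw [LinearMap.eq_adjoint_iff]
  intro x y
  rw [← fieldVec_fieldOf d x, ← fieldVec_fieldOf d y, lieEnd_fieldVec, lieEnd_fieldVec,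
    inner_fieldVec, inner_fieldVec, ← fieldInner_lieOp_conjTranspose,
    Matrix.conjTranspose_conjTranspose]

theorem lieEnd_commutator (d : ℕ) (A B : Matrix (Fin n) (Fin n) ℂ) :
    lieEnd d A ∘ₗ lieEnd d B - lieEnd d B ∘ₗ lieEnd d A = lieEnd d (B * A - A * B) := by
  refine LinearMap.ext fun x => ?_
  rw [← fieldVec_fieldOf d x]
  simp only [LinearMap.sub_apply, LinearMap.comp_apply, lieEnd_fieldVec]
  rw [← map_sub, lieOp_lieOp_sub]

theorem lieEnd_smul (d : ℕ) (c : ℂ) (A : Matrix (Fin n) (Fin n) ℂ) :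
    lieEnd d (c • A) = c • lieEnd d A := by
  refine LinearMap.ext fun x => ?_
  rw [LinearMap.smul_apply, lieEnd_apply, lieEnd_apply, ← map_smul]
  congr 1
  funext i
  rw [Pi.smul_apply, lieOp_apply, lieOp_apply]
  simp only [derivAlong_linearField, Matrix.smul_apply, smul_assoc, smul_sub, Finset.smul_sum]

/-- Monomial fields are eigenvectors of the bracket with a diagonal field, by Euler's identity in
each variable. -/
theorem coeff_lieOp_diagonal (w : Fin n → ℂ) (V : FormalField n) (i : Fin n) (k : Fin n →₀ ℕ) :
    coeff k (lieOp (Matrix.diagonal w) V i) = (∑ j, k j * w j - w i) * coeff k (V i) := by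
  have h1 : ∀ j, coeff k (X j * pderiv ℂ j (V i)) = k j * coeff k (V i) := by
    intro j
    rw [coeff_X_mul_pderiv]
    split_ifs with h
    · have h2 : k j = (k - single j 1 : Fin n →₀ ℕ) j + 1 := by
        have := Finsupp.single_le_iff.mp h
        simp
        omega
      rw [tsub_add_cancel_of_le h, h2]
      push_cast
      ring
    · have : k j = 0 := by
        by_contra h2
        exact h (Finsupp.single_le_iff.mpr (Nat.one_le_iff_ne_zero.mpr h2))
      simp [this]
  rw [lieOp_apply, derivAlong_linearField]
  simp only [Matrix.diagonal_apply, ite_smul, zero_smul, Finset.sum_ite_eq, Finset.mem_univ,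
    if_true, map_sub, map_sum, map_smul, smul_eq_mul, h1, sub_mul, Finset.sum_mul]
  congr 1
  exact Finset.sum_congr rfl fun j _ => by ring

theorem lieEnd_diagonal_apply (d : ℕ) (w : Fin n → ℤ)
    (e : EuclideanSpace ℂ (Fin n × multiIndices n d)) (p : Fin n × multiIndices n d) :
    lieEnd d (Matrix.diagonal fun i => (w i : ℂ)) e p =
      ((∑ j, ((p.2 : Fin n →₀ ℕ) j : ℤ) * w j - w p.1 : ℤ) : ℂ) * e p := by
  conv_rhs => rw [← fieldVec_fieldOf d e]
  rw [lieEnd_apply, fieldVec_apply, fieldVec_apply, polyVec_apply, polyVec_apply,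
    coeff_lieOp_diagonal]
  push_cast
  ring

/-- The lower bound, uniform in the degree, for `d₀` on the image of its adjoint. -/
theorem norm_lieEnd_ge {A : Matrix (Fin n) (Fin n) ℂ} (hA : IsStandardNilpotent A) (d : ℕ)
    (w : EuclideanSpace ℂ (Fin n × multiIndices n d)) :
    ‖(lieEnd d A).adjoint w‖ ≤ ‖lieEnd d A ((lieEnd d A).adjoint w)‖ := by
  obtain ⟨h, hcomm, hwt⟩ := hA.exists_weights
  -- The sign of `h` is reversed because `lieEnd` reverses commutators.
  set D : Matrix (Fin n) (Fin n) ℂ := Matrix.diagonal fun i => ((-h i : ℤ) : ℂ) with hD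
  have hD' : A.conjTranspose * A - A * A.conjTranspose = D := by
    rw [← neg_sub, hcomm, Matrix.diagonal_neg, hD]
    simp only [Int.cast_neg]
  have hDA : D * A = A * D - (2 : ℂ) • A := by
    ext i j
    rw [Matrix.sub_apply, hD, Matrix.diagonal_mul, Matrix.mul_diagonal, Matrix.smul_apply,
      smul_eq_mul]
    by_cases hij : A i j = 0
    · simp [hij]
    · have := hwt i j hij
      have h2 : ((h i : ℤ) : ℂ) - h j = 2 := by exact_mod_cast this
      push_cast
      linear_combination -(A i j) * h2
  have hDA' : A.conjTranspose * D - D * A.conjTranspose = (-2 : ℂ) • A.conjTranspose := by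
    have := congrArg Matrix.conjTranspose hDA
    have hDD : D.conjTranspose = D := by
      rw [hD, Matrix.diagonal_conjTranspose]
      congr 1
      funext i
      simp
    rw [Matrix.conjTranspose_mul, Matrix.conjTranspose_sub, Matrix.conjTranspose_mul, hDD,
      Matrix.conjTranspose_smul] at this
    rw [this]
    simp
  rw [adjoint_lieEnd]
  refine adjoint_lieEnd d A ▸ norm_adjoint_le_norm_comp_adjoint (lieEnd d A) ?_ w
  rw [adjoint_lieEnd]
  -- There are finitely many monomial fields in degree `d`. The bound may depend on `d`, since it
  -- only serves to end the descent.
  obtain ⟨m₀, hm₀⟩ : ∃ m₀ : ℤ, ∀ p : Fin n × multiIndices n d,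
      m₀ ≤ ∑ j, ((p.2 : Fin n →₀ ℕ) j : ℤ) * (-h j) - (-h p.1) := by
    obtain ⟨m, hm⟩ := (Set.finite_range fun p : Fin n × multiIndices n d =>
      ∑ j, ((p.2 : Fin n →₀ ℕ) j : ℤ) * (-h j) - (-h p.1)).bddBelow
    exact ⟨m, fun p => hm (Set.mem_range_self p)⟩
  intro v l hv hl
  refine exists_int_eq_of_eigenvalue (A := lieEnd d A) (B := lieEnd d A.conjTranspose)
    (H := lieEnd d D) (m₀ := m₀) ?_ ?_ ?_ ?_ hv hl
  · rw [lieEnd_commutator, hD']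
  · rw [sub_eq_iff_eq_add'.mp (lieEnd_commutator d D A.conjTranspose), hDA', lieEnd_smul]
    simp [sub_eq_add_neg]
  · rw [sub_eq_iff_eq_add'.mp (lieEnd_commutator d D A), hDA, sub_sub_cancel, lieEnd_smul]
  · intro v μ hv hμ
    obtain ⟨p, hp⟩ : ∃ p, v p ≠ 0 := by
      by_contra! hall
      exact hv (by ext p; simpa using hall p)
    refine ⟨_, hm₀ p, ?_⟩
    have h1 := lieEnd_diagonal_apply d (fun i => -h i) v p
    rw [← hD, hμ] at h1
    exact mul_right_cancel₀ hp h1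

theorem isAdjointValue_lieOp_conjTranspose {A : Matrix (Fin n) (Fin n) ℂ} {d : ℕ}
    {V : FormalField n} (hV : IsHomogeneousField d V) :
    IsAdjointValue A d V (lieOp A.conjTranspose V) := by
  refine ⟨?_, fun W _ => fieldInner_lieOp_conjTranspose d A V W⟩
  rw [isHomogeneousField_iff, homogeneousPart_lieOp, isHomogeneousField_iff.mp hV]

/-- Every vector field homogeneous of degree `d` splits as `d₀ U + S` with `U` in the image and
`S` in the kernel of the adjoint of `d₀`, with norm estimates independent of `d`. -/
theorem IsStandardNilpotent.exists_decomposition {A : Matrix (Fin n) (Fin n) ℂ}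
    (hA : IsStandardNilpotent A) (d : ℕ) (V : FormalField n) :
    ∃ U S : FormalField n, InRangeAdjoint A d U ∧ InKerAdjoint A d S ∧
      lieOp A U + S = homogeneousPart d V ∧
      (∀ i, fischerNorm d (U i) ≤ ∑ j, fischerNorm d (V j)) ∧
      (∀ i, fischerNorm d (S i) ≤ ∑ j, fischerNorm d (V j)) := by
  obtain ⟨w, s, hs, hv, hu1, hs1⟩ := exists_adjoint_decomposition (lieEnd d A)
    (norm_lieEnd_ge hA d) (fieldVec n d V)
  rw [adjoint_lieEnd] at hs hv hu1
  refine ⟨fieldOf n d (lieEnd d A.conjTranspose w), fieldOf n d s, ?_, ?_, ?_, fun i => ?_,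
    fun i => ?_⟩
  · rw [fieldOf_lieEnd]
    exact ⟨_, isHomogeneousField_fieldOf d w,
      isAdjointValue_lieOp_conjTranspose (isHomogeneousField_fieldOf d w)⟩
  · have h1 := isAdjointValue_lieOp_conjTranspose (A := A) (isHomogeneousField_fieldOf d s)
    rw [← fieldOf_lieEnd, hs, map_zero] at h1
    exact ⟨isHomogeneousField_fieldOf d s, h1⟩
  · rw [← fieldOf_lieEnd, ← map_add, hv, fieldOf_fieldVec]
  · refine (fischerNorm_le_norm_fieldVec d _ i).trans ?_
    rw [fieldVec_fieldOf]
    exact hu1.trans (norm_fieldVec_le d V)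
  · refine (fischerNorm_le_norm_fieldVec d _ i).trans ?_
    rw [fieldVec_fieldOf]
    exact hs1.trans (norm_fieldVec_le d V)

end GevreyNF

end

noncomputable section

namespace GevreyNF

open scoped DirectSum

variable {n : ℕ}

/-! ### The Jordan form of a nilpotent matrix -/

section JordanBasis

open Polynomial

/-- The basis `1, X, …, X ^ (k - 1)` of `ℂ[X] / (X ^ k)`. -/
def quotXPowBasis (k : ℕ) :
    Module.Basis (Fin k) ℂ (ℂ[X] ⧸ (Submodule.span ℂ[X] {(X ^ k : ℂ[X])})) :=
  (((AdjoinRoot.powerBasis' (monic_X_pow (R := ℂ) k)).basis).reindex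
    (finCongr (by rw [AdjoinRoot.powerBasis'_dim, natDegree_X_pow]))).map
    -- `AdjoinRoot` and the quotient by the span are the same module by definition, so the identity
    -- transports the basis.
    { toFun := fun x => x
      map_add' := fun _ _ => rfl
      map_smul' := fun _ _ => rfl
      invFun := fun x => x
      left_inv := fun _ => rfl
      right_inv := fun _ => rfl }

theorem quotXPowBasis_apply (k : ℕ) (j : Fin k) :
    quotXPowBasis k j = Submodule.Quotient.mk (X ^ (j : ℕ)) := by
  simp only [quotXPowBasis, Module.Basis.map_apply, Module.Basis.reindex_apply,
    PowerBasis.coe_basis, AdjoinRoot.powerBasis'_gen]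
  rfl

theorem dfinsuppBasis_apply {ι : Type*} [DecidableEq ι] {M : ι → Type*}
    [∀ i, AddCommGroup (M i)] [∀ i, Module ℂ (M i)] {η : ι → Type*}
    (b : ∀ i, Module.Basis (η i) ℂ (M i)) (i : ι) (j : η i) :
    DFinsupp.basis b ⟨i, j⟩ = DFinsupp.single i (b i j) := by
  classical
  rw [Module.Basis.apply_eq_iff]
  ext ⟨i', j'⟩
  have h : ∀ x, (DFinsupp.basis b).repr x ⟨i', j'⟩ = (b i').repr (x i') j' := fun _ => rfl
  rw [h]
  by_cases hi : i = i'
  · subst hi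
    rw [DFinsupp.single_eq_same, Module.Basis.repr_self, Finsupp.single_apply,
      Finsupp.single_apply]
    simp
  · rw [DFinsupp.single_eq_of_ne (Ne.symm hi), map_zero, Finsupp.zero_apply,
      Finsupp.single_eq_of_ne]
    exact fun h => hi (congrArg Sigma.fst h).symm

theorem X_smul_quotXPowBasis (k : ℕ) (j : Fin k) :
    (X : ℂ[X]) • quotXPowBasis k j =
      if h : (j : ℕ) + 1 < k then quotXPowBasis k ⟨j + 1, h⟩ else 0 := by
  rw [quotXPowBasis_apply, ← Submodule.Quotient.mk_smul, smul_eq_mul, ← pow_succ']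
  split_ifs with h
  · rw [quotXPowBasis_apply]
  · have hk : (j : ℕ) + 1 = k := by omega
    rw [hk]
    exact (Submodule.Quotient.mk_eq_zero _).mpr (Submodule.mem_span_singleton_self _)

/-- Chain bases of the summands are glued along a decomposition that intertwines `f` with the
componentwise maps; of these maps only the values at zero and on the bases matter. -/
theorem exists_chain_basis_of_equiv {V : Type*} [AddCommGroup V] [Module ℂ V] {f : V →ₗ[ℂ] V}
    {d : ℕ} {k : Fin d → ℕ} {M : Fin d → Type*} [∀ i, AddCommGroup (M i)] [∀ i, Module ℂ (M i)]
    {g : ∀ i, M i → M i} (hg0 : ∀ i, g i 0 = 0) (β : ∀ i, Module.Basis (Fin (k i)) ℂ (M i))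
    (hg : ∀ i j, g i (β i j) = if h : (j : ℕ) + 1 < k i then β i ⟨j + 1, h⟩ else 0)
    (E : V ≃ₗ[ℂ] Π₀ i : Fin d, M i) (hE : ∀ v i, E (f v) i = g i (E v i)) :
    ∃ b : Module.Basis (Σ i : Fin d, Fin (k i)) ℂ V,
      ∀ (i : Fin d) (j : Fin (k i)), f (b ⟨i, j⟩) =
        if h : (j : ℕ) + 1 < k i then b ⟨i, ⟨j + 1, h⟩⟩ else 0 := by
  have hB : ∀ (i : Fin d) (j : Fin (k i)), E (((DFinsupp.basis β).map E.symm) ⟨i, j⟩) =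
      DFinsupp.single i (β i j) := by
    intro i j
    rw [Module.Basis.map_apply, LinearEquiv.apply_symm_apply]
    have h := dfinsuppBasis_apply β i j
    rw [h]
  refine ⟨(DFinsupp.basis β).map E.symm, fun i j => E.injective (DFinsupp.ext fun i' => ?_)⟩
  rw [hE, hB]
  by_cases hi : i = i'
  · subst hi
    rw [DFinsupp.single_eq_same, hg]
    split_ifs with h
    · rw [hB, DFinsupp.single_eq_same]
    · rw [map_zero, DFinsupp.zero_apply]
  · rw [DFinsupp.single_eq_of_ne (Ne.symm hi), hg0]
    split_ifs with h
    · rw [hB, DFinsupp.single_eq_of_ne (Ne.symm hi)]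
    · rw [map_zero, DFinsupp.zero_apply]

/-- A nilpotent endomorphism has a basis made of chains `v, f v, …, f ^ (k - 1) v`, `f ^ k v = 0`. -/
theorem exists_chain_basis {V : Type*} [AddCommGroup V] [Module ℂ V] [FiniteDimensional ℂ V]
    {f : V →ₗ[ℂ] V} (hf : IsNilpotent f) :
    ∃ (d : ℕ) (k : Fin d → ℕ) (b : Module.Basis (Σ i : Fin d, Fin (k i)) ℂ V),
      ∀ (i : Fin d) (j : Fin (k i)), f (b ⟨i, j⟩) =
        if h : (j : ℕ) + 1 < k i then b ⟨i, ⟨j + 1, h⟩⟩ else 0 := by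
  -- Nilpotency makes `V`, with `X` acting as `f`, a torsion module for the powers of the prime `X`,
  -- hence a direct sum of modules `ℂ[X] / (X ^ kᵢ)`.
  have htors : Module.IsTorsion' (Module.AEval' f) (Submonoid.powers (X : ℂ[X])) := by
    rw [Submodule.isTorsion'_powers_iff]
    intro x
    obtain ⟨N, hN⟩ := hf
    refine ⟨N, ?_⟩
    obtain ⟨v, rfl⟩ := (Module.AEval'.of f).surjective x
    rw [Module.AEval'.X_pow_smul_of, hN, zero_smul, map_zero]
  obtain ⟨d, k, ⟨e⟩⟩ := Module.torsion_by_prime_power_decomposition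
    (irreducible_X (R := ℂ)) htors
  have e' : Module.AEval' f ≃ₗ[ℂ[X]]
      Π₀ i : Fin d, ℂ[X] ⧸ (Submodule.span ℂ[X] {(X ^ k i : ℂ[X])}) := e
  refine ⟨d, k, exists_chain_basis_of_equiv (g := fun _ x => (X : ℂ[X]) • x)
    (fun _ => smul_zero _) (fun i => quotXPowBasis (k i)) (fun i => X_smul_quotXPowBasis (k i))
    ((Module.AEval'.of f).trans (e'.restrictScalars ℂ)) fun v i => ?_⟩
  change e' (Module.AEval'.of f (f v)) i = (X : ℂ[X]) • e' (Module.AEval'.of f v) i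
  rw [← DFinsupp.smul_apply, ← map_smul, Module.AEval'.X_smul_of]

end JordanBasis

/-- The factor relating the `j`-th basis vector of a chain to the normalization of the standard
block. -/
def chainScale (k j : ℕ) : ℂ :=
  ∏ i ∈ Finset.range j, ((√(((i : ℝ) + 1) * ((k : ℝ) - i)) : ℝ) : ℂ)

theorem chainScale_ne_zero {k j : ℕ} (h : j ≤ k) : chainScale k j ≠ 0 := by
  refine Finset.prod_ne_zero_iff.mpr fun i hi => ?_
  have hi' : (i : ℝ) < k := by
    exact_mod_cast (Finset.mem_range.mp hi).trans_le h
  have : (0 : ℝ) < ((i : ℝ) + 1) * ((k : ℝ) - i) := mul_pos (by positivity) (by linarith)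
  exact Complex.ofReal_ne_zero.mpr (Real.sqrt_pos.mpr this).ne'

/-- A nilpotent endomorphism is represented in some basis by standard blocks. -/
theorem exists_standard_basis {V : Type*} [AddCommGroup V] [Module ℂ V] [FiniteDimensional ℂ V]
    {f : V →ₗ[ℂ] V} (hf : IsNilpotent f) :
    ∃ (m : ℕ) (k : Fin m → ℕ) (b : Module.Basis (Σ i : Fin m, Fin (k i + 1)) ℂ V),
      LinearMap.toMatrix b b f = Matrix.blockDiagonal' fun i => nilpotentBlock (k i) := by
  obtain ⟨d, κ, b₀, hb₀⟩ := exists_chain_basis hf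
  -- Summands of dimension zero are discarded, because a standard block has size at least one.
  let σ := (Fintype.equivFin {i : Fin d // κ i ≠ 0}).symm
  set m := Fintype.card {i : Fin d // κ i ≠ 0}
  let k : Fin m → ℕ := fun a => κ (σ a) - 1
  have hk : ∀ a, k a + 1 = κ (σ a) := fun a => by
    have := (σ a).2
    simp only [k]
    omega
  -- Chains are reversed: `f` moves forward along a chain, while the standard block sends each basis
  -- vector to a multiple of its predecessor.
  let φ : (Σ a : Fin m, Fin (k a + 1)) → Σ i : Fin d, Fin (κ i) := fun p =>
    ⟨σ p.1, ⟨k p.1 - p.2, by have := hk p.1; omega⟩⟩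
  have hφ : Function.Bijective φ := by
    constructor
    · rintro ⟨a, x⟩ ⟨b, y⟩ h
      have hab : a = b := σ.injective (Subtype.ext (congrArg Sigma.fst h))
      subst hab
      have h2 := congrArg (fun p : Σ i : Fin d, Fin (κ i) => (p.2 : ℕ)) h
      simp only [φ] at h2
      have : x = y := Fin.ext (by omega)
      rw [this]
    · rintro ⟨i, x⟩
      have hi : κ i ≠ 0 := by
        have := x.2
        omega
      obtain ⟨a, ha⟩ := σ.surjective ⟨i, hi⟩
      have hi' : i = σ a := by rw [ha]
      subst hi'
      have := hk a
      refine ⟨⟨a, ⟨k a - x, by omega⟩⟩, ?_⟩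
      simp only [φ]
      congr 1
      ext
      simp only
      omega
  let b₁ := b₀.reindex (Equiv.ofBijective φ hφ).symm
  have hb₁ : ∀ p, b₁ p = b₀ (φ p) := fun p => by
    simp [b₁]
  let b := b₁.isUnitSMul (w := fun p => chainScale (k p.1) p.2)
    (fun p => isUnit_iff_ne_zero.mpr (chainScale_ne_zero (by omega)))
  have hb : ∀ p, b p = chainScale (k p.1) p.2 • b₀ (φ p) := fun p => by
    rw [← hb₁]
    exact Module.Basis.isUnitSMul_apply _ p
  have hf0 : ∀ (a : Fin m) (h : 0 < k a + 1), f (b ⟨a, ⟨0, h⟩⟩) = 0 := by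
    intro a h
    rw [hb, map_smul, hb₀, dif_neg, smul_zero]
    have := hk a
    simp only
    omega
  have hfs : ∀ (a : Fin m) (j : ℕ) (h : j + 1 < k a + 1), f (b ⟨a, ⟨j + 1, h⟩⟩) =
      nilpotentBlock (k a) ⟨j, by omega⟩ ⟨j + 1, h⟩ • b ⟨a, ⟨j, by omega⟩⟩ := by
    intro a j h
    have := hk a
    rw [hb, map_smul, hb₀, dif_pos (by simp only; omega), hb, smul_smul,
      nilpotentBlock_apply_succ rfl, chainScale, Finset.prod_range_succ, mul_comm, chainScale]
    congr 2
    simp only [φ]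
    congr 2
    omega
  refine ⟨m, k, b, ?_⟩
  ext ⟨a, x⟩ ⟨c, y⟩
  rw [LinearMap.toMatrix_apply]
  obtain ⟨y, hy⟩ := y
  cases y with
  | zero =>
    rw [hf0, map_zero, Finsupp.zero_apply]
    by_cases hac : a = c
    · subst hac
      rw [Matrix.blockDiagonal'_apply_eq]
      exact (if_neg (by simp)).symm
    · rw [Matrix.blockDiagonal'_apply_ne _ _ _ hac]
  | succ j =>
    rw [hfs, map_smul, Finsupp.smul_apply, Module.Basis.repr_self, smul_eq_mul]
    by_cases hac : a = c
    · subst hac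
      rw [Matrix.blockDiagonal'_apply_eq]
      by_cases hx : x = ⟨j, by omega⟩
      · rw [hx, Finsupp.single_eq_same, mul_one]
      · rw [Finsupp.single_eq_of_ne, mul_zero]
        · refine (if_neg fun h => hx (Fin.ext ?_)).symm
          simp at h
          omega
        · intro h
          have := congrArg (fun p : Σ a : Fin m, Fin (k a + 1) => (p.2 : ℕ)) h
          exact hx (Fin.ext this)
    · rw [Matrix.blockDiagonal'_apply_ne _ _ _ hac, Finsupp.single_eq_of_ne, mul_zero]
      exact fun h => hac (congrArg Sigma.fst h)

theorem exists_standardizes {A : Matrix (Fin n) (Fin n) ℂ} (hA : IsNilpotent A) :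
    ∃ P : Matrix (Fin n) (Fin n) ℂ, Standardizes P A := by
  have hf : IsNilpotent (Matrix.toLin' A) := by
    obtain ⟨N, hN⟩ := hA
    exact ⟨N, by rw [← Matrix.toLin'_pow, hN, map_zero]⟩
  obtain ⟨m, k, b, hb⟩ := exists_standard_basis hf
  have hcard : Fintype.card (Σ i : Fin m, Fin (k i + 1)) = n := by
    rw [← Module.finrank_eq_card_basis b]
    simp
  let e : (Σ i : Fin m, Fin (k i + 1)) ≃ Fin n := Fintype.equivFinOfCardEq hcard
  let c := b.reindex e
  let s := Pi.basisFun ℂ (Fin n)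
  let P := s.toMatrix c
  have hP : P * c.toMatrix s = 1 := s.toMatrix_mul_toMatrix_flip c
  have hdet : IsUnit P.det := (Matrix.isUnit_iff_isUnit_det P).mp
    (IsUnit.of_mul_eq_one _ hP)
  refine ⟨P, hdet, m, k, e, ?_⟩
  have hinv : P⁻¹ = c.toMatrix s := Matrix.inv_eq_right_inv hP
  have h1 := basis_toMatrix_mul_linearMap_toMatrix_mul_basis_toMatrix c s c s (Matrix.toLin' A)
  have h2 : LinearMap.toMatrix s s (Matrix.toLin' A) = A := by
    rw [LinearMap.toMatrix_eq_toMatrix', LinearMap.toMatrix'_toLin']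
  rw [h2] at h1
  rw [hinv, h1, ← hb]
  ext i j
  rw [Matrix.reindex_apply, Matrix.submatrix_apply, LinearMap.toMatrix_apply,
    LinearMap.toMatrix_apply]
  simp [c]

end GevreyNF

end

noncomputable section

namespace GevreyNF

open MvPowerSeries Finsupp

variable {n : ℕ}

/-! ### Normalization -/

theorem derivAlong_linearField_linearField (A B : Matrix (Fin n) (Fin n) ℂ) (i : Fin n) :
    derivAlong (linearField A) (linearField B i) = linearField (B * A) i := by
  rw [derivAlong_linearField_right, linearField_mul]

theorem isHomogeneous_X (i : Fin n) : (X i : MvPowerSeries (Fin n) ℂ).IsHomogeneous 1 := by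
  classical
  intro e he
  rw [coeff_X] at he
  split_ifs at he with hi
  · simp [hi, weight_single]
  · exact absurd rfl he

theorem homogeneousPart_linearField_add (A : Matrix (Fin n) (Fin n) ℂ) (S : FormalField n) {d : ℕ}
    (hd : d ≠ 1) : homogeneousPart d (linearField A + S) = homogeneousPart d S := by
  funext i
  ext k
  rw [coeff_homogeneousPart, coeff_homogeneousPart]
  split_ifs with hk
  · rw [Pi.add_apply, map_add, linearField, map_sum, Finset.sum_eq_zero, zero_add]
    intro j _
    rw [coeff_smul, IsHomogeneous.coeff_eq_zero (isHomogeneous_X j) (hk ▸ hd), mul_zero]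
  · rfl

theorem derivAlong_mem_ordGE {V : FormalField n} {f : MvPowerSeries (Fin n) ℂ}
    (hV : ∀ i, V i ∈ ordGE n 2) (hf : f ∈ ordGE n 2) : derivAlong V f ∈ ordGE n 2 :=
  Submodule.sum_mem _ fun i _ => ordGE_mono (Nat.le_succ 2)
    (mul_mem_ordGE (hV i) (pderiv_mem_ordGE hf i))

/-- Degree one suffices: iterating the derivation on the coordinate functions produces the rows of
the powers of `A`. -/
theorem IsNilpotentLinear.isNilpotent {A : Matrix (Fin n) (Fin n) ℂ} (hA : IsNilpotentLinear A) :
    IsNilpotent A := by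
  obtain ⟨k, hk⟩ := hA 1 le_rfl
  refine ⟨k, ?_⟩
  have h : ∀ (m : ℕ) (i : Fin n),
      (derivAlong (linearField A))^[m] (linearField 1 i) = linearField (A ^ m) i := by
    intro m i
    induction m with
    | zero => rw [pow_zero, Function.iterate_zero, id]
    | succ m ih =>
      rw [Function.iterate_succ_apply', ih, derivAlong_linearField_linearField, pow_succ]
  have h0 : linearField (A ^ k) = 0 := by
    funext i
    rw [← h]
    refine hk _ ?_
    rw [linearField_one]
    exact isHomogeneous_X i
  rw [← linearPart_linearField (A ^ k), h0]
  rfl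

/-- The vector field `A x + R` is conjugate by `id + U` to `A x + S` as soon as `U` and `S` solve
the conjugacy equation. -/
theorem transformsTo_of_conjugacy_equation {A : Matrix (Fin n) (Fin n) ℂ} {R U S : FormalField n}
    (hU : ∀ i, U i ∈ ordGE n 2)
    (h : ∀ i, lieOp A U i + S i = subst (fun j => X j + U j) (R i) - derivAlong S (U i)) :
    TransformsTo (fun i => X i + U i) (linearField A + R) (linearField A + S) := by
  have hΨ := add_X_mem_ordGE hU
  funext i
  have h1 : compose (linearField A + R) (fun i => X i + U i) i =
      compose (linearField A) (fun i => X i + U i) i + subst (fun j => X j + U j) (R i) :=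
    subst_add (hasSubst_of_ordGE hΨ) _ _
  have h2 := h i
  rw [lieOp_apply, eq_sub_iff_add_eq] at h2
  have h3 : ∀ f, derivAlong (linearField A + S) f = derivAlong (linearField A) f + derivAlong S f := by
    intro f
    simp only [derivAlong, Pi.add_apply, add_mul, Finset.sum_add_distrib]
  rw [h1, compose_linearField hΨ, ← h2, h3, derivAlong_add, derivAlong_add, derivAlong_X,
    derivAlong_X]
  simp only [linearField, smul_add, Finset.sum_add_distrib]
  ring

/-- Normalization of a vector field whose linear part is standard. -/
theorem exists_normalization {α : ℝ} (hα : 0 ≤ α) {A : Matrix (Fin n) (Fin n) ℂ}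
    (hA : IsStandardNilpotent A) {Y : FormalField n} (hY : IsGevrey α Y)
    (hY1 : ∀ i, Y i ∈ ordGE n 1) (hYA : linearPart Y = A) :
    ∃ U S W : FormalField n, (∀ i, U i ∈ ordGE n 2) ∧ (∀ i, S i ∈ ordGE n 2) ∧
      (∀ i, W i ∈ ordGE n 2) ∧
      (∀ d, 2 ≤ d → InRangeAdjoint A d (homogeneousPart d U)) ∧
      (∀ d, 2 ≤ d → InKerAdjoint A d (homogeneousPart d S)) ∧
      TransformsTo (fun i => X i + U i) Y (linearField A + S) ∧
      compose (fun i => X i + U i) (fun i => X i + W i) = X ∧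
      compose (fun i => X i + W i) (fun i => X i + U i) = X ∧
      ∀ β, α ≤ β → (S = 0 ∨ 1 ≤ β) → IsGevrey β U ∧ IsGevrey β S ∧ IsGevrey β W := by
  obtain ⟨R, hR⟩ : ∃ R, R = Y - linearField A := ⟨_, rfl⟩
  have hYR : Y = linearField A + R := by rw [hR, add_sub_cancel]
  have hR2 : ∀ i, R i ∈ ordGE n 2 := by
    intro i
    rw [hR, ← hYA]
    exact sub_linearField_mem_ordGE hY1 i
  have hRG : IsGevrey α R := by
    intro i
    have h : R i = Y i + (-1 : ℂ) • linearField A i := by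
      rw [hR, neg_one_smul, ← sub_eq_add_neg, Pi.sub_apply]
    rw [h]
    exact (hY i).add ((isGevrey_linearField α A i).smul _)
  -- The choices need not be linear in the field. Only the dependence on one homogeneous part and
  -- the norm bounds are used.
  choose T S hT hS hTS hTn hSn using hA.exists_decomposition
  have hTh : ∀ d V, IsHomogeneousField d (T d V) := fun d V => by
    obtain ⟨_, _, h⟩ := hT d V
    exact h.1
  have hSh : ∀ d V, IsHomogeneousField d (S d V) := fun d V => (hS d V).1
  obtain ⟨W, hW⟩ := exists_solution hR2 T S
  have hU2 := degreewise_mem_ordGE T W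
  have hS2 := degreewise_mem_ordGE S W
  have hUd := fun d (hd : 2 ≤ d) => homogeneousPart_degreewise hTh W hd
  have hSd := fun d (hd : 2 ≤ d) => homogeneousPart_degreewise hSh W hd
  set U := degreewise T W
  set S' := degreewise S W
  have hΨ := add_X_mem_ordGE hU2
  have hW2 : ∀ i, W i ∈ ordGE n 2 := by
    intro i
    rw [hW]
    exact sub_mem (compose_mem_ordGE hΨ hR2 i) (derivAlong_mem_ordGE hS2 (hU2 i))
  have hnorm : ∀ (Q : ℕ → FormalField n → FormalField n) (V : FormalField n),
      (∀ i, V i ∈ ordGE n 2) →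
      (∀ d, 2 ≤ d → homogeneousPart d V = Q d (homogeneousPart d W)) →
      (∀ d V i, fischerNorm d (Q d V i) ≤ ∑ j, fischerNorm d (V j)) →
      ∀ d i, fischerNorm d (V i) ≤ ∑ j, fischerNorm d (W j) := by
    intro Q V hV2 hV hQ d i
    rcases lt_or_ge d 2 with hd | hd
    · rw [fischerNorm_eq_zero (hV2 i) hd]
      exact Finset.sum_nonneg fun j _ => fischerNorm_nonneg _ _
    · have h := hQ d (homogeneousPart d W) i
      rw [← hV d hd] at h
      simpa only [homogeneousPart, fischerNorm_homogeneousComponent] using h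
  -- Degree by degree: below two everything vanishes, and from two on this is the splitting of the
  -- part of `W`.
  have hWeq : ∀ i, W i = lieOp A U i + S' i := by
    intro i
    ext k
    have hc := coeff_homogeneousPart (degree k) W i k
    rw [if_pos rfl] at hc
    rcases lt_or_ge (degree k) 2 with hd | hd
    · have hl := congrFun (homogeneousPart_lieOp (degree k) A U) i
      have hU0 : homogeneousPart (degree k) U = 0 := by
        funext j
        ext e
        rw [coeff_homogeneousPart]
        split_ifs with he
        · exact hU2 j e (by rwa [he])
        · rfl
      have hl0 : coeff k (lieOp A U i) = 0 := by
        have h := coeff_homogeneousPart (degree k) (lieOp A U) i k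
        rw [if_pos rfl, hl, hU0, lieOp_apply] at h
        rw [← h]
        simp [derivAlong]
      rw [map_add, hl0, hS2 i k hd, add_zero]
      exact hW2 i k hd
    · have h := hTS (degree k) (homogeneousPart (degree k) W)
      rw [isHomogeneousField_iff.mp (isHomogeneousField_homogeneousPart _ W), ← hUd _ hd,
        ← hSd _ hd, ← homogeneousPart_lieOp] at h
      rw [← hc, ← h, Pi.add_apply, map_add, map_add, coeff_homogeneousPart, coeff_homogeneousPart,
        if_pos rfl, if_pos rfl]
  obtain ⟨Z, hZ2, hZ, hUZ, hZU⟩ := exists_inverse hU2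
  refine ⟨U, S', Z, hU2, hS2, hZ2, fun d hd => ?_, fun d hd => ?_, ?_, hUZ, hZU, ?_⟩
  · rw [hUd d hd]
    exact hT _ _
  · rw [hSd d hd]
    exact hS _ _
  · rw [hYR]
    exact transformsTo_of_conjugacy_equation hU2 fun i => by rw [← hWeq, ← hW]
  · intro β hαβ hcase
    have hβ := hα.trans hαβ
    obtain ⟨hGU, hGS, -⟩ := isGevrey_of_conjugacy_equation hβ (fun i => (hRG i).mono hαβ) hR2 hU2
      hS2 hW2 (hnorm T U hU2 hUd hTn) (hnorm S S' hS2 hSd hSn) hW hcase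
    have hnU : IsGevrey β (fun i => -(U i)) := fun i => by
      simpa only [neg_one_smul] using (hGU i).smul (-1)
    refine ⟨hGU, hGS, ?_⟩
    -- The correction of the inverse satisfies `Z = -U ∘ (id + Z)`, the conjugacy equation with `S =
    -- 0`, so no condition `1 ≤ β` is needed here.
    exact (isGevrey_of_conjugacy_equation hβ (S := 0) hnU (fun i => neg_mem (hU2 i)) hZ2
      (fun _ => zero_mem _) hZ2
      (fun d i => Finset.single_le_sum (f := fun j => fischerNorm d (Z j))
        (fun j _ => fischerNorm_nonneg _ _) (Finset.mem_univ i))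
      (fun d i => by
        rw [Pi.zero_apply, fischerNorm_eq_zero (zero_mem (ordGE n (d + 1))) d.lt_succ_self]
        exact Finset.sum_nonneg fun j _ => fischerNorm_nonneg _ _)
      (fun i => by
        rw [hZ i]
        simp [derivAlong]) (Or.inl rfl)).1

theorem isGevrey_X_add {β : ℝ} {U : FormalField n} (hU : IsGevrey β U) :
    IsGevrey β (fun i => X i + U i) :=
  fun i => (isGevreySeries_X β i).add (hU i)

theorem AreInverse.isUnit_det_linearPart {Φ Ψ : FormalField n} (h : AreInverse Φ Ψ) :
    IsUnit (linearPart Φ).det ∧ IsUnit (linearPart Ψ).det := by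
  obtain ⟨hΦ, hΨ, h1, -⟩ := h
  have h2 := linearPart_compose (fun i => mem_ordGE_one.mpr (hΦ i))
    (fun i => mem_ordGE_one.mpr (hΨ i))
  rw [h1, ← linearField_one, linearPart_linearField] at h2
  rw [← Matrix.isUnit_iff_isUnit_det, ← Matrix.isUnit_iff_isUnit_det]
  exact ⟨IsUnit.of_mul_eq_one _ h2.symm, IsUnit.of_mul_eq_one_right _ h2.symm⟩

/-- A linear change of coordinates. -/
theorem transformsTo_linearField {P : Matrix (Fin n) (Fin n) ℂ} (hP : IsUnit P.det)
    {V : FormalField n} (hV : ∀ i, V i ∈ ordGE n 1) :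
    TransformsTo (linearField P) V
      (compose (linearField P⁻¹) (compose V (linearField P))) := by
  funext i
  have h1 := compose_mem_ordGE (linearField_mem_ordGE P) hV
  rw [derivAlong_linearField_right, ← compose_linearField (compose_mem_ordGE h1
    (linearField_mem_ordGE _)), ← compose_assoc (linearField_mem_ordGE _) h1,
    compose_linearField_linearField, Matrix.mul_nonsing_inv P hP, linearField_one,
    compose_X_left h1]

/-- Going back from `X'` to `V` and then on to the linear field is a conjugacy with invertible
linear part, so rigidity of normal forms applies. -/
theorem eq_linearField_of_isFormallyLinearizable {A : Matrix (Fin n) (Fin n) ℂ}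
    {Φ Ψ V X' : FormalField n} (h : AreInverse Φ Ψ) (hT : TransformsTo Ψ V X')
    (hX' : IsNormalForm A X') (hV : IsFormallyLinearizable V) : X' = linearField A := by
  obtain ⟨Φ₂, Ψ₂, B, hinv, hB⟩ := hV
  have hΦ1 := fun i => mem_ordGE_one.mpr (h.1 i)
  have hΨ1 := fun i => mem_ordGE_one.mpr (h.2.1 i)
  have hΨ₂1 := fun i => mem_ordGE_one.mpr (hinv.2.1 i)
  refine eq_linearField_of_isNormalForm hX' (compose_mem_ordGE hΨ₂1 hΦ1) ?_
    ((TransformsTo.symm hΦ1 hΨ1 h.2.2.1 h.2.2.2 hT).comp hΦ1 hΨ₂1 hB)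
  rw [linearPart_compose hΦ1 hΨ₂1, Matrix.det_mul]
  exact h.isUnit_det_linearPart.1.mul hinv.isUnit_det_linearPart.2

end GevreyNF

end

/-! ### The main theorem -/

open GevreyNF

theorem theorem1 (n : ℕ) (α : ℝ) (hα : 0 ≤ α) (X : FormalField n)
    (hX : IsGevrey α X) (hX0 : VanishesAtZero X) (hnil : IsNilpotentLinear (linearPart X)) :
    (∃ P : Matrix (Fin n) (Fin n) ℂ, Standardizes P (linearPart X)) ∧
    ∀ P : Matrix (Fin n) (Fin n) ℂ, Standardizes P (linearPart X) →
      ∃ (U Φ Ψ X' : FormalField n),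
        IsNormalizedCorrection (P⁻¹ * linearPart X * P) U ∧
        Ψ = (fun i => ∑ j, P i j • (MvPowerSeries.X j + U j)) ∧
        AreInverse Φ Ψ ∧
        TransformsTo Ψ X X' ∧
        IsNormalForm (P⁻¹ * linearPart X * P) X' ∧
        (IsGevrey (1 + α) Φ ∧ IsGevrey (1 + α) Ψ ∧ IsGevrey (1 + α) X') ∧
        (IsFormallyLinearizable X →
          IsGevrey α Φ ∧ IsGevrey α Ψ ∧ IsGevrey α X' ∧
            X' = linearField (P⁻¹ * linearPart X * P)) := by
  refine ⟨exists_standardizes hnil.isNilpotent, fun P ⟨hP, hA⟩ => ?_⟩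
  have hX1 : ∀ i, X i ∈ ordGE n 1 := fun i => mem_ordGE_one.mpr (hX0 i)
  have hP1 := linearField_mem_ordGE P
  have hQ1 := linearField_mem_ordGE P⁻¹
  have hXP := compose_mem_ordGE hP1 hX1
  -- The normalization is carried out on `P⁻¹ ∘ X ∘ P`, whose linear part is standard and which is
  -- still Gevrey-`α`.
  have hYA : linearPart (compose (linearField P⁻¹) (compose X (linearField P))) =
      P⁻¹ * linearPart X * P := by
    rw [linearPart_compose hQ1 hXP, linearPart_compose hX1 hP1, linearPart_linearField,
      linearPart_linearField, mul_assoc]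
  obtain ⟨U, S, W, hU2, hS2, hW2, hU, hS, hT, hUW, hWU, hG⟩ := exists_normalization hα hA
    (((isGevrey_linearField α P⁻¹).compose hα (hX.compose hα (isGevrey_linearField α P) hP1) hXP))
    (compose_mem_ordGE hXP hQ1) hYA
  have hU1 := add_X_mem_ordGE hU2
  have hW1 := add_X_mem_ordGE hW2
  set A := P⁻¹ * linearPart X * P
  set Ψ := compose (linearField P) (fun i => MvPowerSeries.X i + U i) with hΨ
  set Φ := compose (fun i => MvPowerSeries.X i + W i) (linearField P⁻¹) with hΦ
  have hΨ1 : ∀ i, Ψ i ∈ ordGE n 1 := compose_mem_ordGE hU1 hP1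
  have hΦ1 : ∀ i, Φ i ∈ ordGE n 1 := compose_mem_ordGE hQ1 hW1
  have hinv : AreInverse Φ Ψ := by
    refine ⟨fun i => mem_ordGE_one.mp (hΦ1 i), fun i => mem_ordGE_one.mp (hΨ1 i), ?_, ?_⟩
    · rw [hΦ, compose_assoc hQ1 hΨ1, hΨ, ← compose_assoc hP1 hU1,
        compose_linearField_linearField, Matrix.nonsing_inv_mul P hP, linearField_one,
        compose_X_left hU1, hWU]
    · rw [hΨ, compose_assoc hU1 hΦ1, hΦ, ← compose_assoc hW1 hQ1, hUW, compose_X_left hQ1,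
        compose_linearField_linearField, Matrix.mul_nonsing_inv P hP, linearField_one]
  have hTX : TransformsTo Ψ X (linearField A + S) :=
    (transformsTo_linearField hP hX1).comp hP1 hU1 hT
  have hS0 : linearPart S = 0 := linearPart_eq_zero_of_ordGE hS2
  have hNF : IsNormalForm A (linearField A + S) := by
    refine ⟨fun i => mem_ordGE_one.mp (add_mem (linearField_mem_ordGE A i)
      (ordGE_mono one_le_two (hS2 i))), ?_, fun d hd => ?_⟩
    · rw [linearPart_add, linearPart_linearField, hS0, add_zero]
    · rw [homogeneousPart_linearField_add A S (by omega)]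
      exact hS d hd
  -- One statement for both halves: it is used with `β = 1 + α`, and with `β = α` once `S = 0` is
  -- known. The transformation is the same in both.
  have hG' : ∀ β, α ≤ β → (S = 0 ∨ 1 ≤ β) →
      IsGevrey β Φ ∧ IsGevrey β Ψ ∧ IsGevrey β (linearField A + S) := by
    intro β hαβ hcase
    have hβ := hα.trans hαβ
    obtain ⟨hGU, hGS, hGW⟩ := hG β hαβ hcase
    exact ⟨(isGevrey_X_add hGW).compose hβ (isGevrey_linearField β P⁻¹) hQ1,
      (isGevrey_linearField β P).compose hβ (isGevrey_X_add hGU) hU1,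
      fun i => (isGevrey_linearField β A i).add (hGS i)⟩
  refine ⟨U, Φ, Ψ, linearField A + S, ⟨fun i => mem_ordGE_one.mp (ordGE_mono one_le_two (hU2 i)),
    linearPart_eq_zero_of_ordGE hU2, hU⟩, funext fun i => compose_linearField hU1 P i, hinv, hTX,
    hNF, hG' (1 + α) (by linarith) (Or.inr (by linarith)), fun hlin => ?_⟩
  have hXA := eq_linearField_of_isFormallyLinearizable hinv hTX hNF hlin
  obtain ⟨h1, h2, h3⟩ := hG' α le_rfl (Or.inl (add_eq_left.mp hXA))
  exact ⟨h1, h2, h3, hXA⟩
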